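/- Let $k,m\ge 1$ be integers. For $a\in(0,1)$ let $$L^k_m(a)=\inf_f\ \sup_{a\le|x|\le1}|\operatorname{sgn}(x)-f(x)|,$$ where $f$ runs over all functions $f(x)=\sum_{j=-(2k-1)}^{2m-1}a_jx^j$ with real coefficients. For $B>0$ let $\Omega^k_m(B)$ be the half-strip $\{u+iv:\ 0<u<(k+m)\pi,\ v>0\}$ with the region $$\Big\{u+iv:\ |u-\pi k|\le\arccos\Big(\frac{\cosh B}{\cosh v}\Big),\ v\ge B\Big\}$$ removed, and let $\infty_1$ and $\infty_2$ be its infinite boundary points to the left and to the right of the removed region. Then for every $B>0$ there is a unique conformal map $\phi(\cdot\,;k,m;B)$ of the open first quadrant onto $\Omega^k_m(B)$ with the boundary values $\phi(0)=\infty_1$, $\phi(1)=(k+m)\pi$, $\phi(\infty)=\infty_2$. There is exactly one point $a=a(B)>0$ at which it has the boundary value $\phi(a)=0$; it lies in $(0,1)$. The function $B\mapsto a(B)$ is continuous and strictly increasing on $(0,\infty)$, with $\lim_{B\to0}a(B)=0$ and $\lim_{B\to\infty}a(B)=1$; let $B^k_m:(0,1)\to(0,\infty)$ be its inverse function. For every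 $a\in(0,1)$ the error of the best approximation is $$L^k_m(a)=\frac1{\cosh B^k_m(a)}.$$ There is exactly one extremal function $f$ (that is, one at which the infimum is attained). It is odd, and, with $\phi(x;k,m;B)$ denoting the boundary value of $\phi$ at $x$, $$f(x)=1-(-1)^kL^k_m(a)\cos\phi\big(x;k,m;B^k_m(a)\big),\qquad x>0.$$ -/

import Mathlib

open Set Filter Topology

noncomputable section

namespace SgnApprox

/-- The set `[-1, -a] ∪ [a, 1]`. -/
def twoIntervals (a : ℝ) : Set ℝ := {x | |x| ∈ Icc a 1}

/-- The functions `a_{-(2k-1)} x^{-(2k-1)} + ... + a_{2m-1} x^{2m-1}` with real coefficients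
(all integer exponents between `-(2k-1)` and `2m-1` are allowed). -/
def approximants (k m : ℕ) : Set (ℝ → ℝ) :=
  {f | ∃ c : ℤ → ℝ, f = fun x : ℝ =>
    ∑ j ∈ Finset.Icc (-(2 * (k : ℤ) - 1)) (2 * (m : ℤ) - 1), c j * x ^ j}

/-- The uniform distance of `f` from the sign function on `[-1, -a] ∪ [a, 1]`. -/
def deviation (a : ℝ) (f : ℝ → ℝ) : ℝ :=
  sSup ((fun x : ℝ => |Real.sign x - f x|) '' twoIntervals a)

/-- The error `L^k_m(a)` of the best approximation. -/
def bestError (k m : ℕ) (a : ℝ) : ℝ := sInf (deviation a '' approximants k m)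

/-- The open first quadrant. -/
def quadrant : Set ℂ := {z | 0 < z.re ∧ 0 < z.im}

/-- The half-strip `0 < u < (k+m)π`, `v > 0` (with `w = u + iv`) without the region
`|u - πk| ≤ arccos (cosh B / cosh v)`, `v ≥ B`. -/
def domainΩ (k m : ℕ) (B : ℝ) : Set ℂ :=
  {w | 0 < w.im ∧ 0 < w.re ∧ w.re < ((k : ℝ) + m) * Real.pi} \
    {w | |w.re - Real.pi * k| ≤ Real.arccos (Real.cosh B / Real.cosh w.im) ∧ B ≤ w.im}

/-- `φ` is a conformal map of the first quadrant onto `domainΩ k m B` with the boundary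
correspondence `φ(0) = ∞₁`, `φ(1) = (k+m)π`, `φ(∞) = ∞₂`. Here `∞₁` and `∞₂` are the infinite
boundary points of the domain to the left and to the right of the removed region. -/
structure IsNormalizedMap (k m : ℕ) (B : ℝ) (φ : ℂ → ℂ) : Prop where
  holo : DifferentiableOn ℂ φ quadrant
  bij : BijOn φ quadrant (domainΩ k m B)
  zero_im : Tendsto (fun z => (φ z).im) (𝓝[quadrant] 0) atTop
  zero_left : ∀ᶠ z in 𝓝[quadrant] 0, (φ z).re < Real.pi * k
  one : Tendsto φ (𝓝[quadrant] 1) (𝓝 ((((k : ℝ) + m) * Real.pi : ℝ) : ℂ))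
  infty_im : Tendsto (fun z => (φ z).im) (Bornology.cobounded ℂ ⊓ 𝓟 quadrant) atTop
  infty_right : ∀ᶠ z in Bornology.cobounded ℂ ⊓ 𝓟 quadrant, Real.pi * k < (φ z).re

/-- The boundary value of `φ` (a function on the quadrant) at the point `x` of the real axis
is `w`. -/
def HasBoundaryValue (φ : ℂ → ℂ) (x : ℝ) (w : ℂ) : Prop :=
  Tendsto φ (𝓝[quadrant] (x : ℂ)) (𝓝 w)

end SgnApprox

end

noncomputable section

namespace SgnApprox

/-! Throughout, `k + 1` and `m + 1` replace the `k` and `m` of the theorem, so that the odd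
competitors have `N = k + m + 2` coefficients and exponents from `-(2k+1)` to `2m+1`. Averaging
`f(x)` and `-f(-x)` reduces the problem to approximating `1` on `[a, 1]` by such odd functions.

These functions form a Chebyshev system on the positive axis. A best approximation exists by
compactness. Separation, Carathéodory and Vandermonde give a positive measure on `N + 1` extremal
points, weighted by the error, that annihilates all competitors (`IsBest.exists_isCertificate`).
This yields both uniqueness and alternation.

The alternation determines the whole function (`IsCertificate.isExtremal`). Up to a power of `x`, `x
f'(x)` is a polynomial in `x²` of degree `k + m + 1`, and the interior alternation points use up all
its zeros; hence `a` and `1` are alternation points and `f` is monotone between consecutive ones. An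
argument count along the imaginary axis, where `f` is purely imaginary, shows that for `γ` in `(1 -
L, 1 + L)` the equation `f = γ` has exactly `k + m + 2` roots in the right half-plane. The
alternation already supplies that many real ones. So the normalized error `±(1 - f)/L` omits `[-1,
1]` on the open quadrant, and `cos Φ = ±(1 - f)/L` can be solved there by a holomorphic `Φ` with
positive imaginary part. In the coordinate `s = log z` the quadrant is the strip `0 < Im s < π/2`,
and `Φ` extends continuously to its closure (`IsExtremal.exists_isLift`).

The boundary values can be read off. The real axis goes to the two vertical sides and the base of
the half-strip. On the imaginary axis the real part of the error is `±1/L`, which is the equation of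
the curve `|u - π(k+1)| = arccos (cosh B / cosh v)` with `cosh B = 1/L`. On both edges `Re Φ`
increases, and Phragmén–Lindelöf carries this inside (`IsExtremal.re_le_re_add`). So `Re Φ' > 0`,
which makes `Φ` univalent; an open-closed argument identifies its image with the domain
(`IsExtremal.image_eq`). A normalized map is unique because a disc automorphism with three boundary
fixed points is the identity.

Finally, the error decreases strictly in `a` and takes every value in `(0, 1)`
(`IsSolution.lt_of_lt`, `exists_isSolution_of_error`). Thus `L = 1/cosh B` sets up an increasing
bijection between `B` and `a`, and its continuity and limits follow from monotonicity and
surjectivity. -/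

/-- The odd Laurent polynomial `∑ c_j x^{2j-(2k+1)}`. -/
def oddLaurent (k : ℕ) {N : ℕ} (c : Fin N → ℝ) (x : ℝ) : ℝ :=
  ∑ j, c j * ((x ^ 2) ^ (j : ℕ) / x ^ (2 * k + 1))

/-! ### Existence of best approximations by odd Laurent polynomials -/

section Approximation

variable {k N : ℕ}

theorem oddLaurent_eq_div (c : Fin N → ℝ) (x : ℝ) :
    oddLaurent k c x = (∑ j, c j * (x ^ 2) ^ (j : ℕ)) / x ^ (2 * k + 1) := by
  simp only [oddLaurent, Finset.sum_div, mul_div_assoc]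

theorem oddLaurent_add (c d : Fin N → ℝ) (x : ℝ) :
    oddLaurent k (c + d) x = oddLaurent k c x + oddLaurent k d x := by
  simp only [oddLaurent, Pi.add_apply, add_mul, Finset.sum_add_distrib]

theorem oddLaurent_smul (t : ℝ) (c : Fin N → ℝ) (x : ℝ) :
    oddLaurent k (t • c) x = t * oddLaurent k c x := by
  simp only [oddLaurent, Pi.smul_apply, smul_eq_mul, Finset.mul_sum, mul_assoc]

theorem oddLaurent_neg (c : Fin N → ℝ) (x : ℝ) : oddLaurent k c (-x) = -oddLaurent k c x := by
  rw [oddLaurent_eq_div, oddLaurent_eq_div, neg_sq, Odd.neg_pow ⟨k, rfl⟩, div_neg]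

theorem continuous_oddLaurent_left (x : ℝ) :
    Continuous fun c : Fin N → ℝ => oddLaurent k c x := by
  unfold oddLaurent; fun_prop

theorem continuousOn_oddLaurent (c : Fin N → ℝ) : ContinuousOn (oddLaurent k c) (Ioi 0) := by
  unfold oddLaurent
  refine continuousOn_finsetSum _ fun j _ => continuousOn_const.mul ?_
  exact ContinuousOn.div (by fun_prop) (by fun_prop) fun x hx => (pow_pos hx _).ne'

/-- Vandermonde in the squares of the points: this is the Chebyshev property on which everything
rests. -/
theorem coeff_eq_zero_of_oddLaurent_eq_zero {c : Fin N → ℝ} {x : Fin N → ℝ}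
    (hx : Function.Injective x) (hpos : ∀ i, 0 < x i) (h : ∀ i, oddLaurent k c (x i) = 0) :
    c = 0 := by
  refine Matrix.eq_zero_of_forall_index_sum_mul_pow_eq_zero (f := fun i => x i ^ 2) ?_ fun i => ?_
  · intro i j hij
    exact hx ((pow_left_inj₀ (hpos i).le (hpos j).le two_ne_zero).1 hij)
  · have := h i
    rw [oddLaurent_eq_div, div_eq_zero_iff] at this
    exact this.resolve_right (pow_pos (hpos i) _).ne'

/-- Coefficients of approximants that are bounded on varying intervals have a limit point. -/
theorem exists_limit_coeff {a M : ℝ} (ha : 0 ≤ a) (ha1 : a < 1) {α μ : ℕ → ℝ}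
    (hα : Tendsto α atTop (𝓝 a)) (hμ : Tendsto μ atTop (𝓝 M)) (c : ℕ → Fin N → ℝ)
    (hc : ∀ n, ∀ x ∈ Icc (α n) 1, |1 - oddLaurent k (c n) x| ≤ μ n) :
    ∃ c' : Fin N → ℝ, ∀ x ∈ Ioc a 1, |1 - oddLaurent k c' x| ≤ M := by
  -- Evaluation at `N` points of `[b, 1]` is injective on coefficients, hence bounded below, so
  -- bounds on the values bound the coefficients. Since `b > a`, these points eventually lie in the
  -- varying intervals.
  set b := (1 + a) / 2 with hb
  have hab : a < b := by linarith
  have hb1 : b < 1 := by linarith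
  obtain ⟨s, hs, hsc⟩ := (Icc_infinite hb1).exists_subset_card_eq N
  let x : Fin N → ℝ := fun i => s.orderEmbOfFin hsc i
  have hxm : ∀ i, x i ∈ Icc b 1 := fun i => hs (s.orderEmbOfFin_mem hsc i)
  have hxi : Function.Injective x := (s.orderEmbOfFin hsc).injective
  let T : (Fin N → ℝ) →ₗ[ℝ] (Fin N → ℝ) :=
    { toFun := fun c i => oddLaurent k c (x i)
      map_add' := fun c d => funext fun i => oddLaurent_add c d _
      map_smul' := fun t c => funext fun i => by simp [oddLaurent_smul] }
  have hT : LinearMap.ker T = ⊥ := by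
    rw [LinearMap.ker_eq_bot']
    intro d hd
    exact coeff_eq_zero_of_oddLaurent_eq_zero hxi (fun i => by linarith [(hxm i).1])
      fun i => congrFun hd i
  obtain ⟨K, -, hK⟩ := T.exists_antilipschitzWith hT
  have hev : ∀ᶠ n in atTop, α n < b ∧ μ n < M + 1 :=
    (hα.eventually_lt_const hab).and (hμ.eventually_lt_const (by linarith))
  have hbd : ∀ᶠ n in atTop, c n ∈ Metric.closedBall (0 : Fin N → ℝ) (K * (|M| + 2)) := by
    filter_upwards [hev] with n hn
    rw [mem_closedBall_zero_iff]
    have h1 : ‖c n‖ ≤ K * ‖T (c n)‖ := by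
      simpa using hK.le_mul_dist (c n) 0
    refine h1.trans (mul_le_mul_of_nonneg_left ?_ K.2)
    rw [pi_norm_le_iff_of_nonneg (by positivity)]
    intro i
    have h2 := hc n (x i) ⟨hn.1.le.trans (hxm i).1, (hxm i).2⟩
    change |oddLaurent k (c n) (x i)| ≤ _
    have := abs_le.1 h2
    rw [abs_le]
    constructor <;> linarith [le_abs_self M, this.1, this.2]
  obtain ⟨c', -, φ, hφ, hlim⟩ :=
    tendsto_subseq_of_frequently_bounded Metric.isBounded_closedBall hbd.frequently
  refine ⟨c', fun y hy => ?_⟩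
  have h1 : Tendsto (fun n => |1 - oddLaurent k (c (φ n)) y|) atTop
      (𝓝 |1 - oddLaurent k c' y|) :=
    ((((continuous_oddLaurent_left y).tendsto c').comp hlim).const_sub 1).abs
  refine le_of_tendsto_of_tendsto h1 (hμ.comp hφ.tendsto_atTop) ?_
  filter_upwards [hφ.tendsto_atTop.eventually (hα.eventually_lt_const hy.1)] with n hn
  exact hc _ y ⟨hn.le, hy.2⟩

theorem continuousOn_oddLaurent_Icc {a : ℝ} (ha : 0 < a) (c : Fin N → ℝ) :
    ContinuousOn (oddLaurent k c) (Icc a 1) :=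
  (continuousOn_oddLaurent c).mono fun _ hx => ha.trans_le hx.1

/-- `c` is a best approximation of `1` on `[a, 1]`, and `M` is its error. -/
def IsBest (k : ℕ) {N : ℕ} (a M : ℝ) (c : Fin N → ℝ) : Prop :=
  (∀ x ∈ Icc a 1, |1 - oddLaurent k c x| ≤ M) ∧
    ∀ c' : Fin N → ℝ, ∃ x ∈ Icc a 1, M ≤ |1 - oddLaurent k c' x|

theorem exists_isBest (k N : ℕ) {a : ℝ} (ha : 0 < a) (ha1 : a < 1) :
    ∃ (M : ℝ) (c : Fin N → ℝ), IsBest k a M c := by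
  have hmax : ∀ c' : Fin N → ℝ, ∃ x ∈ Icc a 1, ∀ y ∈ Icc a 1,
      |1 - oddLaurent k c' y| ≤ |1 - oddLaurent k c' x| := fun c' =>
    isCompact_Icc.exists_isMaxOn (nonempty_Icc.2 ha1.le)
      (continuousOn_const.sub (continuousOn_oddLaurent_Icc ha c')).abs
  let S : Set ℝ := {M | ∃ c : Fin N → ℝ, ∀ x ∈ Icc a 1, |1 - oddLaurent k c x| ≤ M}
  have hSne : S.Nonempty := by
    obtain ⟨x, -, hx⟩ := hmax 0
    exact ⟨_, 0, hx⟩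
  have hSb : BddBelow S := ⟨0, by
    rintro M ⟨c, hc⟩
    exact (abs_nonneg _).trans (hc 1 ⟨ha1.le, le_rfl⟩)⟩
  obtain ⟨u, -, hu, huS⟩ := exists_seq_tendsto_sInf hSne hSb
  choose c hc using huS
  obtain ⟨c', hc'⟩ := exists_limit_coeff ha.le ha1 tendsto_const_nhds hu c hc
  refine ⟨sInf S, c', ?_, fun d => ?_⟩
  -- The limit function is controlled only on `(a, 1]`; continuity adds the left endpoint.
  · have hcl : Icc a 1 ⊆ closure (Ioc a 1) := by rw [closure_Ioc ha1.ne]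
    intro x hx
    have h1 : ContinuousWithinAt (fun x => |1 - oddLaurent k c' x|) (Ioc a 1) x :=
      ((continuousOn_const.sub (continuousOn_oddLaurent_Icc ha c')).abs x hx).mono Ioc_subset_Icc_self
    have := mem_closure_iff_nhdsWithin_neBot.1 (hcl hx)
    exact le_of_tendsto h1 (eventually_mem_nhdsWithin.mono hc')
  · obtain ⟨x, hx, hxm⟩ := hmax d
    exact ⟨x, hx, csInf_le hSb ⟨d, hxm⟩⟩

/-- The convex hull of a compact subset of a finite-dimensional space is compact. -/
theorem isCompact_convexHull_pi {K : Set (Fin N → ℝ)} (hK : IsCompact K) :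
    IsCompact (convexHull ℝ K) := by
  rcases K.eq_empty_or_nonempty with rfl | ⟨z₀, hz₀⟩
  · simp
  -- By Carathéodory, `N + 1` points suffice, so the hull is a continuous image of a simplex times a
  -- power of `K`. Shorter combinations are padded with `z₀` and weight `0`.
  have key : convexHull ℝ K = (fun q : (Fin (N + 1) → ℝ) × (Fin (N + 1) → Fin N → ℝ) =>
      ∑ i, q.1 i • q.2 i) '' (stdSimplex ℝ (Fin (N + 1)) ×ˢ Set.univ.pi fun _ => K) := by
    apply Subset.antisymm
    · intro x hx
      obtain ⟨ι, _, z, w, hz, hai, hw, hw1, hwx⟩ := eq_pos_convex_span_of_mem_convexHull hx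
      have hcard : Fintype.card ι ≤ Fintype.card (Fin (N + 1)) := by
        have := hai.card_le_finrank_succ
        have h2 := Submodule.finrank_le (vectorSpan ℝ (range z))
        simp only [Module.finrank_fin_fun, Fintype.card_fin] at *
        omega
      obtain ⟨e⟩ := Function.Embedding.nonempty_of_card_le hcard
      classical
      have hsum : ∀ {E : Type} [AddCommMonoid E] (g : ι → E),
          ∑ i, Function.extend e g 0 i = ∑ i, g i := by
        intro E _ g
        rw [← Finset.sum_subset (Finset.subset_univ (Finset.univ.map e)), Finset.sum_map]
        · simp [e.injective.extend_apply]
        · intro i _ hi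
          rw [Function.extend_apply' _ _ _ (by simpa using hi)]; rfl
      refine ⟨(Function.extend e w 0, Function.extend e z fun _ => z₀), ⟨⟨?_, ?_⟩, ?_⟩, ?_⟩
      · intro i
        by_cases hi : ∃ j, e j = i
        · obtain ⟨j, rfl⟩ := hi
          simpa [e.injective.extend_apply] using (hw j).le
        · simp [Function.extend_apply' _ _ _ hi]
      · rw [hsum, hw1]
      · intro i _
        by_cases hi : ∃ j, e j = i
        · obtain ⟨j, rfl⟩ := hi
          simpa [e.injective.extend_apply] using hz (mem_range_self j)
        · simpa [Function.extend_apply' _ _ _ hi] using hz₀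
      · rw [← hwx, ← hsum]
        refine Finset.sum_congr rfl fun i _ => ?_
        by_cases hi : ∃ j, e j = i
        · obtain ⟨j, rfl⟩ := hi
          simp [e.injective.extend_apply]
        · simp [Function.extend_apply' _ _ _ hi]
    · rintro _ ⟨⟨w, z⟩, ⟨hw, hz⟩, rfl⟩
      exact (convex_convexHull ℝ K).sum_mem (fun i _ => hw.1 i) hw.2
        fun i _ => subset_convexHull ℝ K (hz i (mem_univ i))
  rw [key]
  exact ((isCompact_stdSimplex ℝ _).prod (isCompact_univ_pi fun _ => hK)).image (by fun_prop)

end Approximation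

/-! ### Annihilating measures and alternation -/

section Certificate

variable {k N : ℕ}

/-- If a direction `d` correlates positively with the error at all its extremal points, the error
can be decreased. -/
theorem IsBest.exists_extremal_nonpos {a M : ℝ} (ha : 0 < a) (hM : 0 < M) {c : Fin N → ℝ}
    (h : IsBest k a M c) (d : Fin N → ℝ) :
    ∃ x ∈ Icc a 1, |1 - oddLaurent k c x| = M ∧
      (1 - oddLaurent k c x) * oddLaurent k d x ≤ 0 := by
  have hx : ∀ n : ℕ, ∃ x ∈ Icc a 1,
      M ≤ |1 - oddLaurent k c x - 1 / ((n : ℝ) + 1) * oddLaurent k d x| := by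
    intro n
    obtain ⟨x, hx, hxM⟩ := h.2 (c + (1 / ((n : ℝ) + 1)) • d)
    exact ⟨x, hx, by rwa [oddLaurent_add, oddLaurent_smul, ← sub_sub] at hxM⟩
  choose x hx hxM using hx
  obtain ⟨y, hy, φ, hφ, hlim⟩ := isCompact_Icc.tendsto_subseq hx
  have hlim' : Tendsto (x ∘ φ) atTop (𝓝[Icc a 1] y) :=
    tendsto_nhdsWithin_iff.2 ⟨hlim, Eventually.of_forall fun n => hx _⟩
  have hcont : ∀ c' : Fin N → ℝ, Tendsto (fun n => oddLaurent k c' (x (φ n))) atTop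
      (𝓝 (oddLaurent k c' y)) := fun c' =>
    (continuousOn_oddLaurent_Icc ha c' y hy).tendsto.comp hlim'
  have h0 : Tendsto (fun n => 1 / ((φ n : ℝ) + 1)) atTop (𝓝 0) :=
    tendsto_one_div_add_atTop_nhds_zero_nat.comp hφ.tendsto_atTop
  refine ⟨y, hy, le_antisymm (h.1 y hy) ?_, ?_⟩
  · have h1 := ((((hcont c).const_sub 1).sub (h0.mul (hcont d))).abs)
    rw [zero_mul, sub_zero] at h1
    exact ge_of_tendsto h1 (Eventually.of_forall fun n => hxM _)
  -- Squaring `|e| ≤ M ≤ |e - t g|`, where `e` is the error and `g` the direction, gives `2 e g ≤ t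
  -- g²`; then `t` tends to `0`.
  · have h1 : Tendsto (fun n => 2 * ((1 - oddLaurent k c (x (φ n))) * oddLaurent k d (x (φ n)))
        - 1 / ((φ n : ℝ) + 1) * oddLaurent k d (x (φ n)) ^ 2) atTop
        (𝓝 (2 * ((1 - oddLaurent k c y) * oddLaurent k d y) - 0 * oddLaurent k d y ^ 2)) :=
      ((((hcont c).const_sub 1).mul (hcont d)).const_mul 2).sub (h0.mul ((hcont d).pow 2))
    have h2 := le_of_tendsto h1 (b := 0) (Eventually.of_forall fun n => by
      have e1 : (1 - oddLaurent k c (x (φ n))) ^ 2 ≤ M ^ 2 :=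
        sq_le_sq' (abs_le.1 (h.1 _ (hx (φ n)))).1 (abs_le.1 (h.1 _ (hx (φ n)))).2
      have e2 : M ^ 2 ≤
          (1 - oddLaurent k c (x (φ n)) - 1 / ((φ n : ℝ) + 1) * oddLaurent k d (x (φ n))) ^ 2 := by
        rw [← sq_abs (1 - oddLaurent k c (x (φ n)) - _)]
        exact pow_le_pow_left₀ hM.le (hxM _) 2
      have ht : 0 < 1 / ((φ n : ℝ) + 1) := by positivity
      set t := 1 / ((φ n : ℝ) + 1)
      set e := 1 - oddLaurent k c (x (φ n))
      set g := oddLaurent k d (x (φ n))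
      by_contra hcon
      push Not at hcon
      nlinarith [mul_pos ht hcon])
    linarith

/-- The points and weights that certify a best approximation: an annihilating discrete measure
supported on an alternation set. -/
structure IsCertificate (k : ℕ) {N : ℕ} (a M : ℝ) (c : Fin N → ℝ) (x w : Fin (N + 1) → ℝ) :
    Prop where
  strictMono : StrictMono x
  mem : ∀ i, x i ∈ Icc a 1
  extremal : ∀ i, |1 - oddLaurent k c (x i)| = M
  pos : ∀ i, 0 < w i
  annihilates : ∀ d : Fin N → ℝ,
    ∑ i, w i * (1 - oddLaurent k c (x i)) * oddLaurent k d (x i) = 0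

/-- If `0` were not in the convex hull of the evaluation vectors weighted by the error at the
extremal points, a separating functional would be a direction along which the error could be
decreased. Carathéodory bounds the number of points by `N + 1`, and Vandermonde shows that `N`
points cannot carry an annihilating measure. -/
theorem IsBest.exists_isCertificate {a M : ℝ} (ha : 0 < a) (hM : 0 < M) {c : Fin N → ℝ}
    (h : IsBest k a M c) : ∃ x w, IsCertificate k a M c x w := by
  let v : ℝ → Fin N → ℝ := fun x j => (x ^ 2) ^ (j : ℕ) / x ^ (2 * k + 1)
  let Θ : ℝ → Fin N → ℝ := fun x => (1 - oddLaurent k c x) • v x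
  let E : Set ℝ := Icc a 1 ∩ (fun x => |1 - oddLaurent k c x|) ⁻¹' {M}
  have hcE := (continuousOn_const (c := (1 : ℝ))).sub (continuousOn_oddLaurent_Icc (k := k) ha c)
  have hE : IsCompact E :=
    isCompact_Icc.of_isClosed_subset
      (hcE.abs.preimage_isClosed_of_isClosed isClosed_Icc isClosed_singleton) inter_subset_left
  have hΘ : ContinuousOn Θ E := by
    refine ContinuousOn.smul (hcE.mono inter_subset_left) ?_
    refine continuousOn_pi.2 fun j => ContinuousOn.div (by fun_prop) (by fun_prop) fun x hx => ?_
    exact (pow_pos (ha.trans_le hx.1.1) _).ne'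
  have h0 : (0 : Fin N → ℝ) ∈ convexHull ℝ (Θ '' E) := by
    by_contra hcon
    obtain ⟨φ, u, hφ0, hφ⟩ := geometric_hahn_banach_point_closed (convex_convexHull ℝ (Θ '' E))
      (isCompact_convexHull_pi (hE.image_of_continuousOn hΘ)).isClosed hcon
    obtain ⟨x, hx, hxM, hle⟩ := h.exists_extremal_nonpos ha hM fun j => φ (Pi.single j 1)
    have h1 := hφ (Θ x) (subset_convexHull ℝ _ ⟨x, ⟨hx, hxM⟩, rfl⟩)
    have h2 : φ (Θ x) = (1 - oddLaurent k c x) *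
        oddLaurent k (fun j => φ (Pi.single j 1)) x := by
      rw [map_smul, smul_eq_mul]
      congr 1
      conv_lhs => rw [← Finset.univ_sum_single (v x)]
      rw [map_sum]
      refine Finset.sum_congr rfl fun j _ => ?_
      have : (Pi.single j (v x j) : Fin N → ℝ) = v x j • Pi.single j (1 : ℝ) := by
        rw [← Pi.single_smul, smul_eq_mul, mul_one]
      rw [this, map_smul, smul_eq_mul, mul_comm]
    rw [map_zero] at hφ0
    linarith
  obtain ⟨ι, _, z, w, hz, hai, hw, hw1, hwx⟩ := eq_pos_convex_span_of_mem_convexHull h0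
  choose x hxE hxz using fun i => hz (mem_range_self i)
  have hxi : Function.Injective x := by
    intro i j hij
    exact hai.injective (by rw [← hxz i, ← hxz j, hij])
  have hxpos : ∀ i, 0 < x i := fun i => ha.trans_le (hxE i).1.1
  have hann : ∀ j : Fin N,
      ∑ i, w i * (1 - oddLaurent k c (x i)) / x i ^ (2 * k + 1) * (x i ^ 2) ^ (j : ℕ) = 0 := by
    intro j
    have := congrFun hwx j
    rw [Finset.sum_apply] at this
    rw [← show _ = (0 : ℝ) from this]
    refine Finset.sum_congr rfl fun i _ => ?_
    rw [← hxz i]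
    simp only [Θ, v, Pi.smul_apply, smul_eq_mul]
    ring
  have hcard1 : Fintype.card ι ≤ N + 1 := by
    have := hai.card_le_finrank_succ
    have h2 := Submodule.finrank_le (vectorSpan ℝ (range z))
    simp only [Module.finrank_fin_fun] at *
    omega
  have hcard2 : N < Fintype.card ι := by
    by_contra hcon
    push Not at hcon
    let e := (Fintype.equivFin ι).symm
    have := Matrix.eq_zero_of_forall_pow_sum_mul_pow_eq_zero (f := fun i => x (e i) ^ 2)
      (v := fun i => w (e i) * (1 - oddLaurent k c (x (e i))) / x (e i) ^ (2 * k + 1)) ?_ ?_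
    · have hne : Nonempty ι := by
        by_contra hem
        rw [not_nonempty_iff] at hem
        simp at hw1
      obtain ⟨i⟩ := hne
      have h1 := congrFun this (e.symm i)
      simp only [Equiv.apply_symm_apply, Pi.zero_apply, div_eq_zero_iff, mul_eq_zero,
        (hw i).ne', (pow_pos (hxpos i) (2 * k + 1)).ne', or_false, false_or] at h1
      have h2 : |1 - oddLaurent k c (x i)| = M := (hxE i).2
      rw [h1, abs_zero] at h2
      exact hM.ne h2
    · intro i j hij
      exact e.injective (hxi ((pow_left_inj₀ (hxpos _).le (hxpos _).le two_ne_zero).1 hij))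
    · intro j
      rw [← hann ⟨j, j.2.trans_le hcon⟩]
      exact e.sum_comp fun i =>
        w i * (1 - oddLaurent k c (x i)) / x i ^ (2 * k + 1) * (x i ^ 2) ^ (j : ℕ)
  have hcard : (Finset.univ.image x).card = N + 1 := by
    rw [Finset.card_image_of_injective _ hxi, Finset.card_univ]; omega
  let X := (Finset.univ.image x).orderEmbOfFin hcard
  have hX : ∀ i, ∃ j, x j = X i := fun i => by
    obtain ⟨j, -, hj⟩ := Finset.mem_image.1 (Finset.orderEmbOfFin_mem (Finset.univ.image x) hcard i)
    exact ⟨j, hj⟩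
  choose σ hσ using hX
  have hσi : Function.Injective σ := fun i j hij =>
    X.injective (by rw [← hσ i, ← hσ j, hij])
  have hσb : Function.Bijective σ :=
    (Fintype.bijective_iff_injective_and_card σ).2 ⟨hσi, by rw [Fintype.card_fin]; omega⟩
  refine ⟨X, w ∘ σ, X.strictMono, fun i => ?_, fun i => ?_, fun i => hw _, fun d => ?_⟩
  · rw [← hσ i]; exact (hxE _).1
  · rw [← hσ i]; exact (hxE _).2
  · simp only [← hσ, Function.comp_apply]
    rw [hσb.sum_comp fun i => w i * (1 - oddLaurent k c (x i)) * oddLaurent k d (x i)]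
    simp only [oddLaurent, Finset.mul_sum]
    rw [Finset.sum_comm]
    refine Finset.sum_eq_zero fun j _ => ?_
    rw [← mul_zero (d j), ← hann j, Finset.mul_sum]
    refine Finset.sum_congr rfl fun i _ => ?_
    rw [← oddLaurent]
    ring

variable {a M : ℝ} {c : Fin N → ℝ} {x w : Fin (N + 1) → ℝ}

/-- A competitor with no larger error at the certifying points has the same error there. -/
theorem IsCertificate.eq_of_le (h : IsCertificate k a M c x w) {d : Fin N → ℝ}
    (hd : ∀ i, |1 - oddLaurent k d (x i)| ≤ M) (i : Fin (N + 1)) :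
    oddLaurent k d (x i) = oddLaurent k c (x i) := by
  have hsum : ∑ i, w i * (1 - oddLaurent k c (x i)) *
      (oddLaurent k d (x i) - oddLaurent k c (x i)) = 0 := by
    have := (congrArg₂ (· - ·) (h.annihilates d) (h.annihilates c))
    simpa [← Finset.sum_sub_distrib, ← mul_sub] using this
  -- At an extremal point the competitor can differ from `c` only in the direction of the error. A
  -- vanishing sum of nonnegative terms then forces equality everywhere.
  have hle : ∀ i, 0 ≤ (1 - oddLaurent k c (x i)) *
      (oddLaurent k d (x i) - oddLaurent k c (x i)) := by
    intro i
    have h1 := abs_le.1 (hd i)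
    rcases (abs_eq_abs (a := 1 - oddLaurent k c (x i)) (b := M)).1 (by
      rw [h.extremal i, abs_of_nonneg ((abs_nonneg _).trans (hd i))]) with h2 | h2
    · nlinarith
    · nlinarith
  have h1 := (Finset.sum_eq_zero_iff_of_nonneg (fun i _ => by
    rw [mul_assoc]; exact mul_nonneg (h.pos i).le (hle i))).1 hsum i (Finset.mem_univ i)
  rw [mul_assoc, mul_eq_zero, mul_eq_zero] at h1
  rcases h1 with h1 | h1 | h1
  · exact absurd h1 (h.pos i).ne'
  · have hM0 : M = 0 := by rw [← h.extremal i, h1, abs_zero]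
    have := abs_le.1 (hd i)
    linarith
  · linarith

/-- Agreement at any `N` of the `N + 1` certifying points suffices. The competitor is compared only
at these points, which later allows comparison across different intervals. -/
theorem IsCertificate.coeff_eq (h : IsCertificate k a M c x w) (ha : 0 < a) {d : Fin N → ℝ}
    (hd : ∀ i, |1 - oddLaurent k d (x i)| ≤ M) : d = c := by
  have : d + (-1 : ℝ) • c = 0 :=
    coeff_eq_zero_of_oddLaurent_eq_zero (k := k) (x := fun i => x (Fin.castSucc i))
      (h.strictMono.injective.comp (Fin.castSucc_injective N))
      (fun i => ha.trans_le (h.mem _).1) fun i => by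
        rw [oddLaurent_add, oddLaurent_smul, h.eq_of_le hd]; ring
  rwa [neg_one_smul, ← sub_eq_add_neg, sub_eq_zero] at this

/-- The errors at consecutive certifying points have opposite signs. -/
theorem IsCertificate.mul_neg (h : IsCertificate k a M c x w) (ha : 0 < a) (hM : 0 < M)
    (i : Fin N) :
    (1 - oddLaurent k c (x i.castSucc)) * (1 - oddLaurent k c (x i.succ)) < 0 := by
  classical
  have hpos : ∀ i, 0 < x i := fun i => ha.trans_le (h.mem _).1
  have hne : i.castSucc ≠ i.succ := (Fin.castSucc_lt_succ).ne
  -- The test function has numerator `q(x²)`, where `q` has degree `N - 1` and vanishes at the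
  -- squares of all points except two neighbours. It has the same sign at both, so the two surviving
  -- terms cancel only if the errors have opposite signs.
  let S : Finset (Fin (N + 1)) := (Finset.univ.erase i.castSucc).erase i.succ
  let q : Polynomial ℝ := ∏ l ∈ S, (Polynomial.X - Polynomial.C (x l ^ 2))
  have hS : S.card = N - 1 := by
    rw [Finset.card_erase_of_mem (by simp [hne.symm]), Finset.card_erase_of_mem (by simp)]
    simp
  have hq : q.natDegree < N := by
    rw [Polynomial.natDegree_prod_of_monic _ _ fun l _ => Polynomial.monic_X_sub_C _]
    simp only [Polynomial.natDegree_X_sub_C, Finset.sum_const, hS, smul_eq_mul, mul_one]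
    have := i.pos
    omega
  have heval : ∀ y, q.eval (y ^ 2) = ∑ j : Fin N, q.coeff j * (y ^ 2) ^ (j : ℕ) := fun y => by
    rw [Polynomial.eval_eq_sum_range' hq, Finset.sum_range]
  have hann := h.annihilates fun j => q.coeff j
  simp only [oddLaurent_eq_div (fun j : Fin N => q.coeff j), ← heval] at hann
  have hzero : ∀ l ∈ S, q.eval (x l ^ 2) = 0 := by
    intro l hl
    simp only [q, Polynomial.eval_prod]
    exact Finset.prod_eq_zero hl (by simp)
  rw [← Finset.add_sum_erase _ _ (Finset.mem_univ i.castSucc),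
    ← Finset.add_sum_erase _ _ (show i.succ ∈ Finset.univ.erase i.castSucc by simp [hne.symm]),
    Finset.sum_eq_zero (s := (Finset.univ.erase i.castSucc).erase i.succ) fun l hl => by
      rw [hzero l hl, zero_div, mul_zero]] at hann
  have hqq : 0 < q.eval (x i.castSucc ^ 2) * q.eval (x i.succ ^ 2) := by
    simp only [q, Polynomial.eval_prod, ← Finset.prod_mul_distrib]
    refine Finset.prod_pos fun l hl => ?_
    simp only [Polynomial.eval_sub, Polynomial.eval_X, Polynomial.eval_C]
    simp only [S, Finset.mem_erase, Finset.mem_univ, and_true] at hl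
    have hlt : x i.castSucc ^ 2 < x i.succ ^ 2 :=
      pow_lt_pow_left₀ (h.strictMono Fin.castSucc_lt_succ) (hpos _).le two_ne_zero
    rcases lt_or_gt_of_ne hl.2 with h1 | h1
    · have : x l ^ 2 < x i.castSucc ^ 2 :=
        pow_lt_pow_left₀ (h.strictMono h1) (hpos _).le two_ne_zero
      exact mul_pos (by linarith) (by linarith)
    · have h2 : i.succ < l := lt_of_le_of_ne (Fin.castSucc_lt_iff_succ_le.1 h1) (Ne.symm hl.1)
      have : x i.succ ^ 2 < x l ^ 2 :=
        pow_lt_pow_left₀ (h.strictMono h2) (hpos _).le two_ne_zero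
      exact mul_pos_of_neg_of_neg (by linarith) (by linarith)
  have e1 := h.extremal i.castSucc
  have e2 := h.extremal i.succ
  have w1 := h.pos i.castSucc
  have w2 := h.pos i.succ
  have p1 := pow_pos (hpos i.castSucc) (2 * k + 1)
  have p2 := pow_pos (hpos i.succ) (2 * k + 1)
  set A := 1 - oddLaurent k c (x i.castSucc)
  set B := 1 - oddLaurent k c (x i.succ)
  set q1 := q.eval (x i.castSucc ^ 2)
  set q2 := q.eval (x i.succ ^ 2)
  have hAB : A * B ≠ 0 := by
    intro h0
    rw [← abs_eq_zero, abs_mul, e1, e2] at h0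
    exact (mul_pos hM hM).ne' h0
  by_contra hcon
  have hAB' : 0 < A * B := lt_of_le_of_ne (not_lt.1 hcon) hAB.symm
  have hB2 : 0 ≤ (B * q2) ^ 2 := sq_nonneg _
  have hB3 : (B * q2) ≠ 0 := mul_ne_zero (right_ne_zero_of_mul hAB) (right_ne_zero_of_mul hqq.ne')
  have h3 : (w i.castSucc * A * (q1 / x i.castSucc ^ (2 * k + 1)) +
      (w i.succ * B * (q2 / x i.succ ^ (2 * k + 1)) + 0)) * (B * q2) =
      w i.castSucc * (A * B) * (q1 * q2) / x i.castSucc ^ (2 * k + 1) +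
      w i.succ * (B * q2) ^ 2 / x i.succ ^ (2 * k + 1) := by ring
  rw [hann, zero_mul] at h3
  have : 0 < w i.castSucc * (A * B) * (q1 * q2) / x i.castSucc ^ (2 * k + 1) +
      w i.succ * (B * q2) ^ 2 / x i.succ ^ (2 * k + 1) := by positivity
  linarith

end Certificate

/-! ### Derivatives, the imaginary axis and inversion -/

section Calculus

variable {k N : ℕ}

/-- The extension of `oddLaurent` to the complex plane. -/
def oddLaurentC (k : ℕ) {N : ℕ} (c : Fin N → ℝ) (z : ℂ) : ℂ :=
  ∑ j, (c j : ℂ) * ((z ^ 2) ^ (j : ℕ) / z ^ (2 * k + 1))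

theorem oddLaurentC_ofReal (c : Fin N → ℝ) (x : ℝ) :
    oddLaurentC k c x = (oddLaurent k c x : ℂ) := by
  simp [oddLaurentC, oddLaurent]

theorem oddLaurentC_eq_div (c : Fin N → ℝ) (z : ℂ) :
    oddLaurentC k c z = (∑ j, (c j : ℂ) * (z ^ 2) ^ (j : ℕ)) / z ^ (2 * k + 1) := by
  simp only [oddLaurentC, Finset.sum_div, mul_div_assoc]

/-- The coefficients of `x f'(x)`, where `f` is the odd Laurent polynomial with coefficients `c`. -/
def eulerCoeff (k : ℕ) {N : ℕ} (c : Fin N → ℝ) (j : Fin N) : ℝ :=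
  (2 * (j : ℕ) - (2 * k + 1) : ℝ) * c j

/-- The coefficients of the odd Laurent polynomial `y ↦ -i f(iy)`. -/
def twist (k : ℕ) {N : ℕ} (c : Fin N → ℝ) (j : Fin N) : ℝ := (-1) ^ (k + 1 + (j : ℕ)) * c j

theorem hasDerivAt_sq_pow_div {𝕜 : Type*} [NontriviallyNormedField 𝕜] (j k : ℕ) {z : 𝕜}
    (hz : z ≠ 0) : HasDerivAt (fun z : 𝕜 => (z ^ 2) ^ j / z ^ (2 * k + 1))
      ((2 * j - (2 * k + 1)) * ((z ^ 2) ^ j / z ^ (2 * k + 1)) / z) z := by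
  have e : (fun z : 𝕜 => (z ^ 2) ^ j / z ^ (2 * k + 1)) =
      fun z => z ^ (2 * j) / z ^ (2 * k + 1) := by
    funext z; rw [← pow_mul]
  rw [e, ← pow_mul]
  have h1 := (hasDerivAt_pow (2 * j) z).div (hasDerivAt_pow (2 * k + 1) z)
    (pow_ne_zero _ hz)
  convert! h1 using 1
  have h2 : ((2 * j : ℕ) : 𝕜) * z ^ (2 * j - 1) = ((2 * j : ℕ) : 𝕜) * z ^ (2 * j) / z := by
    rcases Nat.eq_zero_or_pos j with rfl | hj
    · simp
    · rw [eq_div_iff hz, mul_assoc, ← pow_succ]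
      congr 2; omega
  rw [h2]
  simp only [Nat.add_sub_cancel]
  push_cast
  have h3 : z ^ (2 * k + 1) = z ^ (2 * k) * z := pow_succ _ _
  rw [h3]
  field_simp

theorem hasDerivAt_oddLaurent (c : Fin N → ℝ) {x : ℝ} (hx : x ≠ 0) :
    HasDerivAt (oddLaurent k c) (oddLaurent k (eulerCoeff k c) x / x) x := by
  have := HasDerivAt.fun_sum (u := Finset.univ) fun (j : Fin N) _ =>
    (hasDerivAt_sq_pow_div (j : ℕ) k hx).const_mul (c j)
  convert! this using 1
  simp only [oddLaurent, eulerCoeff, Finset.sum_div]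
  refine Finset.sum_congr rfl fun j _ => by ring

theorem hasDerivAt_oddLaurentC (c : Fin N → ℝ) {z : ℂ} (hz : z ≠ 0) :
    HasDerivAt (oddLaurentC k c) (oddLaurentC k (eulerCoeff k c) z / z) z := by
  have := HasDerivAt.fun_sum (u := Finset.univ) fun (j : Fin N) _ =>
    (hasDerivAt_sq_pow_div (j : ℕ) k hz).const_mul (c j : ℂ)
  convert! this using 1
  simp only [oddLaurentC, eulerCoeff, Finset.sum_div]
  refine Finset.sum_congr rfl fun j _ => by push_cast; ring

theorem eulerCoeff_twist (c : Fin N → ℝ) : eulerCoeff k (twist k c) = twist k (eulerCoeff k c) := by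
  funext j; simp only [eulerCoeff, twist]; ring

theorem eulerCoeff_factor_ne_zero (k j : ℕ) : (2 * j - (2 * k + 1) : ℝ) ≠ 0 := by
  intro h
  have : (2 * j : ℤ) = 2 * k + 1 := by exact_mod_cast sub_eq_zero.1 h
  omega

theorem eq_zero_of_eulerCoeff_eq_zero {c : Fin N → ℝ} (h : eulerCoeff k c = 0) : c = 0 := by
  funext j
  have := congrFun h j
  simp only [eulerCoeff, Pi.zero_apply, mul_eq_zero] at this
  exact this.resolve_left (eulerCoeff_factor_ne_zero k j)

/-- Since `f` is odd with real coefficients, it is purely imaginary on the imaginary axis. This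
drives both the root count and the shape of the removed region. -/
theorem oddLaurentC_I_mul (c : Fin N → ℝ) (y : ℝ) :
    oddLaurentC k c (Complex.I * y) = Complex.I * oddLaurent k (twist k c) y := by
  simp only [oddLaurentC, oddLaurent, twist]
  push_cast
  rw [Finset.mul_sum]
  refine Finset.sum_congr rfl fun j _ => ?_
  have h1 : (Complex.I * y) ^ (2 * k + 1) = (-1) ^ k * Complex.I * y ^ (2 * k + 1) := by
    rw [mul_pow, pow_succ Complex.I, pow_mul, Complex.I_sq]
  have h2 : ((Complex.I * y) ^ 2) ^ (j : ℕ) = (-1) ^ (j : ℕ) * (y ^ 2) ^ (j : ℕ) := by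
    rw [mul_pow, Complex.I_sq, mul_pow]
  rw [h1, h2]
  have h3 : ((-1) ^ k * Complex.I * (y : ℂ) ^ (2 * k + 1))⁻¹ =
      (-1) ^ (k + 1) * Complex.I * ((y : ℂ) ^ (2 * k + 1))⁻¹ := by
    rw [mul_inv, mul_inv, Complex.inv_I, ← inv_pow, inv_neg_one]; ring
  rw [div_eq_mul_inv, h3]
  ring

theorem tendsto_oddLaurent_zero {c : Fin (N + 1) → ℝ} (hc : 0 < c 0) :
    Tendsto (oddLaurent k c) (𝓝[>] 0) atTop := by
  have h1 : Tendsto (fun x : ℝ => ∑ j, c j * (x ^ 2) ^ (j : ℕ)) (𝓝[>] 0) (𝓝 (c 0)) := by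
    have : Continuous fun x : ℝ => ∑ j, c j * (x ^ 2) ^ (j : ℕ) := by fun_prop
    have h2 := this.tendsto 0
    rw [Fin.sum_univ_succ] at h2
    simpa using h2.mono_left nhdsWithin_le_nhds
  have h2 : Tendsto (fun x : ℝ => (x ^ (2 * k + 1))⁻¹) (𝓝[>] 0) atTop := by
    refine tendsto_inv_nhdsGT_zero.comp (tendsto_nhdsWithin_iff.2 ⟨?_, ?_⟩)
    · have : Tendsto (fun x : ℝ => x ^ (2 * k + 1)) (𝓝 0) (𝓝 0) := by
        simpa using (continuous_pow (M := ℝ) (2 * k + 1)).tendsto 0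
      exact this.mono_left nhdsWithin_le_nhds
    · filter_upwards [self_mem_nhdsWithin] with x hx using pow_pos (mem_Ioi.1 hx) _
  refine (h1.pos_mul_atTop hc h2).congr fun x => ?_
  rw [oddLaurent_eq_div, div_eq_mul_inv]

theorem inv_sq_pow_div {𝕜 : Type*} [Field 𝕜] {x : 𝕜} (hx : x ≠ 0) {i j k m : ℕ}
    (h : i + j = k + m + 1) :
    (x⁻¹ ^ 2) ^ i / x⁻¹ ^ (2 * k + 1) = (x ^ 2) ^ j / x ^ (2 * m + 1) := by
  have h1 : x ^ (2 * k + 1) * x ^ (2 * m + 1) = x ^ (2 * j) * x ^ (2 * i) := by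
    rw [← pow_add, ← pow_add]; congr 1; omega
  rw [← pow_mul, ← pow_mul, inv_pow, inv_pow, inv_div_inv,
    div_eq_div_iff (pow_ne_zero _ hx) (pow_ne_zero _ hx), h1]

/-- Inversion `x ↦ 1/x` exchanges the two ends of an odd Laurent polynomial. -/
theorem oddLaurent_inv {k m : ℕ} (c : Fin (k + m + 1 + 1) → ℝ) {x : ℝ} (hx : x ≠ 0) :
    oddLaurent k c x⁻¹ = oddLaurent m (fun j => c j.rev) x := by
  simp only [oddLaurent]
  rw [← Equiv.sum_comp Fin.revPerm]
  refine Finset.sum_congr rfl fun j _ => ?_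
  rw [Fin.revPerm_apply, inv_sq_pow_div hx (j := j) (m := m) (by have := Fin.val_rev j; omega)]

theorem oddLaurentC_inv {k m : ℕ} (c : Fin (k + m + 1 + 1) → ℝ) {z : ℂ} (hz : z ≠ 0) :
    oddLaurentC k c z⁻¹ = oddLaurentC m (fun j => c j.rev) z := by
  simp only [oddLaurentC]
  rw [← Equiv.sum_comp Fin.revPerm]
  refine Finset.sum_congr rfl fun j _ => ?_
  rw [Fin.revPerm_apply, inv_sq_pow_div hz (j := j) (m := m) (by have := Fin.val_rev j; omega)]

theorem tendsto_oddLaurent_atTop {k m : ℕ} {c : Fin (k + m + 1 + 1) → ℝ} (hc : 0 < c (Fin.last _)) :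
    Tendsto (oddLaurent k c) atTop atTop := by
  have h := (tendsto_oddLaurent_zero (k := m) (c := fun j => c j.rev)
    (by simpa using hc)).comp tendsto_inv_atTop_nhdsGT_zero
  refine h.congr' ?_
  filter_upwards [eventually_gt_atTop 0] with x hx
  rw [Function.comp_apply, ← oddLaurent_inv c (inv_ne_zero hx.ne'), inv_inv]

end Calculus

/-! ### Argument count for the level sets in the right half-plane -/

section RootCount

open Polynomial

/-- The polynomial `z^{2k+1} (f(z) - γ)`, where `f` is the odd Laurent polynomial with
coefficients `c`. -/
def levelPoly (k : ℕ) {N : ℕ} (c : Fin N → ℝ) (γ : ℝ) : ℂ[X] :=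
  (∑ j : Fin N, C (c j : ℂ) * X ^ (2 * (j : ℕ))) - C (γ : ℂ) * X ^ (2 * k + 1)

theorem eval_levelPoly (k : ℕ) {N : ℕ} (c : Fin N → ℝ) (γ : ℝ) {z : ℂ} (hz : z ≠ 0) :
    (levelPoly k c γ).eval z = z ^ (2 * k + 1) * (oddLaurentC k c z - γ) := by
  rw [oddLaurentC_eq_div, mul_sub, mul_div_cancel₀ _ (pow_ne_zero _ hz)]
  simp only [levelPoly, eval_sub, eval_finsetSum, eval_mul, eval_C, eval_pow, eval_X, pow_mul]
  rw [mul_comm (γ : ℂ)]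

variable {k m : ℕ} {c : Fin (k + m + 1 + 1) → ℝ} {γ : ℝ}

theorem natDegree_levelPoly (hc : c (Fin.last _) ≠ 0) :
    (levelPoly k c γ).natDegree = 2 * (k + m + 1) := by
  refine natDegree_eq_of_le_of_coeff_ne_zero ?_ ?_
  · rw [← max_self (2 * (k + m + 1))]
    refine natDegree_sub_le_of_le (natDegree_sum_le_of_forall_le (S := ℂ) _ _ fun j _ => ?_) ?_
    · exact (natDegree_C_mul_X_pow_le _ _).trans (by have := j.2; omega)
    · exact (natDegree_C_mul_X_pow_le _ _).trans (by omega)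
  · rw [levelPoly, coeff_sub, finsetSum_coeff, Finset.sum_eq_single (Fin.last _)]
    · rw [coeff_C_mul_X_pow, coeff_C_mul_X_pow, if_pos (by simp), if_neg (by omega)]
      simpa using hc
    · intro j _ hj
      rw [coeff_C_mul_X_pow, if_neg]
      intro h
      exact hj (Fin.ext (by simp only [Fin.val_last]; omega))
    · simp

theorem roots_levelPoly_map_conj :
    (levelPoly k c γ).roots.map (starRingEnd ℂ) = (levelPoly k c γ).roots := by
  rw [roots_map_of_injective_of_card_eq_natDegree (starRingEnd ℂ).injective
    IsAlgClosed.card_roots_eq_natDegree]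
  congr 1
  simp [levelPoly, Polynomial.map_sum]

/-- Off the origin `f(iy) - γ` has real part `-γ`; at the origin only the lowest coefficient
survives. So no root lies on the imaginary axis. -/
theorem eval_levelPoly_I_mul (hγ : 0 < γ) (hc : c 0 ≠ 0) (y : ℝ) :
    (levelPoly k c γ).eval (Complex.I * y) ≠ 0 := by
  by_cases hy : y = 0
  · subst hy
    simp only [Complex.ofReal_zero, mul_zero, levelPoly, eval_sub, eval_finsetSum, eval_mul, eval_C,
      eval_pow, eval_X]
    rw [Fin.sum_univ_succ]
    simpa using hc
  · have hz : Complex.I * y ≠ 0 := mul_ne_zero Complex.I_ne_zero (by exact_mod_cast hy)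
    rw [eval_levelPoly k c γ hz, oddLaurentC_I_mul]
    refine mul_ne_zero (pow_ne_zero _ hz) fun h => ?_
    have := congrArg Complex.re h
    simp at this
    exact hγ.ne' this

theorem re_ne_zero_of_mem_roots (hγ : 0 < γ) (hc : c 0 ≠ 0) {z : ℂ}
    (hz : z ∈ (levelPoly k c γ).roots) : z.re ≠ 0 := by
  intro h
  refine eval_levelPoly_I_mul hγ hc z.im ?_
  have : Complex.I * (z.im : ℂ) = z := by
    rw [mul_comm]; conv_rhs => rw [← Complex.re_add_im z, h]
    simp
  rw [this]
  exact (isRoot_of_mem_roots hz)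

/-- The continuous argument of `levelPoly k c γ` along the positive imaginary axis. -/
def argSum (k : ℕ) {N : ℕ} (c : Fin N → ℝ) (γ y : ℝ) : ℝ :=
  ∑ z ∈ (levelPoly k c γ).roots.toFinset,
    ((levelPoly k c γ).roots.count z : ℝ) * Real.arctan ((y - z.im) / -z.re)

/-- The derivative of `arg P(iy)` is `Re (P'/P)(iy)`, and the partial fraction of each root
integrates to an arctangent. -/
theorem hasDerivAt_argSum (hγ : 0 < γ) (hc : c 0 ≠ 0) (y : ℝ) :
    HasDerivAt (argSum k c γ) ((levelPoly k c γ).derivative.eval (Complex.I * y) /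
      (levelPoly k c γ).eval (Complex.I * y)).re y := by
  rw [(IsAlgClosed.splits _).eval_derivative_div_eval_of_ne_zero
    (eval_levelPoly_I_mul hγ hc y), Finset.sum_multiset_map_count, Complex.re_sum]
  refine HasDerivAt.fun_sum fun z hz => ?_
  have hre := re_ne_zero_of_mem_roots hγ hc (Multiset.mem_toFinset.1 hz)
  have h1 : HasDerivAt (fun y : ℝ => (y - z.im) / -z.re) (1 / -z.re) y :=
    ((hasDerivAt_id y).sub_const _).div_const _
  convert! (h1.arctan).const_mul ((levelPoly k c γ).roots.count z : ℝ) using 1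
  rw [nsmul_eq_mul, ← Complex.ofReal_natCast, Complex.re_ofReal_mul]
  congr 1
  rw [one_div, Complex.inv_re, Complex.normSq_apply]
  simp only [Complex.sub_re, Complex.mul_re, Complex.I_re, Complex.I_im, Complex.ofReal_re,
    Complex.ofReal_im, Complex.sub_im, Complex.mul_im]
  have h2 : z.re ^ 2 + (y - z.im) ^ 2 ≠ 0 := by positivity
  have h3 : 1 + ((y - z.im) / -z.re) ^ 2 ≠ 0 := by positivity
  have h4 : (0 * y - 1 * 0 - z.re) * (0 * y - 1 * 0 - z.re) +
      (0 * 0 + 1 * y - z.im) * (0 * 0 + 1 * y - z.im) = z.re ^ 2 + (y - z.im) ^ 2 := by ring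
  have h5 : 1 + ((y - z.im) / -z.re) ^ 2 = (z.re ^ 2 + (y - z.im) ^ 2) / z.re ^ 2 := by
    field_simp
  rw [h4, h5]
  field_simp
  ring

/-- A second branch of the same argument: `P(iy) = (iy)^{2k+1} (i h(y) - γ)`, where the first factor
has constant argument for `y > 0` and the second has argument `-arctan (h/γ)` up to a constant. -/
theorem hasDerivAt_arctan_level (hγ : 0 < γ) {y : ℝ} (hy : 0 < y) :
    HasDerivAt (fun y => -Real.arctan (oddLaurent k (twist k c) y / γ))
      ((levelPoly k c γ).derivative.eval (Complex.I * y) /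
      (levelPoly k c γ).eval (Complex.I * y)).re y := by
  have hz : Complex.I * (y : ℂ) ≠ 0 := mul_ne_zero Complex.I_ne_zero (by exact_mod_cast hy.ne')
  have hd : (levelPoly k c γ).derivative.eval (Complex.I * y) =
      ((2 * k + 1 : ℕ) : ℂ) * (Complex.I * y) ^ (2 * k) * (oddLaurentC k c (Complex.I * y) - γ) +
      (Complex.I * y) ^ (2 * k + 1) *
        (oddLaurentC k (eulerCoeff k c) (Complex.I * y) / (Complex.I * y)) := by
    have h1 := (hasDerivAt_pow (2 * k + 1) (Complex.I * (y : ℂ))).mul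
      ((hasDerivAt_oddLaurentC (k := k) c hz).sub_const (γ : ℂ))
    refine ((levelPoly k c γ).hasDerivAt (Complex.I * y)).unique (h1.congr_of_eventuallyEq ?_)
    filter_upwards [isOpen_ne.mem_nhds hz] with w hw
    exact eval_levelPoly k c γ hw
  have h2 := ((hasDerivAt_oddLaurent (k := k) (twist k c) hy.ne').div_const γ).arctan.neg
  convert! h2 using 1
  rw [hd, eval_levelPoly k c γ hz, eulerCoeff_twist, oddLaurentC_I_mul, oddLaurentC_I_mul]
  set h := oddLaurent k (twist k c) y
  set h' := oddLaurent k (twist k (eulerCoeff k c)) y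
  have hne : Complex.I * (h : ℂ) - γ ≠ 0 := by
    intro h0
    have := congrArg Complex.re h0
    simp at this
    exact hγ.ne' this
  have hy' : (y : ℂ) ≠ 0 := by exact_mod_cast hy.ne'
  have e1 : (((2 * k + 1 : ℕ) : ℂ) * (Complex.I * y) ^ (2 * k) * (Complex.I * h - γ) +
      (Complex.I * y) ^ (2 * k + 1) * (Complex.I * h' / (Complex.I * y))) /
      ((Complex.I * y) ^ (2 * k + 1) * (Complex.I * h - γ)) =
      (((2 * k + 1 : ℕ) : ℝ) / y : ℝ) * (-Complex.I) + ((h' / y : ℝ) : ℂ) * (Complex.I * h - γ)⁻¹ := by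
    rw [pow_succ]
    push_cast
    have hI := Complex.I_ne_zero
    have hII : Complex.I * -Complex.I = 1 := by simp
    rw [show -Complex.I = Complex.I⁻¹ by simp]
    field_simp
  rw [e1, Complex.add_re, Complex.re_ofReal_mul, Complex.re_ofReal_mul, Complex.inv_re,
    Complex.normSq_apply]
  simp only [Complex.neg_re, Complex.I_re, neg_zero, mul_zero, zero_add, Complex.sub_re,
    Complex.mul_re, Complex.ofReal_re, Complex.I_im, Complex.ofReal_im, Complex.sub_im,
    Complex.mul_im, zero_mul, mul_zero, sub_zero, zero_sub, one_mul, zero_add]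
  have h3 : 0 < γ ^ 2 + h ^ 2 := by positivity
  have h4 : 0 < 1 + (h / γ) ^ 2 := by positivity
  field_simp

/-- The roots are symmetric under conjugation, so their contributions at `y = 0` cancel. -/
theorem argSum_zero : argSum k c γ 0 = 0 := by
  have h1 : argSum k c γ 0 = ((levelPoly k c γ).roots.map
      fun z : ℂ => Real.arctan ((0 - z.im) / -z.re)).sum := by
    rw [Finset.sum_multiset_map_count]
    simp only [argSum, nsmul_eq_mul]
  have h2 : ((levelPoly k c γ).roots.map fun z : ℂ => Real.arctan ((0 - z.im) / -z.re)).sum =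
      -((levelPoly k c γ).roots.map fun z : ℂ => Real.arctan ((0 - z.im) / -z.re)).sum := by
    conv_lhs => rw [← roots_levelPoly_map_conj]
    rw [Multiset.map_map, ← Multiset.sum_map_neg]
    congr 2
    funext z
    simp [neg_div, div_neg]
  linarith

/-- Each root in the left half-plane contributes `π/2` in the limit, each root in the right
half-plane `-π/2`. -/
theorem tendsto_argSum_atTop (hγ : 0 < γ) (hc : c 0 ≠ 0) :
    Tendsto (argSum k c γ) atTop (𝓝 (Real.pi / 2 *
      ((Multiset.card (levelPoly k c γ).roots : ℝ) -
      2 * (Multiset.card ((levelPoly k c γ).roots.filter fun z => 0 < z.re) : ℝ)))) := by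
  have h1 : ∀ z ∈ (levelPoly k c γ).roots.toFinset,
      Tendsto (fun y => ((levelPoly k c γ).roots.count z : ℝ) *
        Real.arctan ((y - z.im) / -z.re)) atTop
      (𝓝 (((levelPoly k c γ).roots.count z : ℝ) *
        (Real.pi / 2 * (1 - 2 * if 0 < z.re then 1 else 0)))) := by
    intro z hz
    refine Tendsto.const_mul _ ?_
    have ht : Tendsto (fun y : ℝ => y - z.im) atTop atTop := tendsto_atTop_add_const_right _ _ tendsto_id
    rcases lt_or_gt_of_ne (re_ne_zero_of_mem_roots hγ hc (Multiset.mem_toFinset.1 hz)) with h | h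
    · rw [if_neg (not_lt.2 h.le)]
      have := (Real.tendsto_arctan_atTop.mono_right nhdsWithin_le_nhds).comp
        (ht.atTop_div_const (neg_pos.2 h))
      convert! this using 2
      ring
    · rw [if_pos h]
      have := (Real.tendsto_arctan_atBot.mono_right nhdsWithin_le_nhds).comp
        (ht.atTop_div_const_of_neg (neg_lt_zero.2 h))
      convert! this using 2
      ring
  convert! tendsto_finsetSum _ h1 using 2
  have e1 : (Multiset.card (levelPoly k c γ).roots : ℝ) =
      ∑ z ∈ (levelPoly k c γ).roots.toFinset, ((levelPoly k c γ).roots.count z : ℝ) := by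
    exact_mod_cast ((levelPoly k c γ).roots.toFinset_sum_count_eq).symm
  have e2 : (Multiset.card ((levelPoly k c γ).roots.filter fun z => 0 < z.re) : ℝ) =
      ∑ z ∈ (levelPoly k c γ).roots.toFinset,
        ((levelPoly k c γ).roots.count z : ℝ) * if 0 < z.re then 1 else 0 := by
    rw [← Multiset.sum_count_eq_card (s := (levelPoly k c γ).roots.toFinset) fun z hz =>
      Multiset.mem_toFinset.2 (Multiset.mem_of_mem_filter hz)]
    push_cast
    refine Finset.sum_congr rfl fun z _ => ?_
    rw [Multiset.count_filter]
    split_ifs <;> simp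
  rw [e1, e2, Finset.mul_sum, ← Finset.sum_sub_distrib, Finset.mul_sum]
  refine Finset.sum_congr rfl fun z _ => by ring

/-- The number of roots of `levelPoly` in the right half-plane. -/
theorem card_roots_re_pos (hγ : 0 < γ) {ε : ℝ} (hε : ε = 1 ∨ ε = -1)
    (hlast : 0 < ε * twist k c (Fin.last _)) (hzero : ε * twist k c 0 < 0) :
    (Multiset.card ((levelPoly k c γ).roots.filter fun z => 0 < z.re) : ℝ) = k + m + 1 + ε := by
  have hc0 : c 0 ≠ 0 := by
    intro h; simp [twist, h] at hzero
  have hcl : c (Fin.last _) ≠ 0 := by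
    intro h; simp [twist, h] at hlast
  have hεsq : ε * ε = 1 := by rcases hε with rfl | rfl <;> norm_num
  -- The two branches of the argument differ by a constant on the positive axis.
  have hconst : ∀ y ∈ Ioi (0 : ℝ), argSum k c γ y - -Real.arctan (oddLaurent k (twist k c) y / γ) =
      argSum k c γ 1 - -Real.arctan (oddLaurent k (twist k c) 1 / γ) := by
    intro y hy
    refine IsOpen.is_const_of_deriv_eq_zero
      (f := fun y => argSum k c γ y - -Real.arctan (oddLaurent k (twist k c) y / γ))
      isOpen_Ioi isPreconnected_Ioi ?_ ?_ hy (mem_Ioi.2 one_pos)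
    · intro y hy
      exact ((hasDerivAt_argSum hγ hc0 y).sub
        (hasDerivAt_arctan_level hγ hy)).differentiableAt.differentiableWithinAt
    · intro y hy
      have := ((hasDerivAt_argSum hγ hc0 y).sub (hasDerivAt_arctan_level (c := c) hγ hy)).deriv
      rw [sub_self] at this
      exact this
  have hscale : ∀ y, oddLaurent k (twist k c) y / γ =
      ε * (oddLaurent k (ε • twist k c) y / γ) := by
    intro y; rw [oddLaurent_smul, mul_div_assoc, ← mul_assoc, hεsq, one_mul]
  have hodd : ∀ y, Real.arctan (ε * y) = ε * Real.arctan y := by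
    intro y; rcases hε with rfl | rfl <;> simp
  have htop : Tendsto (fun y => Real.arctan (oddLaurent k (twist k c) y / γ)) atTop
      (𝓝 (ε * (Real.pi / 2))) := by
    simp only [hscale, hodd]
    refine Tendsto.const_mul _ ((Real.tendsto_arctan_atTop.mono_right nhdsWithin_le_nhds).comp ?_)
    exact (tendsto_oddLaurent_atTop (by simpa using hlast)).atTop_div_const hγ
  have hbot : Tendsto (fun y => Real.arctan (oddLaurent k (twist k c) y / γ)) (𝓝[>] 0)
      (𝓝 (ε * -(Real.pi / 2))) := by
    simp only [hscale, hodd]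
    refine Tendsto.const_mul _ ?_
    have h1 : Tendsto (fun y => oddLaurent k (-(ε • twist k c)) y / γ) (𝓝[>] 0) atTop :=
      (tendsto_oddLaurent_zero (by simpa using hzero)).atTop_div_const hγ
    have h2 := ((Real.tendsto_arctan_atTop.mono_right nhdsWithin_le_nhds).comp h1).neg
    refine h2.congr fun y => ?_
    rw [Function.comp_apply, ← neg_one_smul ℝ (ε • twist k c), oddLaurent_smul, neg_one_mul,
      neg_div, Real.arctan_neg, neg_neg]
  have hA0 : Tendsto (argSum k c γ) (𝓝[>] 0) (𝓝 0) := by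
    have := (hasDerivAt_argSum hγ hc0 0).continuousAt.tendsto
    rw [argSum_zero] at this
    exact this.mono_left nhdsWithin_le_nhds
  -- From `0` to `∞` the root sum changes by `π (k + m + 1 - R)`, with `R` the number of roots on
  -- the right, and `-arctan (h/γ)` changes by `-επ`. Equating the two gives `R`.
  have l1 := tendsto_nhds_unique ((hA0.sub hbot.neg).congr' (by
    filter_upwards [self_mem_nhdsWithin] with y hy using hconst y hy)) tendsto_const_nhds
  have l2 := tendsto_nhds_unique (((tendsto_argSum_atTop hγ hc0).sub htop.neg).congr' (by
    filter_upwards [eventually_gt_atTop 0] with y hy using hconst y hy)) tendsto_const_nhds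
  rw [IsAlgClosed.card_roots_eq_natDegree, natDegree_levelPoly hcl] at l2
  have hpi := Real.pi_pos
  push_cast at l2
  have : Real.pi * ((Multiset.card ((levelPoly k c γ).roots.filter fun z => 0 < z.re) : ℝ)) =
      Real.pi * (k + m + 1 + ε) := by linarith
  exact mul_left_cancel₀ hpi.ne' this

end RootCount

/-! ### Shape of the extremal function -/

section Structure

theorem neg_one_pow_mul_prod_pos {r i : ℕ} (hi : i ≤ r) (g : Fin r → ℝ)
    (h1 : ∀ l : Fin r, (l : ℕ) < i → 0 < g l) (h2 : ∀ l : Fin r, i ≤ (l : ℕ) → g l < 0) :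
    0 < (-1) ^ (r + i) * ∏ l, g l := by
  induction r with
  | zero => obtain rfl : i = 0 := by omega
            simp
  | succ r ih =>
    rcases hi.eq_or_lt with rfl | hlt
    · have : 0 < ∏ l, g l := Finset.prod_pos fun l _ => h1 l l.2
      simpa [← two_mul] using this
    · have h3 := ih (Nat.lt_succ_iff.1 hlt) (fun l => g l.castSucc)
        (fun l hl => h1 _ hl) fun l hl => h2 _ hl
      have h4 := h2 (Fin.last r) (by simpa using Nat.lt_succ_iff.1 hlt)
      rw [Fin.prod_univ_castSucc]
      have : (-1 : ℝ) ^ (r + 1 + i) * ((∏ l : Fin r, g l.castSucc) * g (Fin.last r)) =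
        ((-1) ^ (r + i) * ∏ l : Fin r, g l.castSucc) * -g (Fin.last r) := by ring
      rw [this]
      exact mul_pos h3 (neg_pos.2 h4)

/-- The coefficients `c` and the alternation points `x` of the extremal function on `[a, 1]` with
error `L`, together with its behaviour between these points, on the imaginary axis and in the right
half-plane. -/
structure IsExtremal (k m : ℕ) (a L : ℝ) (c : Fin (k + m + 1 + 1) → ℝ)
    (x : Fin (k + m + 1 + 1 + 1) → ℝ) : Prop where
  a_pos : 0 < a
  L_pos : 0 < L
  L_lt_one : L < 1
  strictMono : StrictMono x
  first : x 0 = a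
  last : x (Fin.last _) = 1
  value : ∀ i, 1 - oddLaurent k c (x i) = (-1) ^ (k + 1 + (i : ℕ)) * L
  le : ∀ y ∈ Icc a 1, |1 - oddLaurent k c y| ≤ L
  deriv_between : ∀ (i : Fin (k + m + 1 + 1)), ∀ y ∈ Ioo (x i.castSucc) (x i.succ),
    0 < (-1) ^ (k + 1 + (i : ℕ)) * oddLaurent k (eulerCoeff k c) y
  deriv_left : ∀ y ∈ Ioc 0 a, 0 < (-1) ^ (k + 1) * oddLaurent k (eulerCoeff k c) y
  deriv_right : ∀ y ∈ Ici 1, 0 < (-1) ^ m * oddLaurent k (eulerCoeff k c) y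
  twist_deriv : ∀ y ∈ Ioi 0, 0 < oddLaurent k (twist k (eulerCoeff k c)) y
  twist_last : 0 < twist k c (Fin.last _)
  twist_zero : twist k c 0 < 0
  level : ∀ z : ℂ, 0 < z.re → z.im ≠ 0 → ∀ γ ∈ Ioo (1 - L) (1 + L), oddLaurentC k c z ≠ γ

variable {k m : ℕ} {a L : ℝ} {c : Fin (k + m + 1 + 1) → ℝ} {x w : Fin (k + m + 1 + 1 + 1) → ℝ}

/-- The squared error has an interior maximum at such a point and the error itself does not vanish
there. -/
theorem eulerCoeff_root_of_extremal (hL : 0 < L) (ha : 0 < a)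
    (hle : ∀ y ∈ Icc a 1, |1 - oddLaurent k c y| ≤ L) {y : ℝ} (hy : y ∈ Ioo a 1)
    (hyL : |1 - oddLaurent k c y| = L) : oddLaurent k (eulerCoeff k c) y = 0 := by
  have hy0 : y ≠ 0 := (ha.trans hy.1).ne'
  have hmax : IsLocalMax (fun y => (1 - oddLaurent k c y) ^ 2) y := by
    filter_upwards [Icc_mem_nhds hy.1 hy.2] with t ht
    rw [← sq_abs (1 - oddLaurent k c t), ← sq_abs (1 - oddLaurent k c y), hyL]
    exact pow_le_pow_left₀ (abs_nonneg _) (hle t ht) 2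
  have hd := ((hasDerivAt_oddLaurent (k := k) c hy0).const_sub 1).pow 2
  have h0 := hmax.hasDerivAt_eq_zero hd
  have hne : 1 - oddLaurent k c y ≠ 0 := by
    intro h; rw [h, abs_zero] at hyL; exact hL.ne hyL
  simpa [hne, hy0] using h0

/-- With `N` positive zeros, `x f'(x)` vanishes identically. All exponents are odd, so no
coefficient is lost and `f = 0`; but then the error is constantly `1` and does not alternate. -/
theorem IsCertificate.false_of_roots (h : IsCertificate k a L c x w) (ha : 0 < a) (hL : 0 < L)
    {y : Fin (k + m + 1 + 1) → ℝ} (hy : Function.Injective y) (hpos : ∀ i, 0 < y i)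
    (h0 : ∀ i, oddLaurent k (eulerCoeff k c) (y i) = 0) : False := by
  have hc := eq_zero_of_eulerCoeff_eq_zero (coeff_eq_zero_of_oddLaurent_eq_zero hy hpos h0)
  have := h.mul_neg ha hL 0
  simp [hc, oddLaurent] at this
  linarith

/-- Otherwise all points except the last would be interior, giving `N` zeros of `f'`, one too many.
The same count with the first point left out settles the right endpoint. -/
theorem IsCertificate.first_eq (h : IsCertificate k a L c x w) (ha : 0 < a) (hL : 0 < L)
    (hle : ∀ y ∈ Icc a 1, |1 - oddLaurent k c y| ≤ L) : x 0 = a := by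
  by_contra hne
  have h0 : a < x 0 := lt_of_le_of_ne (h.mem 0).1 (Ne.symm hne)
  refine h.false_of_roots ha hL (y := fun i => x i.castSucc)
    (h.strictMono.injective.comp (Fin.castSucc_injective _)) (fun i => ha.trans_le (h.mem _).1)
    fun i => eulerCoeff_root_of_extremal hL ha hle ⟨?_, ?_⟩ (h.extremal _)
  · exact h0.trans_le (h.strictMono.monotone (Fin.zero_le _))
  · exact (h.strictMono (Fin.castSucc_lt_last i)).trans_le (h.mem _).2

theorem IsCertificate.last_eq (h : IsCertificate k a L c x w) (ha : 0 < a) (hL : 0 < L)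
    (hle : ∀ y ∈ Icc a 1, |1 - oddLaurent k c y| ≤ L) : x (Fin.last _) = 1 := by
  by_contra hne
  have h0 : x (Fin.last _) < 1 := lt_of_le_of_ne (h.mem _).2 hne
  refine h.false_of_roots ha hL (y := fun i => x i.succ)
    (h.strictMono.injective.comp (Fin.succ_injective _)) (fun i => ha.trans_le (h.mem _).1)
    fun i => eulerCoeff_root_of_extremal hL ha hle ⟨?_, ?_⟩ (h.extremal _)
  · exact (h.mem 0).1.trans_lt (h.strictMono (Fin.succ_pos i))
  · exact (h.strictMono.monotone (Fin.le_last _)).trans_lt h0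

open Polynomial in
-- The `k + m + 1` interior alternation points are zeros of the numerator of `x f'(x)`, whose degree
-- in `t = x²` is at most `k + m + 1`. The difference of the two sides loses its leading term and
-- still has that many zeros.
theorem IsCertificate.sum_eulerCoeff (h : IsCertificate k a L c x w) (ha : 0 < a) (hL : 0 < L)
    (hle : ∀ y ∈ Icc a 1, |1 - oddLaurent k c y| ≤ L) (t : ℝ) :
    ∑ j, eulerCoeff k c j * t ^ (j : ℕ) =
      eulerCoeff k c (Fin.last _) * ∏ i : Fin (k + m + 1), (t - x i.castSucc.succ ^ 2) := by
  have hpos : ∀ i, 0 < x i := fun i => ha.trans_le (h.mem _).1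
  set d := eulerCoeff k c
  let Q : ℝ[X] := ∏ i : Fin (k + m + 1), (X - C (x i.castSucc.succ ^ 2))
  have hQm : Q.Monic := monic_prod_of_monic _ _ fun i _ => monic_X_sub_C _
  have hQd : Q.natDegree = k + m + 1 := by
    rw [natDegree_prod_of_monic _ _ fun i _ => monic_X_sub_C _]
    simp only [natDegree_X_sub_C, Finset.sum_const, Finset.card_univ, Fintype.card_fin,
      smul_eq_mul, mul_one]
  let F : ℝ[X] := (∑ j : Fin (k + m + 1 + 1), C (d j) * X ^ (j : ℕ)) - C (d (Fin.last _)) * Q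
  have hF : F = 0 := by
    refine eq_zero_of_degree_lt_of_eval_index_eq_zero (v := fun i => x i.castSucc.succ ^ 2)
      (Finset.univ : Finset (Fin (k + m + 1))) ?_ ?_ ?_
    · intro i _ j _ hij
      have := h.strictMono.injective ((pow_left_inj₀ (hpos _).le (hpos _).le two_ne_zero).1 hij)
      exact Fin.castSucc_injective _ (Fin.succ_injective _ this)
    · rw [Finset.card_univ, Fintype.card_fin, degree_lt_iff_coeff_zero]
      intro n hn
      simp only [F, coeff_sub, finsetSum_coeff, coeff_C_mul, coeff_X_pow]
      rcases hn.eq_or_lt with rfl | hlt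
      · rw [Finset.sum_eq_single (Fin.last _)]
        · have : Q.coeff (k + m + 1) = 1 := by rw [← hQd]; exact hQm
          simp [this]
        · intro j _ hj
          rw [if_neg, mul_zero]
          intro hjj
          exact hj (Fin.ext (by simp [← hjj]))
        · simp
      · rw [coeff_eq_zero_of_natDegree_lt (hQd ▸ hlt), Finset.sum_eq_zero]
        · simp
        · intro j _
          rw [if_neg (by have := j.2; omega), mul_zero]
    · intro i _
      have h1 : Q.eval (x i.castSucc.succ ^ 2) = 0 := by
        simp only [Q, eval_prod]
        exact Finset.prod_eq_zero (Finset.mem_univ i) (by simp)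
      have h2 : oddLaurent k d (x i.castSucc.succ) = 0 := by
        refine eulerCoeff_root_of_extremal hL ha hle ⟨?_, ?_⟩ (h.extremal _)
        · exact (h.mem 0).1.trans_lt (h.strictMono (Fin.succ_pos _))
        · refine (h.strictMono ?_).trans_le (h.mem (Fin.last _)).2
          rw [← Fin.succ_last]
          exact Fin.succ_lt_succ_iff.2 (Fin.castSucc_lt_last i)
      rw [oddLaurent_eq_div, div_eq_zero_iff] at h2
      have h3 := h2.resolve_right (pow_pos (hpos _) _).ne'
      simp only [F, eval_sub, eval_mul, eval_C, h1, mul_zero, sub_zero, eval_finsetSum, eval_pow,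
        eval_X]
      exact h3
  have := congrArg (eval t) hF
  simp only [F, Q, eval_sub, eval_mul, eval_C, eval_finsetSum, eval_pow, eval_X, eval_zero,
    eval_prod, sub_eq_zero] at this
  exact this

theorem IsCertificate.exists_level (h : IsCertificate k a L c x w) (ha : 0 < a) (hL : 0 < L)
    {γ : ℝ} (hγ : γ ∈ Ioo (1 - L) (1 + L)) (i : Fin (k + m + 1 + 1)) :
    ∃ y ∈ Ioo (x i.castSucc) (x i.succ), oddLaurent k c y = γ := by
  have hlt := h.strictMono (Fin.castSucc_lt_succ (i := i))
  have hcont : ContinuousOn (oddLaurent k c) (Icc (x i.castSucc) (x i.succ)) :=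
    (continuousOn_oddLaurent c).mono fun y hy => (ha.trans_le (h.mem _).1).trans_le hy.1
  have h1 := h.mul_neg ha hL i
  have e1 := h.extremal i.castSucc
  have e2 := h.extremal i.succ
  rcases mul_neg_iff.1 h1 with ⟨p, q⟩ | ⟨p, q⟩
  · rw [abs_of_pos p] at e1
    rw [abs_of_neg q] at e2
    obtain ⟨y, hy, hyγ⟩ := intermediate_value_Ioo hlt.le hcont
      (show γ ∈ Ioo _ _ from ⟨by linarith [hγ.1], by linarith [hγ.2]⟩)
    exact ⟨y, hy, hyγ⟩
  · rw [abs_of_neg p] at e1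
    rw [abs_of_pos q] at e2
    obtain ⟨y, hy, hyγ⟩ := intermediate_value_Ioo' hlt.le hcont
      (show γ ∈ Ioo _ _ from ⟨by linarith [hγ.1], by linarith [hγ.2]⟩)
    exact ⟨y, hy, hyγ⟩

/-- The real roots that the alternation forces. -/
theorem IsCertificate.exists_finset_roots (h : IsCertificate k a L c x w) (ha : 0 < a) (hL : 0 < L)
    (hcl : c (Fin.last _) ≠ 0) {γ : ℝ} (hγ : γ ∈ Ioo (1 - L) (1 + L)) :
    ∃ s : Finset ℂ, s.card = k + m + 1 + 1 ∧ (∀ z ∈ s, z.im = 0) ∧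
      s.val ≤ (levelPoly k c γ).roots.filter fun z => 0 < z.re := by
  classical
  choose y hy hyγ using h.exists_level ha hL hγ
  have hypos : ∀ i, 0 < y i := fun i => (ha.trans_le (h.mem _).1).trans (hy i).1
  have hyi : StrictMono y := by
    rw [Fin.strictMono_iff_lt_succ]
    intro i
    have h1 := (hy i.castSucc).2
    have h2 := (hy i.succ).1
    rw [Fin.succ_castSucc] at h1
    exact h1.trans h2
  refine ⟨Finset.univ.image fun i => (y i : ℂ), ?_, ?_, ?_⟩
  · rw [Finset.card_image_of_injective _ fun i j hij =>
      hyi.injective (Complex.ofReal_injective hij), Finset.card_univ, Fintype.card_fin]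
  · simp
  · rw [Multiset.le_iff_subset (Finset.nodup _)]
    intro z hz
    obtain ⟨i, -, rfl⟩ := Finset.mem_image.1 (Finset.mem_def.2 hz)
    have hne : levelPoly k c γ ≠ 0 := by
      intro h0
      have := natDegree_levelPoly (γ := γ) hcl
      rw [h0] at this
      simp at this
    rw [Multiset.mem_filter, Polynomial.mem_roots hne, Polynomial.IsRoot.def,
      eval_levelPoly _ _ _ (by exact_mod_cast (hypos i).ne'), oddLaurentC_ofReal, hyγ i]
    simpa using hypos i

/-- The product formula for `x f'(x)` leaves one sign undetermined. The root count settles it: the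
wrong sign leaves too few roots in the right half-plane for the alternation. With the right sign the
count equals the number of real roots forced by alternation, so no others exist. -/
theorem IsCertificate.isExtremal (h : IsCertificate k a L c x w) (ha : 0 < a) (hL : 0 < L)
    (hL1 : L < 1) (hle : ∀ y ∈ Icc a 1, |1 - oddLaurent k c y| ≤ L) : IsExtremal k m a L c x := by
  have hpos : ∀ i, 0 < x i := fun i => ha.trans_le (h.mem _).1
  have hfirst := h.first_eq ha hL hle
  have hlast := h.last_eq ha hL hle
  have hsum := h.sum_eulerCoeff ha hL hle
  set d := eulerCoeff k c with hd
  have hdl : d (Fin.last _) ≠ 0 := by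
    intro h0
    refine h.false_of_roots ha hL (y := fun i => x i.succ)
      (h.strictMono.injective.comp (Fin.succ_injective _)) (fun i => hpos _) fun i => ?_
    rw [oddLaurent_eq_div, hsum, h0, zero_mul, zero_div]
  have hdl' : d (Fin.last _) = (2 * m + 1) * c (Fin.last _) := by
    simp only [hd, eulerCoeff, Fin.val_last]; push_cast; ring
  have hd0 : d 0 = -((2 * k + 1) * c 0) := by
    simp only [hd, eulerCoeff, Fin.val_zero]; push_cast; ring
  have hcl : c (Fin.last _) ≠ 0 := by
    intro h0; rw [hdl', h0, mul_zero] at hdl; exact hdl rfl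
  have htl : twist k c (Fin.last _) = (-1) ^ m * c (Fin.last _) := by
    simp only [twist, Fin.val_last]
    rw [show k + 1 + (k + m + 1) = 2 * (k + 1) + m by ring, pow_add, pow_mul]
    simp
  have hprod : 0 < ∏ i : Fin (k + m + 1), x i.castSucc.succ ^ 2 :=
    Finset.prod_pos fun i _ => pow_pos (hpos _) 2
  -- The product formula at `t = 0` ties the sign of the lowest coefficient to that of the highest,
  -- so one value of `ε` serves both ends in the root count.
  have ht0 : (2 * k + 1) * twist k c 0 =
      -((-1) ^ m * d (Fin.last _) * ∏ i : Fin (k + m + 1), x i.castSucc.succ ^ 2) := by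
    have h0 := hsum 0
    rw [Fin.sum_univ_succ] at h0
    simp only [Fin.val_zero, pow_zero, mul_one, Fin.val_succ, ne_eq, Nat.add_eq_zero_iff,
      one_ne_zero, and_false, not_false_eq_true, zero_pow, mul_zero, Finset.sum_const_zero,
      add_zero, zero_sub, Finset.prod_neg, Finset.card_univ, Fintype.card_fin] at h0
    have e : ((-1 : ℝ)) ^ (k + m + 1) = (-1) ^ (k + 1) * (-1) ^ m := by ring
    have e2 : ((-1 : ℝ)) ^ (k + 1) * (-1) ^ (k + 1) = 1 := by
      rw [← mul_pow]; simp
    rw [hd0, e] at h0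
    simp only [twist, Fin.val_zero, add_zero]
    linear_combination (-((-1) ^ (k + 1)) : ℝ) * h0 -
      ((-1) ^ m * d (Fin.last _) * ∏ i : Fin (k + m + 1), x i.castSucc.succ ^ 2) * e2
  have hcount : ∀ {ε : ℝ}, (ε = 1 ∨ ε = -1) → 0 < ε * ((-1) ^ m * d (Fin.last _)) → ∀ γ : ℝ, 0 < γ →
      (Multiset.card ((levelPoly k c γ).roots.filter fun z => 0 < z.re) : ℝ) = k + m + 1 + ε := by
    intro ε hε hεd γ hγ
    refine card_roots_re_pos hγ hε ?_ ?_
    · rw [htl]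
      rw [hdl'] at hεd
      have h2m : (0 : ℝ) < 2 * m + 1 := by positivity
      have : 0 < (2 * m + 1) * (ε * ((-1) ^ m * c (Fin.last _))) := by linarith
      exact (mul_pos_iff_of_pos_left h2m).1 this
    · have h2k : (0 : ℝ) < 2 * k + 1 := by positivity
      have : (2 * k + 1) * (ε * twist k c 0) < 0 := by
        have e : (2 * k + 1) * (ε * twist k c 0) = -(ε * ((-1) ^ m * d (Fin.last _)) *
          ∏ i : Fin (k + m + 1), x i.castSucc.succ ^ 2) := by
            linear_combination ε * ht0
        rw [e]
        exact neg_neg_of_pos (mul_pos hεd hprod)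
      exact neg_of_mul_neg_right this h2k.le
  -- With the opposite sign the level `γ = 1` would have `k + m` roots on the right, whereas
  -- alternation produces `k + m + 2`.
  have hsign : 0 < (-1) ^ m * d (Fin.last _) := by
    by_contra hcon
    have hne : (-1) ^ m * d (Fin.last _) ≠ 0 := mul_ne_zero (by simp) hdl
    have h1 := hcount (ε := -1) (Or.inr rfl) (by
      have := lt_of_le_of_ne (not_lt.1 hcon) hne
      linarith) 1 one_pos
    obtain ⟨s, hs, -, hle'⟩ := h.exists_finset_roots ha hL hcl
      (γ := 1) ⟨by linarith, by linarith⟩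
    have h2 := Multiset.card_le_card hle'
    rw [Finset.card_val, hs] at h2
    have h3 : ((k + m + 1 + 1 : ℕ) : ℝ) ≤ k + m + 1 + -1 := by
      rw [← h1]; exact_mod_cast h2
    push_cast at h3
    linarith
  have hdpos : ∀ y, 0 < y → ∀ i ≤ k + m + 1,
      (∀ l : Fin (k + m + 1), (l : ℕ) < i → x l.castSucc.succ < y) →
      (∀ l : Fin (k + m + 1), i ≤ (l : ℕ) → y < x l.castSucc.succ) →
      0 < (-1) ^ (k + 1 + i) * oddLaurent k d y := by
    intro y hy i hi hlo hup
    have h1 := neg_one_pow_mul_prod_pos hi (fun l => y ^ 2 - x l.castSucc.succ ^ 2)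
      (fun l hl => sub_pos.2 (pow_lt_pow_left₀ (hlo l hl) (hpos _).le two_ne_zero))
      (fun l hl => sub_neg.2 (pow_lt_pow_left₀ (hup l hl) hy.le two_ne_zero))
    rw [oddLaurent_eq_div, hsum, ← mul_div_assoc]
    refine div_pos ?_ (pow_pos hy _)
    have e2 : ((-1 : ℝ)) ^ m * (-1) ^ m = 1 := by rw [← mul_pow]; simp
    have : (-1 : ℝ) ^ (k + 1 + i) *
        (d (Fin.last _) * ∏ l : Fin (k + m + 1), (y ^ 2 - x l.castSucc.succ ^ 2)) =
        ((-1) ^ m * d (Fin.last _)) *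
        ((-1) ^ (k + m + 1 + i) * ∏ l : Fin (k + m + 1), (y ^ 2 - x l.castSucc.succ ^ 2)) := by
      rw [show k + m + 1 + i = k + 1 + i + m by ring, pow_add _ (k + 1 + i) m]
      linear_combination (-((-1 : ℝ) ^ (k + 1 + i)) *
        (d (Fin.last _) * ∏ l : Fin (k + m + 1), (y ^ 2 - x l.castSucc.succ ^ 2))) * e2
    rw [this]
    exact mul_pos hsign h1
  have hbetween : ∀ (i : Fin (k + m + 1 + 1)), ∀ y ∈ Ioo (x i.castSucc) (x i.succ),
      0 < (-1) ^ (k + 1 + (i : ℕ)) * oddLaurent k d y := by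
    intro i y hy
    refine hdpos y ((hpos _).trans hy.1) i (Nat.lt_succ_iff.1 i.2) (fun l hl => ?_) fun l hl => ?_
    · refine (h.strictMono.monotone ?_).trans_lt hy.1
      rw [Fin.le_def]; simp; omega
    · refine hy.2.trans_le (h.strictMono.monotone ?_)
      rw [Fin.le_def]; simp; omega
  have hmono : ∀ i : Fin (k + m + 1 + 1),
      0 < (-1) ^ (k + 1 + (i : ℕ)) * (oddLaurent k c (x i.succ) - oddLaurent k c (x i.castSucc)) := by
    intro i
    have hlt := h.strictMono (Fin.castSucc_lt_succ (i := i))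
    obtain ⟨y, hy, hy'⟩ := exists_hasDerivAt_eq_slope (oddLaurent k c)
      (fun y => oddLaurent k d y / y) hlt
      ((continuousOn_oddLaurent c).mono fun y hy => (hpos _).trans_le hy.1)
      fun y hy => hasDerivAt_oddLaurent c ((hpos _).trans hy.1).ne'
    have h1 := hbetween i y hy
    have hy0 := (hpos _).trans hy.1
    rw [div_eq_div_iff hy0.ne' (sub_pos.2 hlt).ne'] at hy'
    have h2 : 0 < (-1) ^ (k + 1 + (i : ℕ)) * oddLaurent k d y * (x i.succ - x i.castSucc) :=
      mul_pos h1 (sub_pos.2 hlt)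
    have h3 : 0 < ((-1) ^ (k + 1 + (i : ℕ)) *
        (oddLaurent k c (x i.succ) - oddLaurent k c (x i.castSucc))) * y := by
      rw [mul_assoc, ← hy', ← mul_assoc]; exact h2
    exact (mul_pos_iff_of_pos_right hy0).1 h3
  have hvals : ∀ i : Fin (k + m + 1 + 1),
      1 - oddLaurent k c (x i.castSucc) = (-1) ^ (k + 1 + (i : ℕ)) * L ∧
      1 - oddLaurent k c (x i.succ) = -((-1) ^ (k + 1 + (i : ℕ)) * L) := by
    intro i
    have h1 := hmono i
    have e1 := h.extremal i.castSucc
    have e2 := h.extremal i.succ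
    have e3 := h.mul_neg ha hL i
    rcases neg_one_pow_eq_or ℝ (k + 1 + (i : ℕ)) with hs | hs <;> rw [hs] at h1 ⊢ <;>
    rcases mul_neg_iff.1 e3 with ⟨p, q⟩ | ⟨p, q⟩ <;>
    first
    | (rw [abs_of_pos p] at e1; rw [abs_of_neg q] at e2; constructor <;> linarith)
    | (rw [abs_of_neg p] at e1; rw [abs_of_pos q] at e2; constructor <;> linarith)
  have hcnt1 := hcount (ε := 1) (Or.inl rfl) (by linarith)
  refine ⟨ha, hL, hL1, h.strictMono, hfirst, hlast, fun i => ?_, hle, hbetween, fun y hy => ?_,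
    fun y hy => ?_, fun y hy => ?_, ?_, ?_, fun z hz him γ hγ heq => ?_⟩
  · induction i using Fin.lastCases with
    | last =>
      rw [← Fin.succ_last, (hvals (Fin.last _)).2]
      simp only [Fin.val_last, Fin.val_succ]
      ring
    | cast i => exact (hvals i).1
  · refine hdpos y hy.1 0 (Nat.zero_le _) (fun l hl => absurd hl (Nat.not_lt_zero _)) fun l _ => ?_
    refine hy.2.trans_lt ?_
    rw [← hfirst]
    exact h.strictMono (Fin.succ_pos _)
  · have h1 := hdpos y (one_pos.trans_le hy) (k + m + 1) le_rfl (fun l _ => ?_)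
      fun l hl => absurd l.2 (not_lt.2 hl)
    · rw [show k + 1 + (k + m + 1) = 2 * (k + 1) + m by ring, pow_add, pow_mul] at h1
      simpa using h1
    · refine lt_of_lt_of_le ?_ (mem_Ici.1 hy)
      rw [← hlast]
      refine h.strictMono ?_
      rw [← Fin.succ_last]
      exact Fin.succ_lt_succ_iff.2 (Fin.castSucc_lt_last l)
  · have hy0 : 0 < y := hy
    have e : ∑ j, twist k d j * (y ^ 2) ^ (j : ℕ) =
        (-1) ^ (k + 1) * ∑ j, d j * (-y ^ 2) ^ (j : ℕ) := by
      rw [Finset.mul_sum]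
      refine Finset.sum_congr rfl fun j _ => ?_
      rw [neg_pow (y ^ 2), twist]; ring
    rw [oddLaurent_eq_div, e, hsum]
    refine div_pos ?_ (pow_pos hy0 _)
    have e2 : ∏ i : Fin (k + m + 1), (-y ^ 2 - x i.castSucc.succ ^ 2) =
        (-1) ^ (k + m + 1) * ∏ i : Fin (k + m + 1), (y ^ 2 + x i.castSucc.succ ^ 2) := by
      have := Finset.prod_neg (s := Finset.univ)
        (fun i : Fin (k + m + 1) => y ^ 2 + x i.castSucc.succ ^ 2)
      rw [Finset.card_univ, Fintype.card_fin] at this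
      rw [← this]
      refine Finset.prod_congr rfl fun i _ => by ring
    have e3 : ((-1 : ℝ)) ^ (k + 1) * (-1) ^ (k + m + 1) = (-1) ^ m := by
      rw [← pow_add, show k + 1 + (k + m + 1) = 2 * (k + 1) + m by ring, pow_add, pow_mul]; simp
    rw [e2]
    have : (-1 : ℝ) ^ (k + 1) * (d (Fin.last _) * ((-1) ^ (k + m + 1) *
        ∏ i : Fin (k + m + 1), (y ^ 2 + x i.castSucc.succ ^ 2))) =
        (-1) ^ m * d (Fin.last _) * ∏ i : Fin (k + m + 1), (y ^ 2 + x i.castSucc.succ ^ 2) := by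
      rw [← e3]; ring
    rw [this]
    exact mul_pos hsign (Finset.prod_pos fun i _ => by positivity)
  · rw [htl]
    rw [hdl'] at hsign
    have h2m : (0 : ℝ) < 2 * m + 1 := by positivity
    have : 0 < (2 * m + 1) * ((-1) ^ m * c (Fin.last _)) := by linarith
    exact (mul_pos_iff_of_pos_left h2m).1 this
  · have h2k : (0 : ℝ) < 2 * k + 1 := by positivity
    have : (2 * k + 1) * twist k c 0 < 0 := by
      rw [ht0]; exact neg_neg_of_pos (mul_pos hsign hprod)
    exact neg_of_mul_neg_right this h2k.le
  -- The real roots already exhaust the multiset of roots in the right half-plane.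
  · obtain ⟨s, hs, hsim, hle'⟩ := h.exists_finset_roots ha hL hcl hγ
    have h1 := hcnt1 γ (by linarith [hγ.1])
    have h2 : Multiset.card ((levelPoly k c γ).roots.filter fun z => 0 < z.re) =
        k + m + 1 + 1 := by exact_mod_cast h1
    have h3 := Multiset.eq_of_le_of_card_le hle' (by rw [h2, Finset.card_val, hs])
    have hne : levelPoly k c γ ≠ 0 := by
      intro h0
      have := natDegree_levelPoly (γ := γ) hcl
      rw [h0] at this
      simp at this
    have hz0 : z ≠ 0 := by rintro rfl; simp at hz
    have hmem : z ∈ (levelPoly k c γ).roots.filter fun z => 0 < z.re := by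
      rw [Multiset.mem_filter, Polynomial.mem_roots hne, Polynomial.IsRoot.def,
        eval_levelPoly _ _ _ hz0, heq]
      exact ⟨by simp, hz⟩
    rw [← h3] at hmem
    exact him (hsim z hmem)

end Structure

/-! ### Convergence of lifts through `cos` and `exp`, and the inverse Joukowski map -/

section Lifting

/-- A map into the plane whose composition with a periodic function `q` converges also converges,
provided it maps small sets of the filter to connected sets. -/
theorem exists_tendsto_of_tendsto_comp {X : Type*} {l : Filter X} [l.NeBot] {Φ : X → ℂ} {q : ℂ → ℂ}
    {c₀ : ℂ} (hl : ∀ s ∈ l, ∃ t ∈ l, t ⊆ s ∧ IsPreconnected (Φ '' t)) (hqc : Continuous q)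
    (hper : ∀ w, q (w + 2 * Real.pi) = q w) (hq : Tendsto (fun s => q (Φ s)) l (𝓝 c₀))
    (him : ∃ M : ℝ, ∀ᶠ s in l, |(Φ s).im| ≤ M)
    (hline : ∃ u : ℝ, ∀ v : ℝ, q (u + v * Complex.I) ≠ c₀)
    (hiso : ∀ w₀, ∀ᶠ w in 𝓝[≠] w₀, q w ≠ c₀) : ∃ w₀, Tendsto Φ l (𝓝 w₀) := by
  obtain ⟨M, hM⟩ := him
  obtain ⟨u, hu⟩ := hline
  have hper' : ∀ (j : ℤ) (w : ℂ), q (w + j * (2 * Real.pi)) = q w := fun j w =>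
    Function.Periodic.int_mul hper j w
  -- On the vertical line `Re w = u` and its translates by the period, `q` stays at distance `ε`
  -- from `c₀`. Connected images cannot cross these lines, so `Re Φ` is confined to one period and a
  -- cluster point exists.
  obtain ⟨ε, hε, hεu⟩ : ∃ ε > 0, ∀ v ∈ Icc (-M) M, ε ≤ ‖q (u + v * Complex.I) - c₀‖ := by
    rcases (Icc (-M) M).eq_empty_or_nonempty with he | hne
    · exact ⟨1, one_pos, by simp [he]⟩
    · have hcont : Continuous fun v : ℝ => ‖q (u + v * Complex.I) - c₀‖ := by fun_prop
      obtain ⟨v, -, hv⟩ := isCompact_Icc.exists_isMinOn hne hcont.continuousOn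
      exact ⟨_, norm_pos_iff.2 (sub_ne_zero.2 (hu v)), fun v' hv' => hv hv'⟩
  obtain ⟨t, htl, hts, htc⟩ := hl _ ((hM.and (hq.eventually (Metric.ball_mem_nhds c₀ hε))))
  obtain ⟨s₁, hs₁⟩ := Filter.nonempty_of_mem htl
  have hp := Real.two_pi_pos
  obtain ⟨j, hj⟩ : ∃ j : ℤ, (Φ s₁).re ∈ Icc (u + j * (2 * Real.pi)) (u + (j + 1) * (2 * Real.pi)) := by
    refine ⟨⌊((Φ s₁).re - u) / (2 * Real.pi)⌋, ?_, ?_⟩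
    · have := (le_div_iff₀ hp).1 (Int.floor_le (((Φ s₁).re - u) / (2 * Real.pi)))
      linarith
    · have := (div_lt_iff₀ hp).1 (Int.lt_floor_add_one (((Φ s₁).re - u) / (2 * Real.pi)))
      linarith
  have hne : ∀ s ∈ t, ∀ i : ℤ, (Φ s).re ≠ u + i * (2 * Real.pi) := by
    intro s hs i hsi
    obtain ⟨h1, h2⟩ := hts hs
    have h3 := hεu _ (abs_le.1 h1)
    have h4 : Φ s = (u + (Φ s).im * Complex.I) + i * (2 * Real.pi) := by
      apply Complex.ext <;> simp [hsi]
    have h5 : q (Φ s) = q (u + (Φ s).im * Complex.I) := by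
      conv_lhs => rw [h4]
      exact hper' i _
    rw [dist_eq_norm, h5] at h2
    linarith
  have hre : IsPreconnected (Complex.re '' (Φ '' t)) :=
    htc.image _ Complex.continuous_re.continuousOn
  have hord := hre.ordConnected
  have hbd : ∀ s ∈ t, (Φ s).re ∈ Icc (u + j * (2 * Real.pi)) (u + (j + 1) * (2 * Real.pi)) := by
    intro s hs
    have m1 : (Φ s₁).re ∈ Complex.re '' (Φ '' t) := ⟨_, ⟨s₁, hs₁, rfl⟩, rfl⟩
    have m2 : (Φ s).re ∈ Complex.re '' (Φ '' t) := ⟨_, ⟨s, hs, rfl⟩, rfl⟩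
    constructor
    · by_contra hcon
      obtain ⟨_, ⟨s', hs', rfl⟩, h'⟩ := hord.out m2 m1 ⟨(not_le.1 hcon).le, hj.1⟩
      exact hne s' hs' j h'
    · by_contra hcon
      obtain ⟨_, ⟨s', hs', rfl⟩, h'⟩ := hord.out m1 m2 ⟨hj.2, (not_le.1 hcon).le⟩
      exact hne s' hs' (j + 1) (by rw [h']; push_cast; ring)
  have hK : IsCompact (Icc (u + j * (2 * Real.pi)) (u + (j + 1) * (2 * Real.pi)) ×ℂ Icc (-M) M) :=
    isCompact_Icc.reProdIm isCompact_Icc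
  obtain ⟨w₀, -, hw₀⟩ := hK (f := map Φ l) (by
    rw [le_principal_iff, mem_map]
    filter_upwards [htl] with s hs
    exact ⟨hbd s hs, abs_le.1 (hts hs).1⟩)
  -- A small circle about the cluster point, on which `q ≠ c₀`, is a barrier of the same kind: a
  -- connected image that meets its interior cannot leave.
  refine ⟨w₀, Metric.tendsto_nhds.2 fun ρ hρ => ?_⟩
  obtain ⟨δ, hδ, hδq⟩ := Metric.mem_nhdsWithin_iff.1 (hiso w₀)
  set ρ' := min ρ (δ / 2)
  have hρ' : 0 < ρ' := lt_min hρ (by linarith)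
  have hsph : ∀ w ∈ Metric.sphere w₀ ρ', q w ≠ c₀ := by
    intro w hw
    refine hδq ⟨?_, ?_⟩
    · rw [Metric.mem_ball, Metric.mem_sphere.1 hw]
      exact (min_le_right _ _).trans_lt (by linarith)
    · rintro rfl
      simp at hw
      exact hρ'.ne hw
  obtain ⟨ε', hε', hεs⟩ : ∃ ε > 0, ∀ w ∈ Metric.sphere w₀ ρ', ε ≤ ‖q w - c₀‖ := by
    have hcont : Continuous fun w => ‖q w - c₀‖ := by fun_prop
    obtain ⟨v, hvs, hv⟩ := (isCompact_sphere w₀ ρ').exists_isMinOn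
      (NormedSpace.sphere_nonempty.2 hρ'.le) hcont.continuousOn
    exact ⟨_, norm_pos_iff.2 (sub_ne_zero.2 (hsph v hvs)), fun v' hv' => hv hv'⟩
  obtain ⟨t', ht'l, ht's, ht'c⟩ := hl _ (hq.eventually (Metric.ball_mem_nhds c₀ hε'))
  have hd : IsPreconnected ((fun w => dist w w₀) '' (Φ '' t')) :=
    ht'c.image _ (by fun_prop)
  have hfreq : ∃ᶠ s in l, Φ s ∈ Metric.ball w₀ ρ' :=
    hw₀.frequently (Metric.ball_mem_nhds w₀ hρ')
  obtain ⟨s₂, hs₂, hs₂t⟩ := (hfreq.and_eventually ht'l).exists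
  filter_upwards [ht'l] with s hs
  refine lt_of_lt_of_le ?_ (min_le_left ρ (δ / 2))
  by_contra hcon
  obtain ⟨_, ⟨s', hs', rfl⟩, h'⟩ := hd.ordConnected.out ⟨_, ⟨s₂, hs₂t, rfl⟩, rfl⟩
    ⟨_, ⟨s, hs, rfl⟩, rfl⟩ ⟨(Metric.mem_ball.1 hs₂).le, not_lt.1 hcon⟩
  have h1 := hεs _ h'
  have h2 := ht's hs'
  rw [mem_ofPred_eq, dist_eq_norm] at h2
  linarith

theorem exists_vertical_line_of_countable {S : Set ℂ} (hS : S.Countable) :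
    ∃ u : ℝ, ∀ v : ℝ, (u + v * Complex.I : ℂ) ∉ S := by
  obtain ⟨u, hu⟩ := ((hS.image Complex.re).dense_compl ℝ).nonempty
  exact ⟨u, fun v hv => hu ⟨_, hv, by simp⟩⟩

theorem isolated_of_not_const {q : ℂ → ℂ} (hq : Differentiable ℂ q) (c₀ : ℂ) {w₁ : ℂ}
    (hw₁ : q w₁ ≠ c₀) (w₀ : ℂ) : ∀ᶠ w in 𝓝[≠] w₀, q w ≠ c₀ := by
  have ha : AnalyticOnNhd ℂ (fun w => q w - c₀) univ :=
    (hq.sub_const c₀).differentiableOn.analyticOnNhd isOpen_univ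
  rcases (ha w₀ (mem_univ _)).eventually_eq_zero_or_eventually_ne_zero with h | h
  · have := ha.eqOn_zero_of_preconnected_of_eventuallyEq_zero isPreconnected_univ (mem_univ w₀) h
      (mem_univ w₁)
    exact absurd (sub_eq_zero.1 this) hw₁
  · exact h.mono fun w hw => sub_ne_zero.1 hw

theorem cos_re_eq (w : ℂ) : (Complex.cos w).re = Real.cos w.re * Real.cosh w.im := by
  conv_lhs => rw [← Complex.re_add_im w]
  rw [Complex.cos_add_mul_I, ← Complex.ofReal_cos, ← Complex.ofReal_cosh, ← Complex.ofReal_sin,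
    ← Complex.ofReal_sinh, ← Complex.ofReal_mul, ← Complex.ofReal_mul, Complex.sub_re,
    Complex.ofReal_re, Complex.re_ofReal_mul, Complex.I_re, mul_zero, sub_zero]

theorem cos_im_eq (w : ℂ) : (Complex.cos w).im = -(Real.sin w.re * Real.sinh w.im) := by
  conv_lhs => rw [← Complex.re_add_im w]
  rw [Complex.cos_add_mul_I, ← Complex.ofReal_cos, ← Complex.ofReal_cosh, ← Complex.ofReal_sin,
    ← Complex.ofReal_sinh, ← Complex.ofReal_mul, ← Complex.ofReal_mul, Complex.sub_im,
    Complex.ofReal_im, Complex.im_ofReal_mul, Complex.I_im, mul_one, zero_sub]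

theorem normSq_cos (w : ℂ) :
    Complex.normSq (Complex.cos w) = Real.cos w.re ^ 2 + Real.sinh w.im ^ 2 := by
  rw [Complex.normSq_apply, cos_re_eq, cos_im_eq]
  linear_combination (Real.cos w.re ^ 2) * Real.cosh_sq w.im +
    Real.sinh w.im ^ 2 * Real.sin_sq_add_cos_sq w.re

theorem abs_sinh_im_le_norm_cos (w : ℂ) : |Real.sinh w.im| ≤ ‖Complex.cos w‖ := by
  rw [← abs_norm, ← sq_le_sq, ← Complex.normSq_eq_norm_sq, normSq_cos]
  nlinarith [sq_nonneg (Real.cos w.re)]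

/-- If `cos ∘ Φ` converges, so does `Φ`. -/
theorem exists_tendsto_of_tendsto_cos {X : Type*} {l : Filter X} [l.NeBot] {Φ : X → ℂ} {c₀ : ℂ}
    (hl : ∀ s ∈ l, ∃ t ∈ l, t ⊆ s ∧ IsPreconnected (Φ '' t))
    (hq : Tendsto (fun s => Complex.cos (Φ s)) l (𝓝 c₀)) : ∃ w₀, Tendsto Φ l (𝓝 w₀) := by
  refine exists_tendsto_of_tendsto_comp hl Complex.continuous_cos Complex.cos_periodic hq ?_ ?_ ?_
  · refine ⟨Real.arsinh (‖c₀‖ + 1), ?_⟩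
    filter_upwards [hq.norm.eventually_lt_const (lt_add_one ‖c₀‖)] with s hs
    have h1 := (abs_sinh_im_le_norm_cos (Φ s)).trans hs.le
    rw [← Real.sinh_le_sinh, Real.sinh_arsinh, ← Real.abs_sinh]
    exact h1
  · obtain ⟨w₀, rfl⟩ := Complex.cos_surjective c₀
    have : {w | Complex.cos w = Complex.cos w₀}.Countable := by
      refine (countable_range fun n : ℤ => 2 * (n : ℂ) * Real.pi + w₀).union
        (countable_range fun n : ℤ => 2 * (n : ℂ) * Real.pi - w₀) |>.mono fun w hw => ?_
      obtain ⟨n, hn | hn⟩ := Complex.cos_eq_cos_iff.1 (Eq.symm hw)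
      · exact Or.inl ⟨n, hn.symm⟩
      · exact Or.inr ⟨n, hn.symm⟩
    exact exists_vertical_line_of_countable this
  · obtain ⟨w₁, hw₁⟩ := Complex.cos_surjective (c₀ + 1)
    exact isolated_of_not_const Complex.differentiable_cos c₀ (w₁ := w₁) (by rw [hw₁]; simp)

/-- If `exp (iΨ)` converges to a nonzero limit, then `Ψ` converges. -/
theorem exists_tendsto_of_tendsto_exp {X : Type*} {l : Filter X} [l.NeBot] {Ψ : X → ℂ} {c₀ : ℂ}
    (hc₀ : c₀ ≠ 0) (hl : ∀ s ∈ l, ∃ t ∈ l, t ⊆ s ∧ IsPreconnected (Ψ '' t))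
    (hq : Tendsto (fun s => Complex.exp (Complex.I * Ψ s)) l (𝓝 c₀)) :
    ∃ w₀, Tendsto Ψ l (𝓝 w₀) := by
  refine exists_tendsto_of_tendsto_comp (q := fun w => Complex.exp (Complex.I * w)) hl
    (by fun_prop) ?_ hq ?_ ?_ ?_
  · intro w
    rw [mul_add, show Complex.I * (2 * Real.pi) = 2 * Real.pi * Complex.I by ring,
      Complex.exp_periodic]
  · have h1 := hq.norm.log (norm_ne_zero_iff.2 hc₀)
    refine ⟨|Real.log ‖c₀‖| + 1, ?_⟩
    filter_upwards [h1.abs.eventually_lt_const (lt_add_one _)] with s hs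
    rw [Complex.norm_exp, Real.log_exp] at hs
    simpa using hs.le
  · have : {w | Complex.exp (Complex.I * w) = c₀}.Countable := by
      refine (countable_range fun n : ℤ => -Complex.I * (Complex.log c₀ + n * (2 * Real.pi * Complex.I)))
        |>.mono fun w hw => ?_
      rw [mem_ofPred_eq, ← Complex.exp_log hc₀, Complex.exp_eq_exp_iff_exists_int] at hw
      obtain ⟨n, hn⟩ := hw
      refine ⟨n, ?_⟩
      simp only [← hn]
      rw [← mul_assoc]; simp
    exact exists_vertical_line_of_countable this
  · intro w₀
    obtain ⟨w₁, hw₁⟩ : ∃ w₁, Complex.exp (Complex.I * w₁) ≠ c₀ := by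
      by_contra hcon
      push Not at hcon
      have h1 := hcon 0
      have h2 := hcon Real.pi
      rw [mul_comm, Complex.exp_pi_mul_I] at h2
      simp at h1
      rw [← h1] at h2
      norm_num at h2
    exact isolated_of_not_const (q := fun w => Complex.exp (Complex.I * w)) (by fun_prop) c₀ hw₁ w₀

/-- A continuous inverse of the Joukowski function off `[-1, 1]`. -/
theorem exists_joukowski_inverse : ∃ J : ℂ → ℂ, ∀ ζ : ℂ, (∀ t ∈ Icc (-1 : ℝ) 1, ζ ≠ t) →
    ContinuousAt J ζ ∧ J ζ ≠ 0 ∧ ‖J ζ‖ < 1 ∧ (J ζ + (J ζ)⁻¹) / 2 = ζ := by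
  -- The quotient `(ζ - 1)/(ζ + 1)` lies on the closed negative axis, or `ζ = -1`, exactly for `ζ`
  -- in `[-1, 1]`. Elsewhere its principal root `q` has positive real part, so `(1 - q)/(1 + q)` has
  -- modulus below `1`.
  refine ⟨fun ζ => (1 - ((ζ - 1) / (ζ + 1)) ^ (1 / 2 : ℂ)) /
    (1 + ((ζ - 1) / (ζ + 1)) ^ (1 / 2 : ℂ)), fun ζ hζ => ?_⟩
  have h1 : ζ + 1 ≠ 0 := by
    intro h; exact hζ (-1) (by simp) (by push_cast; linear_combination h)
  have hslit : (ζ - 1) / (ζ + 1) ∈ Complex.slitPlane := by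
    by_contra hcon
    rw [Complex.mem_slitPlane_iff, not_or, not_lt, not_not] at hcon
    set r := ((ζ - 1) / (ζ + 1)).re with hr
    have e : (ζ - 1) / (ζ + 1) = (r : ℂ) := Complex.ext (by simp [hr]) (by simp [hcon.2])
    have hr1 : (0 : ℝ) < 1 - r := by linarith [hcon.1]
    have hr1' : (1 - r : ℂ) ≠ 0 := by exact_mod_cast hr1.ne'
    refine hζ ((1 + r) / (1 - r)) ⟨?_, ?_⟩ ?_
    · rw [le_div_iff₀ hr1]; linarith
    · rw [div_le_iff₀ hr1]; linarith [hcon.1]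
    · rw [div_eq_iff h1] at e
      push_cast
      rw [eq_div_iff hr1']
      linear_combination e
  set p := (ζ - 1) / (ζ + 1) with hp
  have hp0 : p ≠ 0 := Complex.slitPlane_ne_zero hslit
  set q := p ^ (1 / 2 : ℂ) with hq
  have hqq : q ^ 2 = p := by
    rw [hq, ← Complex.cpow_nat_mul]; norm_num
  have hqre : 0 < q.re := by
    rw [hq, Complex.cpow_def_of_ne_zero hp0, Complex.exp_re]
    refine mul_pos (Real.exp_pos _) (Real.cos_pos_of_mem_Ioo ?_)
    have h2 : (Complex.log p * (1 / 2)).im = p.arg / 2 := by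
      rw [Complex.mul_im, Complex.log_im, Complex.log_re]; norm_num; ring
    rw [h2]
    have h3 := Complex.mem_slitPlane_iff_arg.1 hslit
    have h4 := Complex.neg_pi_lt_arg p
    have h5 := lt_of_le_of_ne (Complex.arg_le_pi p) h3.1
    constructor <;> linarith
  have hq1 : 1 + q ≠ 0 := by
    intro h; have := congrArg Complex.re h; simp at this; linarith
  have hq2 : 1 - q ≠ 0 := by
    intro h
    have hq' : q = 1 := by linear_combination -h
    rw [hq', hp, one_pow, eq_div_iff h1] at hqq
    have : (2 : ℂ) = 0 := by linear_combination hqq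
    norm_num at this
  refine ⟨?_, div_ne_zero hq2 hq1, ?_, ?_⟩
  · have hc : ContinuousAt (fun ζ : ℂ => ((ζ - 1) / (ζ + 1)) ^ (1 / 2 : ℂ)) ζ := by
      refine ContinuousAt.cpow ?_ continuousAt_const hslit
      exact ContinuousAt.div (by fun_prop) (by fun_prop) h1
    exact (continuousAt_const.sub hc).div (continuousAt_const.add hc) hq1
  · rw [norm_div, div_lt_one (norm_pos_iff.2 hq1), ← sq_lt_sq₀ (norm_nonneg _) (norm_nonneg _),
      ← Complex.normSq_eq_norm_sq, ← Complex.normSq_eq_norm_sq, Complex.normSq_apply,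
      Complex.normSq_apply]
    simp
    nlinarith
  · have h3 : p * (ζ + 1) = ζ - 1 := by rw [hp, div_mul_cancel₀ _ h1]
    have h4 : (1 - q) / (1 + q) + (1 + q) / (1 - q) = 2 * ζ := by
      rw [div_add_div _ _ hq1 hq2, div_eq_iff (mul_ne_zero hq1 hq2)]
      rw [← hqq] at h3
      linear_combination 2 * h3
    rw [inv_div, h4, mul_div_cancel_left₀ _ two_ne_zero]

end Lifting

/-! ### Solving `cos Φ = ±(1 - f)/L` on the closed strip -/

section Lift

/-- The open strip `0 < Im s < π/2`, mapped by `exp` onto the first quadrant. -/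
def strip : Set ℂ := Complex.im ⁻¹' Ioo 0 (Real.pi / 2)

/-- The closed strip `0 ≤ Im s ≤ π/2`. -/
def closedStrip : Set ℂ := Complex.im ⁻¹' Icc 0 (Real.pi / 2)

theorem isOpen_strip : IsOpen strip := isOpen_Ioo.preimage Complex.continuous_im

theorem strip_subset_closedStrip : strip ⊆ closedStrip := fun _ hs => ⟨hs.1.le, hs.2.le⟩

theorem convex_strip : Convex ℝ strip := (convex_Ioo 0 (Real.pi / 2)).linear_preimage Complex.imLm

theorem convex_closedStrip : Convex ℝ closedStrip :=
  (convex_Icc 0 (Real.pi / 2)).linear_preimage Complex.imLm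

theorem closure_strip : closure strip = closedStrip := by
  rw [strip, Complex.closure_preimage_im, closure_Ioo (by positivity), closedStrip]

theorem ofReal_mem_closedStrip (σ : ℝ) : (σ : ℂ) ∈ closedStrip := by
  simp [closedStrip]; positivity

theorem exp_mem_quadrant {s : ℂ} (hs : s ∈ strip) : Complex.exp s ∈ quadrant := by
  have h := hs
  simp only [strip, mem_preimage, mem_Ioo] at h
  constructor
  · rw [Complex.exp_re]
    exact mul_pos (Real.exp_pos _) (Real.cos_pos_of_mem_Ioo ⟨by linarith, by linarith⟩)
  · rw [Complex.exp_im]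
    exact mul_pos (Real.exp_pos _) (Real.sin_pos_of_mem_Ioo ⟨h.1, by linarith⟩)

theorem log_mem_strip {z : ℂ} (hz : z ∈ quadrant) : Complex.log z ∈ strip := by
  simp only [strip, mem_preimage, Complex.log_im]
  refine ⟨?_, Complex.arg_lt_pi_div_two_iff.2 (Or.inl hz.1)⟩
  refine lt_of_le_of_ne (Complex.arg_nonneg_iff.2 hz.2.le) fun h => ?_
  exact hz.2.ne' (Complex.arg_eq_zero_iff.1 h.symm).2

theorem ne_zero_of_mem_quadrant {z : ℂ} (hz : z ∈ quadrant) : z ≠ 0 := by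
  rintro rfl; exact lt_irrefl _ hz.1

/-- The error `(1 - f)/L`, normalized in sign so that it is `1` at the left end of the interval. -/
def normError (k : ℕ) {N : ℕ} (L : ℝ) (c : Fin N → ℝ) (z : ℂ) : ℂ :=
  (-1) ^ (k + 1) * (1 - oddLaurentC k c z) / L

theorem differentiableAt_normError (k : ℕ) {N : ℕ} (L : ℝ) (c : Fin N → ℝ) {z : ℂ} (hz : z ≠ 0) :
    DifferentiableAt ℂ (normError k L c) z := by
  unfold normError
  exact (((hasDerivAt_oddLaurentC c hz).differentiableAt.const_sub 1).const_mul _).div_const _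

theorem continuous_normError_exp (k : ℕ) {N : ℕ} (L : ℝ) (c : Fin N → ℝ) :
    Continuous fun s => normError k L c (Complex.exp s) :=
  continuous_iff_continuousAt.2 fun s =>
    ((differentiableAt_normError k L c (Complex.exp_ne_zero s)).continuousAt).comp
      Complex.continuous_exp.continuousAt

theorem neg_one_pow_mul_self (R : Type*) [CommRing R] (n : ℕ) : ((-1 : R)) ^ n * (-1) ^ n = 1 := by
  rw [← mul_pow]; simp

/-- `Φ` solves `cos Φ(s) = (normalized error at exp s)` on the closed strip. -/
structure IsLift (k : ℕ) {N : ℕ} (a L : ℝ) (c : Fin N → ℝ) (Φ : ℂ → ℂ) : Prop where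
  cont : ContinuousOn Φ closedStrip
  cos_eq : ∀ s ∈ closedStrip, Complex.cos (Φ s) = normError k L c (Complex.exp s)
  im_pos : ∀ s ∈ strip, 0 < (Φ s).im
  zero : Φ (Real.log a) = 0

variable {k m : ℕ} {a L : ℝ} {c : Fin (k + m + 1 + 1) → ℝ} {x : Fin (k + m + 1 + 1 + 1) → ℝ}

theorem IsExtremal.oddLaurentC_eq (h : IsExtremal k m a L c x) (z : ℂ) :
    oddLaurentC k c z = 1 - (-1) ^ (k + 1) * L * normError k L c z := by
  have hL : (L : ℂ) ≠ 0 := by exact_mod_cast h.L_pos.ne'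
  unfold normError
  field_simp
  linear_combination (1 - oddLaurentC k c z) * neg_one_pow_mul_self ℂ (k + 1)

theorem IsExtremal.levelPoly_ne_zero (h : IsExtremal k m a L c x) (γ : ℝ) : levelPoly k c γ ≠ 0 := by
  have hcl : c (Fin.last _) ≠ 0 := by
    intro h0; have := h.twist_last; simp [twist, h0] at this
  intro h0
  have := natDegree_levelPoly (γ := γ) hcl
  rw [h0] at this
  simp at this

/-- Root counting excludes the open interval of levels. By the open mapping theorem, attaining an
endpoint would entail attaining nearby levels inside as well. -/
theorem IsExtremal.oddLaurentC_ne (h : IsExtremal k m a L c x) {z : ℂ} (hz : z ∈ quadrant)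
    {γ : ℝ} (hγ : γ ∈ Icc (1 - L) (1 + L)) : oddLaurentC k c z ≠ γ := by
  intro heq
  have hz0 := ne_zero_of_mem_quadrant hz
  have hopen : IsOpen quadrant := by
    have : quadrant = Complex.re ⁻¹' Ioi 0 ∩ Complex.im ⁻¹' Ioi 0 := rfl
    rw [this]
    exact (isOpen_Ioi.preimage Complex.continuous_re).inter
      (isOpen_Ioi.preimage Complex.continuous_im)
  have han : AnalyticAt ℂ (oddLaurentC k c) z := by
    have : DifferentiableOn ℂ (oddLaurentC k c) quadrant := fun w hw =>
      (hasDerivAt_oddLaurentC c (ne_zero_of_mem_quadrant hw)).differentiableAt.differentiableWithinAt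
    exact this.analyticAt (hopen.mem_nhds hz)
  rcases han.eventually_constant_or_nhds_le_map_nhds with hc | hc
  · refine h.levelPoly_ne_zero γ (Polynomial.eq_zero_of_infinite_isRoot _ ?_)
    have hmem : {w | (levelPoly k c γ).IsRoot w} ∈ 𝓝 z := by
      filter_upwards [hc, hopen.mem_nhds hz] with w hw hwq
      rw [Polynomial.IsRoot.def, eval_levelPoly _ _ _ (ne_zero_of_mem_quadrant hwq),
        hw, heq]
      simp
    exact infinite_of_mem_nhds z hmem
  · rw [heq] at hc
    have h1 : oddLaurentC k c '' quadrant ∈ 𝓝 (γ : ℂ) := hc (image_mem_map (hopen.mem_nhds hz))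
    have h2 : Complex.ofReal ⁻¹' (oddLaurentC k c '' quadrant) ∈ 𝓝 γ :=
      Complex.continuous_ofReal.continuousAt.preimage_mem_nhds h1
    have h3 : γ ∈ closure (Ioo (1 - L) (1 + L)) := by
      rwa [closure_Ioo (by linarith [h.L_pos])]
    obtain ⟨γ', ⟨w, hw, hwγ⟩, hγ'⟩ := mem_closure_iff_nhds.1 h3 _ h2
    exact h.level w hw.1 hw.2.ne' γ' hγ' hwγ

theorem IsExtremal.normError_ne (h : IsExtremal k m a L c x) {z : ℂ} (hz : z ∈ quadrant)
    {t : ℝ} (ht : t ∈ Icc (-1) 1) : normError k L c z ≠ t := by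
  intro heq
  have h1 := h.oddLaurentC_eq z
  rw [heq] at h1
  refine h.oddLaurentC_ne hz (γ := 1 - (-1) ^ (k + 1) * L * t) ?_ (by rw [h1]; push_cast; ring)
  have hL := h.L_pos
  rcases neg_one_pow_eq_or ℝ (k + 1) with hs | hs <;> rw [hs] <;>
    constructor <;> nlinarith [ht.1, ht.2]

theorem normError_ofReal (k : ℕ) {N : ℕ} (L : ℝ) (c : Fin N → ℝ) (y : ℝ) :
    normError k L c y = (((-1) ^ (k + 1) * (1 - oddLaurent k c y) / L : ℝ) : ℂ) := by
  rw [normError, oddLaurentC_ofReal]; push_cast; ring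

theorem IsExtremal.normError_point (h : IsExtremal k m a L c x) (i : Fin (k + m + 1 + 1 + 1)) :
    normError k L c (x i) = (-1) ^ (i : ℕ) := by
  have hL := h.L_pos.ne'
  rw [normError_ofReal, h.value]
  have : ((-1) ^ (k + 1) * ((-1) ^ (k + 1 + (i : ℕ)) * L) / L : ℝ) = (-1) ^ (i : ℕ) := by
    rw [pow_add (-1 : ℝ) (k + 1) (i : ℕ)]
    rw [div_eq_iff hL]
    linear_combination (-1) ^ (i : ℕ) * L * neg_one_pow_mul_self ℝ (k + 1)
  rw [this]; push_cast; rfl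

theorem exists_preconnected_image_nhdsWithin {Φ : ℂ → ℂ} {S : Set ℂ} (hS : Convex ℝ S)
    (hΦ : ContinuousOn Φ S) (s₀ : ℂ) :
    ∀ u ∈ 𝓝[S] s₀, ∃ t ∈ 𝓝[S] s₀, t ⊆ u ∧ IsPreconnected (Φ '' t) := by
  intro u hu
  obtain ⟨δ, hδ, hδu⟩ := Metric.mem_nhdsWithin_iff.1 hu
  refine ⟨Metric.ball s₀ δ ∩ S, ?_, hδu, ?_⟩
  · exact inter_mem (mem_nhdsWithin_of_mem_nhds (Metric.ball_mem_nhds _ hδ)) self_mem_nhdsWithin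
  · exact (((convex_ball _ _).inter hS).isPreconnected).image _ (hΦ.mono inter_subset_right)

/-- The normalized error avoids `[-1, 1]`, so its inverse Joukowski image is a nonvanishing function
on a simply connected strip and has a logarithm. Dividing by `i` gives a solution; modulus below `1`
becomes positive imaginary part. Boundary limits exist because those of the cosine do, and a
translation by a multiple of `2π` normalizes the value at `log a`. -/
theorem IsExtremal.exists_isLift (h : IsExtremal k m a L c x) : ∃ Φ, IsLift k a L c Φ := by
  obtain ⟨J, hJ⟩ := exists_joukowski_inverse
  have hJs : ∀ s ∈ strip, _ := fun s hs =>
    hJ (normError k L c (Complex.exp s)) fun t ht => h.normError_ne (exp_mem_quadrant hs) ht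
  have hne : strip.Nonempty := ⟨(Real.pi / 4 : ℝ) * Complex.I, by
    have := Real.pi_pos
    simp [strip]; constructor <;> linarith⟩
  have hsc : IsSimplyConnected strip := by
    have := convex_strip.contractibleSpace hne
    exact (inferInstance : SimplyConnectedSpace strip)
  obtain ⟨f, hfc, hf⟩ := Complex.exists_continuousOn_eqOn_exp_comp hsc isOpen_strip
    (g := fun s => J (normError k L c (Complex.exp s)))
    (fun s hs => ((hJs s hs).1.comp
      (f := fun s => normError k L c (Complex.exp s))
      (continuous_normError_exp k L c).continuousAt).continuousWithinAt)
    (by rintro ⟨s, hs, h0⟩; exact (hJs s hs).2.1 h0)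
  have hf' : ∀ s ∈ strip, Complex.exp (f s) = J (normError k L c (Complex.exp s)) := hf
  let Φ₀ : ℂ → ℂ := fun s => -Complex.I * f s
  have hΦc : ContinuousOn Φ₀ strip := continuousOn_const.mul hfc
  have hcos : ∀ s ∈ strip, Complex.cos (Φ₀ s) = normError k L c (Complex.exp s) := by
    intro s hs
    have e1 : -Complex.I * f s * Complex.I = f s := by
      rw [mul_right_comm]; simp
    have e2 : -(-Complex.I * f s) * Complex.I = -f s := by
      rw [neg_mul, e1]
    rw [Complex.cos, e1, e2, Complex.exp_neg, hf' s hs]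
    exact (hJs s hs).2.2.2
  have him : ∀ s ∈ strip, 0 < (Φ₀ s).im := by
    intro s hs
    have h1 := (hJs s hs).2.2.1
    rw [← hf' s hs, Complex.norm_exp, Real.exp_lt_one_iff] at h1
    simpa [Φ₀] using h1
  have hlim : ∀ s₀ ∈ closedStrip, ∃ w, Tendsto Φ₀ (𝓝[strip] s₀) (𝓝 w) := by
    intro s₀ hs₀
    rw [← closure_strip] at hs₀
    have := mem_closure_iff_nhdsWithin_neBot.1 hs₀
    refine exists_tendsto_of_tendsto_cos
      (exists_preconnected_image_nhdsWithin convex_strip hΦc s₀)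
      (c₀ := normError k L c (Complex.exp s₀)) ?_
    refine (((continuous_normError_exp k L c).tendsto s₀).mono_left nhdsWithin_le_nhds).congr' ?_
    filter_upwards [self_mem_nhdsWithin] with s hs using (hcos s hs).symm
  let Φ₁ := extendFrom strip Φ₀
  have hΦ₁ : ContinuousOn Φ₁ closedStrip :=
    continuousOn_extendFrom closure_strip.ge hlim
  have hext : ∀ s ∈ strip, Φ₁ s = Φ₀ s := extendFrom_extends hΦc
  have hcos₁ : ∀ s ∈ closedStrip, Complex.cos (Φ₁ s) = normError k L c (Complex.exp s) := by
    intro s₀ hs₀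
    have hs₀' := hs₀
    rw [← closure_strip] at hs₀'
    have := mem_closure_iff_nhdsWithin_neBot.1 hs₀'
    have h1 := tendsto_extendFrom (hlim s₀ hs₀)
    have h2 := (Complex.continuous_cos.tendsto _).comp h1
    refine tendsto_nhds_unique h2 ?_
    refine (((continuous_normError_exp k L c).tendsto s₀).mono_left nhdsWithin_le_nhds).congr' ?_
    filter_upwards [self_mem_nhdsWithin] with s hs using (hcos s hs).symm
  have hone : Complex.cos (Φ₁ (Real.log a)) = Complex.cos 0 := by
    rw [hcos₁ _ (ofReal_mem_closedStrip _), ← Complex.ofReal_exp, Real.exp_log h.a_pos, ← h.first,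
      h.normError_point]
    simp
  obtain ⟨n, hn⟩ := Complex.cos_eq_cos_iff.1 hone.symm
  have hn' : Φ₁ (Real.log a) = n * (2 * Real.pi) := by
    rcases hn with hn | hn <;> rw [hn] <;> ring
  refine ⟨fun s => Φ₁ s - n * (2 * Real.pi), hΦ₁.sub continuousOn_const, fun s hs => ?_,
    fun s hs => ?_, ?_⟩
  · rw [Complex.cos_sub_int_mul_two_pi, hcos₁ s hs]
  · have := him s hs
    rw [← hext s hs] at this
    simpa using this
  · rw [hn', sub_self]

end Lift

/-! ### Boundary values on the real axis -/

section Bottom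

/-- The normalized error on the real axis. -/
def realError (k : ℕ) {N : ℕ} (L : ℝ) (c : Fin N → ℝ) (y : ℝ) : ℝ :=
  (-1) ^ (k + 1) * (1 - oddLaurent k c y) / L

theorem normError_eq_realError (k : ℕ) {N : ℕ} (L : ℝ) (c : Fin N → ℝ) (y : ℝ) :
    normError k L c y = (realError k L c y : ℂ) := normError_ofReal k L c y

theorem hasDerivAt_realError (k : ℕ) {N : ℕ} (L : ℝ) (c : Fin N → ℝ) {y : ℝ} (hy : y ≠ 0) :
    HasDerivAt (realError k L c)
      (-((-1) ^ (k + 1) * oddLaurent k (eulerCoeff k c) y) / (y * L)) y := by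
  convert! (((hasDerivAt_oddLaurent (k := k) c hy).const_sub 1).const_mul ((-1) ^ (k + 1))).div_const
    L using 1
  field_simp

/-- A continuous function cannot pass from one multiple of `π` to another without taking the value
half a period above the lower one, where the sine is nonzero. -/
theorem eq_of_sin_eq_zero {s : Set ℝ} (hs : IsPreconnected s) {u : ℝ → ℝ} (hu : ContinuousOn u s)
    (h0 : ∀ σ ∈ s, Real.sin (u σ) = 0) {σ σ' : ℝ} (hσ : σ ∈ s) (hσ' : σ' ∈ s) : u σ = u σ' := by
  have key : ∀ {σ σ' : ℝ}, σ ∈ s → σ' ∈ s → ¬ u σ < u σ' := by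
    intro σ σ' hσ hσ' hlt
    obtain ⟨n, hn⟩ := Real.sin_eq_zero_iff.1 (h0 σ hσ)
    obtain ⟨n', hn'⟩ := Real.sin_eq_zero_iff.1 (h0 σ' hσ')
    rw [← hn, ← hn'] at hlt
    have hnn : (n : ℝ) < n' := lt_of_mul_lt_mul_right hlt Real.pi_pos.le
    have hnn' : (n : ℝ) + 1 ≤ n' := by exact_mod_cast Int.add_one_le_iff.2 (by exact_mod_cast hnn)
    have hpi := Real.pi_pos
    obtain ⟨t, ht, htv⟩ := (hs.image _ hu).ordConnected.out ⟨σ, hσ, rfl⟩ ⟨σ', hσ', rfl⟩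
      (show n * Real.pi + Real.pi / 2 ∈ Icc (u σ) (u σ') from ⟨by rw [← hn]; linarith, by
        rw [← hn']; nlinarith⟩)
    have h1 := h0 t ht
    rw [htv, Real.sin_add_pi_div_two, Real.cos_int_mul_pi] at h1
    exact absurd h1 (zpow_ne_zero _ (by norm_num))
  exact le_antisymm (not_lt.1 (key hσ' hσ)) (not_lt.1 (key hσ hσ'))

variable {k m : ℕ} {a L : ℝ} {c : Fin (k + m + 1 + 1) → ℝ} {x : Fin (k + m + 1 + 1 + 1) → ℝ}
  {Φ : ℂ → ℂ}

theorem IsExtremal.pos (h : IsExtremal k m a L c x) (i : Fin (k + m + 1 + 1 + 1)) : 0 < x i :=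
  h.a_pos.trans_le (h.first ▸ h.strictMono.monotone (Fin.zero_le i))

theorem IsExtremal.realError_point (h : IsExtremal k m a L c x) (i : Fin (k + m + 1 + 1 + 1)) :
    realError k L c (x i) = (-1) ^ (i : ℕ) := by
  have := h.normError_point i
  rw [normError_eq_realError] at this
  exact_mod_cast this

theorem continuousOn_realError (k : ℕ) {N : ℕ} (L : ℝ) (c : Fin N → ℝ) :
    ContinuousOn (realError k L c) (Ioi 0) := fun _ hy =>
  (hasDerivAt_realError k L c (ne_of_gt hy)).continuousAt.continuousWithinAt

theorem IsExtremal.strictAntiOn_between (h : IsExtremal k m a L c x) (i : Fin (k + m + 1 + 1)) :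
    StrictAntiOn (fun y => (-1) ^ (i : ℕ) * realError k L c y)
      (Icc (x i.castSucc) (x i.succ)) := by
  refine strictAntiOn_of_deriv_neg (convex_Icc _ _) ?_ fun y hy => ?_
  · exact continuousOn_const.mul ((continuousOn_realError k L c).mono fun y hy =>
      (h.pos _).trans_le hy.1)
  · rw [interior_Icc] at hy
    have hy0 := (h.pos _).trans hy.1
    rw [((hasDerivAt_realError k L c hy0.ne').const_mul _).deriv]
    have h1 := h.deriv_between i y hy
    rw [pow_add] at h1
    have h2 : (-1 : ℝ) ^ (i : ℕ) * (-((-1) ^ (k + 1) * oddLaurent k (eulerCoeff k c) y) / (y * L)) =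
      -((-1) ^ (k + 1) * (-1) ^ (i : ℕ) * oddLaurent k (eulerCoeff k c) y / (y * L)) := by ring
    rw [h2, neg_lt_zero]
    exact div_pos h1 (mul_pos hy0 h.L_pos)

theorem IsExtremal.one_lt_realError_left (h : IsExtremal k m a L c x) {y : ℝ} (hy : 0 < y)
    (hya : y < a) : 1 < realError k L c y := by
  have hanti : StrictAntiOn (realError k L c) (Ioc 0 a) := by
    refine strictAntiOn_of_deriv_neg (convex_Ioc _ _)
      ((continuousOn_realError k L c).mono fun y hy => hy.1) fun y hy => ?_
    rw [interior_Ioc] at hy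
    rw [(hasDerivAt_realError k L c hy.1.ne').deriv, neg_div, neg_lt_zero]
    exact div_pos (h.deriv_left y ⟨hy.1, hy.2.le⟩) (mul_pos hy.1 h.L_pos)
  have h1 := hanti ⟨hy, hya.le⟩ ⟨h.a_pos, le_rfl⟩ hya
  have h2 := h.realError_point 0
  rw [h.first] at h2
  rw [h2] at h1
  simpa using h1

theorem IsExtremal.one_lt_abs_realError_right (h : IsExtremal k m a L c x) {y : ℝ} (hy : 1 < y) :
    1 < |realError k L c y| := by
  have hanti : StrictAntiOn (fun y => (-1) ^ (k + m + 1) * realError k L c y) (Ici 1) := by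
    refine strictAntiOn_of_deriv_neg (convex_Ici _)
      (continuousOn_const.mul ((continuousOn_realError k L c).mono fun y hy =>
        mem_Ioi.2 (one_pos.trans_le (mem_Ici.1 hy)))) fun y hy => ?_
    rw [interior_Ici] at hy
    have hy0 : 0 < y := one_pos.trans hy
    rw [((hasDerivAt_realError k L c hy0.ne').const_mul _).deriv]
    have e : ((-1 : ℝ)) ^ (k + m + 1) * (-1) ^ (k + 1) = (-1) ^ m := by
      rw [← pow_add, show k + m + 1 + (k + 1) = 2 * (k + 1) + m by ring, pow_add, pow_mul]; simp
    have h2 : (-1 : ℝ) ^ (k + m + 1) *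
        (-((-1) ^ (k + 1) * oddLaurent k (eulerCoeff k c) y) / (y * L)) =
        -((-1) ^ m * oddLaurent k (eulerCoeff k c) y / (y * L)) := by rw [← e]; ring
    rw [h2, neg_lt_zero]
    exact div_pos (h.deriv_right y (mem_Ici.2 (le_of_lt (mem_Ioi.1 hy)))) (mul_pos hy0 h.L_pos)
  have h1 := hanti (mem_Ici.2 le_rfl) (mem_Ici.2 hy.le) hy
  have h2 := h.realError_point (Fin.last _)
  rw [h.last, Fin.val_last] at h2
  simp only [h2] at h1
  have e : ((-1 : ℝ)) ^ (k + m + 1) * (-1) ^ (k + m + 1 + 1) = -1 := by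
    rw [pow_succ _ (k + m + 1), ← mul_assoc, neg_one_pow_mul_self]; simp
  rw [e] at h1
  have h3 : 1 < |(-1) ^ (k + m + 1) * realError k L c y| := lt_abs.2 (Or.inr (by linarith))
  rwa [abs_mul, abs_neg_one_pow, one_mul] at h3

theorem IsExtremal.abs_realError_lt (h : IsExtremal k m a L c x) (i : Fin (k + m + 1 + 1)) {y : ℝ}
    (hy : y ∈ Ioo (x i.castSucc) (x i.succ)) : |realError k L c y| < 1 := by
  have hlt := hy.1.trans hy.2
  have h1 := h.strictAntiOn_between i ⟨le_rfl, hlt.le⟩ ⟨hy.1.le, hy.2.le⟩ hy.1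
  have h2 := h.strictAntiOn_between i ⟨hy.1.le, hy.2.le⟩ ⟨hlt.le, le_rfl⟩ hy.2
  simp only [h.realError_point, Fin.val_succ, Fin.val_castSucc, pow_succ, ← mul_assoc,
    neg_one_pow_mul_self] at h1 h2
  have h3 : |(-1) ^ (i : ℕ) * realError k L c y| < 1 := abs_lt.2 ⟨by linarith, h1⟩
  rwa [abs_mul, abs_neg_one_pow, one_mul] at h3

theorem IsLift.im_nonneg {N : ℕ} {c : Fin N → ℝ} (hΦ : IsLift k a L c Φ) {s : ℂ}
    (hs : s ∈ closedStrip) : 0 ≤ (Φ s).im := by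
  have hs' := hs
  rw [← closure_strip] at hs'
  have := mem_closure_iff_nhdsWithin_neBot.1 hs'
  have h1 : Tendsto (fun s => (Φ s).im) (𝓝[strip] s) (𝓝 (Φ s).im) :=
    (Complex.continuous_im.tendsto _).comp ((hΦ.cont s hs).mono strip_subset_closedStrip)
  refine ge_of_tendsto h1 ?_
  filter_upwards [self_mem_nhdsWithin] with t ht using (hΦ.im_pos t ht).le

theorem IsLift.cos_real {N : ℕ} {c : Fin N → ℝ} (hΦ : IsLift k a L c Φ) (σ : ℝ) :
    Complex.cos (Φ σ) = (realError k L c (Real.exp σ) : ℂ) := by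
  rw [hΦ.cos_eq _ (ofReal_mem_closedStrip σ), ← Complex.ofReal_exp, normError_eq_realError]

theorem IsLift.cos_mul_cosh {N : ℕ} {c : Fin N → ℝ} (hΦ : IsLift k a L c Φ) (σ : ℝ) :
    Real.cos (Φ σ).re * Real.cosh (Φ σ).im = realError k L c (Real.exp σ) := by
  rw [← cos_re_eq, hΦ.cos_real, Complex.ofReal_re]

theorem IsLift.sin_mul_sinh {N : ℕ} {c : Fin N → ℝ} (hΦ : IsLift k a L c Φ) (σ : ℝ) :
    Real.sin (Φ σ).re * Real.sinh (Φ σ).im = 0 := by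
  have := cos_im_eq (Φ σ)
  rw [hΦ.cos_real, Complex.ofReal_im] at this
  linarith

theorem IsLift.im_eq_zero {N : ℕ} {c : Fin N → ℝ} (hΦ : IsLift k a L c Φ) {σ : ℝ}
    (hσ : |realError k L c (Real.exp σ)| ≤ 1) : (Φ σ).im = 0 := by
  rcases mul_eq_zero.1 (hΦ.sin_mul_sinh σ) with h1 | h1
  · have h2 := normSq_cos (Φ σ)
    rw [hΦ.cos_real, Complex.normSq_ofReal] at h2
    have h3 := Real.sin_sq_add_cos_sq (Φ σ).re
    have h4 : Real.sinh (Φ σ).im ^ 2 ≤ 0 := by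
      have := (sq_le_one_iff_abs_le_one _).2 hσ
      rw [h1] at h3
      nlinarith
    exact Real.sinh_eq_zero.1 (pow_eq_zero_iff two_ne_zero |>.1 (le_antisymm h4 (sq_nonneg _)))
  · exact Real.sinh_eq_zero.1 h1

theorem IsLift.sin_re_eq_zero {N : ℕ} {c : Fin N → ℝ} (hΦ : IsLift k a L c Φ) {σ : ℝ}
    (hσ : 1 < |realError k L c (Real.exp σ)|) : Real.sin (Φ σ).re = 0 ∧ 0 < (Φ σ).im := by
  have hne : (Φ σ).im ≠ 0 := by
    intro h0
    have := hΦ.cos_mul_cosh σ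
    rw [h0, Real.cosh_zero, mul_one] at this
    rw [← this] at hσ
    exact not_lt.2 (Real.abs_cos_le_one _) hσ
  refine ⟨(mul_eq_zero.1 (hΦ.sin_mul_sinh σ)).resolve_right fun h => hne (Real.sinh_eq_zero.1 h), ?_⟩
  exact lt_of_le_of_ne (hΦ.im_nonneg (ofReal_mem_closedStrip σ)) (Ne.symm hne)

theorem IsLift.continuous_re_real {N : ℕ} {c : Fin N → ℝ} (hΦ : IsLift k a L c Φ) :
    Continuous fun σ : ℝ => (Φ σ).re :=
  Complex.continuous_re.comp (hΦ.cont.comp_continuous Complex.continuous_ofReal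
    ofReal_mem_closedStrip)

/-- This decides in which direction `Re Φ` moves away from an alternation point. Just above the real
axis `Im cos Φ = -sin (Re Φ) sinh (Im Φ)` with `Im Φ > 0`, and the sign of the left side is that of
the derivative of the error. -/
theorem IsExtremal.sin_sign (h : IsExtremal k m a L c x) (hΦ : IsLift k a L c Φ)
    (i : Fin (k + m + 1 + 1)) {σ : ℝ} (hσ : Real.exp σ ∈ Ioo (x i.castSucc) (x i.succ)) :
    0 ≤ (-1) ^ (i : ℕ) * Real.sin (Φ σ).re := by
  let p : ℝ → ℂ := fun τ => σ + τ * Complex.I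
  have hp : HasDerivAt p Complex.I 0 := by
    convert! ((Complex.ofRealCLM.hasDerivAt (x := 0)).mul_const Complex.I).const_add (σ : ℂ) using 1
    simp
  have hy0 : Real.exp σ ≠ 0 := (Real.exp_pos σ).ne'
  set y := Real.exp σ with hy
  have hGd : HasDerivAt (normError k L c)
      (-((-1) ^ (k + 1) * (oddLaurentC k (eulerCoeff k c) y / y)) / L) y := by
    convert! (((hasDerivAt_oddLaurentC (k := k) c (z := (y : ℂ))
      (by exact_mod_cast hy0)).const_sub 1).const_mul ((-1) ^ (k + 1))).div_const (L : ℂ) using 1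
    ring
  have hexp : HasDerivAt (fun τ : ℝ => Complex.exp (p τ)) ((y : ℂ) * Complex.I) 0 := by
    have := hp.cexp
    simpa [p, hy] using this
  have hE0 : Complex.exp (p 0) = y := by simp [p, hy]
  have hd : HasDerivAt (fun τ : ℝ => normError k L c (Complex.exp (p τ)))
      (-((-1) ^ (k + 1) * (oddLaurentC k (eulerCoeff k c) y / y)) / L * ((y : ℂ) * Complex.I)) 0 := by
    have hGd' := hGd
    rw [← hE0] at hGd'
    convert! hGd'.comp (0 : ℝ) hexp using 1
    rw [hE0]
  have hd' := (Complex.imCLM.hasFDerivAt.comp_hasDerivAt (0 : ℝ) hd)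
  have hval : Complex.imCLM (-((-1) ^ (k + 1) * (oddLaurentC k (eulerCoeff k c) y / y)) / L *
      ((y : ℂ) * Complex.I)) = -((-1) ^ (k + 1) * oddLaurent k (eulerCoeff k c) y / L) := by
    rw [oddLaurentC_ofReal]
    have : -((-1) ^ (k + 1) * ((oddLaurent k (eulerCoeff k c) y : ℂ) / y)) / L *
        ((y : ℂ) * Complex.I) =
        ((-((-1) ^ (k + 1) * oddLaurent k (eulerCoeff k c) y / L) : ℝ) : ℂ) * Complex.I := by
      have hyc : (y : ℂ) ≠ 0 := by exact_mod_cast hy0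
      push_cast
      field_simp
    rw [this, Complex.imCLM_apply, Complex.im_ofReal_mul, Complex.I_im, mul_one]
  rw [hval] at hd'
  have hslope := hd'.tendsto_slope_zero_right
  have hneg : -((-1) ^ (i : ℕ) * -((-1) ^ (k + 1) * oddLaurent k (eulerCoeff k c) y / L)) > 0 := by
    have h1 := div_pos (h.deriv_between i y hσ) h.L_pos
    rw [pow_add] at h1
    have e : -((-1) ^ (i : ℕ) * -((-1) ^ (k + 1) * oddLaurent k (eulerCoeff k c) y / L)) =
      (-1) ^ (k + 1) * (-1) ^ (i : ℕ) * oddLaurent k (eulerCoeff k c) y / L := by ring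
    rw [e]; exact h1
  have hev := ((hslope.const_mul ((-1) ^ (i : ℕ))).neg).eventually_const_lt hneg
  have hp' : Tendsto p (𝓝[>] 0) (𝓝[closedStrip] (σ : ℂ)) := by
    refine tendsto_nhdsWithin_iff.2 ⟨?_, ?_⟩
    · have := hp.continuousAt.tendsto.mono_left (nhdsWithin_le_nhds (s := Ioi 0))
      simpa [p] using this
    · filter_upwards [Ioo_mem_nhdsGT (show (0 : ℝ) < Real.pi / 2 by positivity)] with τ hτ
      exact strip_subset_closedStrip (by simpa [strip, p] using hτ)
  have hlim : Tendsto (fun τ => (-1) ^ (i : ℕ) * Real.sin (Φ (p τ)).re) (𝓝[>] 0)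
      (𝓝 ((-1) ^ (i : ℕ) * Real.sin (Φ σ).re)) :=
    (((Real.continuous_sin.comp Complex.continuous_re).tendsto _).comp
      ((hΦ.cont _ (ofReal_mem_closedStrip σ)).tendsto.comp hp')).const_mul _
  refine ge_of_tendsto hlim ?_
  filter_upwards [hev, Ioo_mem_nhdsGT (show (0 : ℝ) < Real.pi / 2 by positivity)] with τ hτ hτ'
  have hs : p τ ∈ strip := by simpa [strip, p] using hτ'
  have h0 : (normError k L c (Complex.exp (p 0))).im = 0 := by
    rw [hE0, normError_eq_realError, Complex.ofReal_im]
  simp only [Function.comp_apply, Complex.imCLM_apply, zero_add, h0, sub_zero, smul_eq_mul] at hτ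
  rw [← hΦ.cos_eq _ (strip_subset_closedStrip hs), cos_im_eq] at hτ
  have hsinh : 0 < Real.sinh (Φ (p τ)).im := Real.sinh_pos_iff.2 (hΦ.im_pos _ hs)
  have h3 : 0 < ((-1) ^ (i : ℕ) * Real.sin (Φ (p τ)).re) * (Real.sinh (Φ (p τ)).im * τ⁻¹) := by
    linarith
  exact ((mul_pos_iff_of_pos_right (mul_pos hsinh (inv_pos.2 hτ'.1))).1 h3).le

/-- Between two alternation points the real part of the lift increases by `π`. -/
theorem IsExtremal.re_between (h : IsExtremal k m a L c x) (hΦ : IsLift k a L c Φ)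
    (i : Fin (k + m + 1 + 1)) (hi : (Φ (Real.log (x i.castSucc))).re = (i : ℕ) * Real.pi) {σ : ℝ}
    (hσ : σ ∈ Icc (Real.log (x i.castSucc)) (Real.log (x i.succ))) :
    (Φ σ).re = (i : ℕ) * Real.pi + Real.arccos ((-1) ^ (i : ℕ) * realError k L c (Real.exp σ)) := by
  have hpi := Real.pi_pos
  have hlog : Real.log (x i.castSucc) < Real.log (x i.succ) :=
    Real.log_lt_log (h.pos _) (h.strictMono Fin.castSucc_lt_succ)
  have hexp : ∀ σ ∈ Ioo (Real.log (x i.castSucc)) (Real.log (x i.succ)),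
      Real.exp σ ∈ Ioo (x i.castSucc) (x i.succ) := fun σ hσ =>
    ⟨(Real.log_lt_iff_lt_exp (h.pos _)).1 hσ.1, (Real.lt_log_iff_exp_lt (h.pos _)).1 hσ.2⟩
  have hsin : ∀ σ ∈ Ioo (Real.log (x i.castSucc)) (Real.log (x i.succ)),
      Real.sin (Φ σ).re ≠ 0 := by
    intro σ hσ h0
    have h1 := h.abs_realError_lt i (hexp σ hσ)
    have h2 := hΦ.cos_mul_cosh σ
    rw [hΦ.im_eq_zero h1.le, Real.cosh_zero, mul_one] at h2
    rw [← h2] at h1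
    have h3 := Real.sin_sq_add_cos_sq (Φ σ).re
    rw [h0] at h3
    have := (sq_lt_one_iff_abs_lt_one _).2 h1
    linarith
  have hcont : Continuous fun σ : ℝ => (Φ σ).re := hΦ.continuous_re_real
  -- Strictly between alternation points the sine does not vanish, so `Re Φ` stays between
  -- neighbouring multiples of `π`. The interval below `iπ` is excluded by the sign of the sine.
  have hopen : ∀ σ ∈ Ioo (Real.log (x i.castSucc)) (Real.log (x i.succ)),
      (Φ σ).re ∈ Icc ((i : ℕ) * Real.pi) ((i : ℕ) * Real.pi + Real.pi) := by
    intro σ hσ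
    have hne : ∀ n : ℤ, ∀ t ∈ Ioo (Real.log (x i.castSucc)) (Real.log (x i.succ)),
        (Φ t).re ≠ n * Real.pi := fun n t ht h0 =>
      hsin t ht (Real.sin_eq_zero_iff.2 ⟨n, h0.symm⟩)
    constructor
    · by_contra hcon
      push Not at hcon
      have hlow : (i : ℕ) * Real.pi - Real.pi < (Φ σ).re := by
        by_contra hcon'
        push Not at hcon'
        obtain ⟨t, ht, ht'⟩ := intermediate_value_Icc' hσ.1.le hcont.continuousOn
          (show (i : ℕ) * Real.pi - Real.pi ∈ Icc _ _ from ⟨hcon', by rw [hi]; linarith⟩)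
        simp only at ht'
        have htne : t ≠ Real.log (x i.castSucc) := by
          rintro rfl
          rw [hi] at ht'
          linarith
        refine hne ((i : ℕ) - 1) t ⟨lt_of_le_of_ne ht.1 (Ne.symm htne), ht.2.trans_lt hσ.2⟩ ?_
        rw [ht']; push_cast; ring
      have h1 := h.sin_sign hΦ i (hexp σ hσ)
      have h2 : Real.sin ((Φ σ).re - (i : ℕ) * Real.pi) < 0 :=
        Real.sin_neg_of_neg_of_neg_pi_lt (by linarith) (by linarith)
      rw [Real.sin_sub_nat_mul_pi] at h2
      linarith
    · by_contra hcon
      push Not at hcon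
      obtain ⟨t, ht, ht'⟩ := intermediate_value_Icc hσ.1.le hcont.continuousOn
        (show (i : ℕ) * Real.pi + Real.pi ∈ Icc _ _ from ⟨by rw [hi]; linarith, hcon.le⟩)
      simp only at ht'
      have htne : t ≠ Real.log (x i.castSucc) := by
        rintro rfl
        rw [hi] at ht'
        linarith
      refine hne ((i : ℕ) + 1) t ⟨lt_of_le_of_ne ht.1 (Ne.symm htne), ht.2.trans_lt hσ.2⟩ ?_
      rw [ht']; push_cast; ring
  have hclosed : (Φ σ).re ∈ Icc ((i : ℕ) * Real.pi) ((i : ℕ) * Real.pi + Real.pi) := by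
    have hcl : Icc (Real.log (x i.castSucc)) (Real.log (x i.succ)) ⊆
        (fun σ : ℝ => (Φ σ).re) ⁻¹' Icc ((i : ℕ) * Real.pi) ((i : ℕ) * Real.pi + Real.pi) := by
      rw [← closure_Ioo hlog.ne]
      exact closure_minimal hopen (isClosed_Icc.preimage hcont)
    exact hcl hσ
  have habs : |realError k L c (Real.exp σ)| ≤ 1 := by
    have hcl : Icc (Real.log (x i.castSucc)) (Real.log (x i.succ)) ⊆
        (fun σ : ℝ => |realError k L c (Real.exp σ)|) ⁻¹' Iic 1 := by
      rw [← closure_Ioo hlog.ne]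
      refine closure_minimal (fun t ht => (h.abs_realError_lt i (hexp t ht)).le)
        (isClosed_Iic.preimage (Continuous.abs ?_))
      exact (continuousOn_realError k L c).comp_continuous Real.continuous_exp Real.exp_pos
    exact hcl hσ
  have h2 := hΦ.cos_mul_cosh σ
  rw [hΦ.im_eq_zero habs, Real.cosh_zero, mul_one] at h2
  rw [← h2, ← Real.cos_sub_nat_mul_pi, Real.arccos_cos (by linarith [hclosed.1])
    (by linarith [hclosed.2])]
  ring

theorem IsExtremal.re_point (h : IsExtremal k m a L c x) (hΦ : IsLift k a L c Φ)
    (i : Fin (k + m + 1 + 1 + 1)) : (Φ (Real.log (x i))).re = (i : ℕ) * Real.pi := by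
  induction i using Fin.induction with
  | zero => rw [h.first, hΦ.zero]; simp
  | succ i ih =>
    have hlog : Real.log (x i.castSucc) < Real.log (x i.succ) :=
      Real.log_lt_log (h.pos _) (h.strictMono Fin.castSucc_lt_succ)
    rw [h.re_between hΦ i ih ⟨hlog.le, le_rfl⟩, Real.exp_log (h.pos _), h.realError_point,
      Fin.val_succ, pow_succ, ← mul_assoc, neg_one_pow_mul_self, one_mul, Real.arccos_neg_one]
    push_cast; ring

theorem IsExtremal.re_left (h : IsExtremal k m a L c x) (hΦ : IsLift k a L c Φ) {σ : ℝ}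
    (hσ : σ ≤ Real.log a) : (Φ σ).re = 0 := by
  have h1 : (Φ σ).re = (Φ (Real.log a)).re := by
    refine eq_of_sin_eq_zero (isPreconnected_Iic (a := Real.log a))
      (u := fun σ : ℝ => (Φ σ).re) hΦ.continuous_re_real.continuousOn ?_ hσ (mem_Iic.2 le_rfl)
    intro t ht
    rcases (mem_Iic.1 ht).eq_or_lt with rfl | hlt
    · rw [hΦ.zero]; simp
    · have h2 := h.one_lt_realError_left (Real.exp_pos t) ((Real.lt_log_iff_exp_lt h.a_pos).1 hlt)
      exact (hΦ.sin_re_eq_zero (h2.trans_le (le_abs_self _))).1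
  rw [h1, hΦ.zero]; simp

theorem IsExtremal.re_right (h : IsExtremal k m a L c x) (hΦ : IsLift k a L c Φ) {σ : ℝ}
    (hσ : 0 ≤ σ) : (Φ σ).re = (k + m + 2) * Real.pi := by
  have h0 := h.re_point hΦ (Fin.last _)
  rw [h.last, Real.log_one] at h0
  have h1 : (Φ σ).re = (Φ (0 : ℝ)).re := by
    refine eq_of_sin_eq_zero (isPreconnected_Ici (a := (0 : ℝ)))
      (u := fun σ : ℝ => (Φ σ).re) hΦ.continuous_re_real.continuousOn ?_ hσ (mem_Ici.2 le_rfl)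
    intro t ht
    rcases (mem_Ici.1 ht).eq_or_lt with rfl | hlt
    · rw [h0]; exact Real.sin_nat_mul_pi _
    · exact (hΦ.sin_re_eq_zero (h.one_lt_abs_realError_right (Real.one_lt_exp_iff.2 hlt))).1
  rw [h1, h0, Fin.val_last]; push_cast; ring

theorem IsExtremal.monotone_re_real (h : IsExtremal k m a L c x) (hΦ : IsLift k a L c Φ) :
    Monotone fun σ : ℝ => (Φ σ).re := by
  have hlog : StrictMono fun i => Real.log (x i) := fun i j hij =>
    Real.log_lt_log (h.pos _) (h.strictMono hij)
  have hpiece : ∀ i : Fin (k + m + 1 + 1), MonotoneOn (fun σ : ℝ => (Φ σ).re)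
      (Icc (Real.log (x i.castSucc)) (Real.log (x i.succ))) := by
    intro i σ hσ σ' hσ' hle
    have hi := h.re_point hΦ i.castSucc
    simp only [Fin.val_castSucc] at hi
    simp only [h.re_between hΦ i hi hσ, h.re_between hΦ i hi hσ']
    have hmem : ∀ σ ∈ Icc (Real.log (x i.castSucc)) (Real.log (x i.succ)),
        Real.exp σ ∈ Icc (x i.castSucc) (x i.succ) := fun σ hσ =>
      ⟨(Real.log_le_iff_le_exp (h.pos _)).1 hσ.1, (Real.le_log_iff_exp_le (h.pos _)).1 hσ.2⟩
    have := (h.strictAntiOn_between i).antitoneOn (hmem σ hσ) (hmem σ' hσ')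
      (Real.exp_le_exp.2 hle)
    have h2 := Real.antitone_arccos this
    linarith
  have hall : ∀ i : Fin (k + m + 1 + 1 + 1), MonotoneOn (fun σ : ℝ => (Φ σ).re)
      (Iic (Real.log (x i))) := by
    intro i
    induction i using Fin.induction with
    | zero =>
      rw [h.first]
      intro σ hσ σ' hσ' _
      simp only [h.re_left hΦ hσ, h.re_left hΦ hσ', le_refl]
    | succ i ih =>
      have hlt := (hlog (Fin.castSucc_lt_succ (i := i))).le
      have := ih.union_right (hpiece i) isGreatest_Iic (isLeast_Icc hlt)
      rwa [Iic_union_Icc_eq_Iic hlt] at this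
  have hlast := hall (Fin.last _)
  rw [h.last, Real.log_one] at hlast
  have hright : MonotoneOn (fun σ : ℝ => (Φ σ).re) (Ici 0) := by
    intro σ hσ σ' hσ' _
    simp only [h.re_right hΦ hσ, h.re_right hΦ hσ', le_refl]
  have := hlast.union_right hright isGreatest_Iic isLeast_Ici
  rw [Iic_union_Ici] at this
  exact monotoneOn_univ.1 this

/-- Where `Im Φ > 0` the sine is nonzero, so `cos` has a holomorphic local inverse, and by
continuity `Φ` is that inverse applied to the error. -/
theorem IsLift.differentiableAt {N : ℕ} {c : Fin N → ℝ} (hΦ : IsLift k a L c Φ) {s : ℂ}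
    (hs : s ∈ strip) : DifferentiableAt ℂ Φ s := by
  have hsin : -Complex.sin (Φ s) ≠ 0 := by
    rw [neg_ne_zero]
    intro h0
    obtain ⟨n, hn⟩ := Complex.sin_eq_zero_iff.1 h0
    have := hΦ.im_pos s hs
    rw [hn] at this
    simp at this
  have hcosd := Complex.hasStrictDerivAt_cos (Φ s)
  have hc : ContinuousAt Φ s :=
    (hΦ.cont.mono strip_subset_closedStrip).continuousAt (isOpen_strip.mem_nhds hs)
  have h1 := (hcosd.to_localInverse hsin).hasDerivAt.differentiableAt
  have h2 := (hcosd.hasStrictFDerivAt_equiv hsin).eventually_left_inverse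
  have h3 : DifferentiableAt ℂ (fun s => hcosd.localInverse _ _ _ hsin
      (normError k L c (Complex.exp s))) s := by
    rw [hΦ.cos_eq s (strip_subset_closedStrip hs)] at h1
    exact DifferentiableAt.comp s h1 ((differentiableAt_normError k L c
      (Complex.exp_ne_zero s)).comp s Complex.differentiableAt_exp)
  refine h3.congr_of_eventuallyEq ?_
  filter_upwards [hc.eventually h2, isOpen_strip.mem_nhds hs] with t ht hts
  rw [← hΦ.cos_eq t (strip_subset_closedStrip hts)]
  exact ht.symm

end Bottom

/-! ### Behaviour at the two ends of the strip -/

section Ends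

/-- The left end of the closed strip. -/
def leftEnd : Filter ℂ := comap Complex.re atBot ⊓ 𝓟 closedStrip

/-- The right end of the closed strip. -/
def rightEnd : Filter ℂ := comap Complex.re atTop ⊓ 𝓟 closedStrip

theorem hasBasis_leftEnd :
    leftEnd.HasBasis (fun _ : ℝ => True) fun M => Complex.re ⁻¹' Iic M ∩ closedStrip :=
  (atBot_basis.comap _).inf_principal _

theorem hasBasis_rightEnd :
    rightEnd.HasBasis (fun _ : ℝ => True) fun M => Complex.re ⁻¹' Ici M ∩ closedStrip :=
  (atTop_basis.comap _).inf_principal _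

theorem tendsto_ofReal_leftEnd : Tendsto ((↑) : ℝ → ℂ) atBot leftEnd := by
  refine tendsto_inf.2 ⟨tendsto_comap_iff.2 tendsto_id, tendsto_principal.2 ?_⟩
  exact Eventually.of_forall ofReal_mem_closedStrip

theorem tendsto_ofReal_rightEnd : Tendsto ((↑) : ℝ → ℂ) atTop rightEnd := by
  refine tendsto_inf.2 ⟨tendsto_comap_iff.2 tendsto_id, tendsto_principal.2 ?_⟩
  exact Eventually.of_forall ofReal_mem_closedStrip

instance : leftEnd.NeBot := tendsto_ofReal_leftEnd.neBot

instance : rightEnd.NeBot := tendsto_ofReal_rightEnd.neBot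

theorem exists_preconnected_leftEnd {Ψ : ℂ → ℂ} (hΨ : ContinuousOn Ψ closedStrip) :
    ∀ u ∈ leftEnd, ∃ t ∈ leftEnd, t ⊆ u ∧ IsPreconnected (Ψ '' t) := by
  intro u hu
  obtain ⟨M, -, hM⟩ := hasBasis_leftEnd.mem_iff.1 hu
  refine ⟨_, hasBasis_leftEnd.mem_of_mem (i := M) trivial, hM, ?_⟩
  refine IsPreconnected.image (Convex.isPreconnected ?_) _ (hΨ.mono inter_subset_right)
  exact ((convex_Iic M).linear_preimage Complex.reLm).inter convex_closedStrip

theorem exists_preconnected_rightEnd {Ψ : ℂ → ℂ} (hΨ : ContinuousOn Ψ closedStrip) :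
    ∀ u ∈ rightEnd, ∃ t ∈ rightEnd, t ⊆ u ∧ IsPreconnected (Ψ '' t) := by
  intro u hu
  obtain ⟨M, -, hM⟩ := hasBasis_rightEnd.mem_iff.1 hu
  refine ⟨_, hasBasis_rightEnd.mem_of_mem (i := M) trivial, hM, ?_⟩
  refine IsPreconnected.image (Convex.isPreconnected ?_) _ (hΨ.mono inter_subset_right)
  exact ((convex_Ici M).linear_preimage Complex.reLm).inter convex_closedStrip

theorem norm_cos_le_exp_im {w : ℂ} (hw : 0 ≤ w.im) : ‖Complex.cos w‖ ≤ Real.exp w.im := by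
  rw [Complex.cos, norm_div]
  have h1 : ‖Complex.exp (w * Complex.I)‖ ≤ Real.exp w.im := by
    rw [Complex.norm_exp]; simp; linarith
  have h2 : ‖Complex.exp (-w * Complex.I)‖ ≤ Real.exp w.im := by
    rw [Complex.norm_exp]; simp
  have h3 := norm_add_le (Complex.exp (w * Complex.I)) (Complex.exp (-w * Complex.I))
  rw [show ‖(2 : ℂ)‖ = 2 by simp, div_le_iff₀ two_pos]
  linarith

/-- The behaviour of a lift of `cos` at an end where the lifted function behaves like
`g exp(-λ s)`. -/
theorem tendsto_lift_end {l : Filter ℂ} [l.NeBot] {Φ : ℂ → ℂ} {lam : ℝ} {g : ℂ} (hg : g ≠ 0)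
    (hl : ∀ u ∈ l, ∃ t ∈ l, t ⊆ u ∧
      IsPreconnected ((fun s => Φ s + Complex.I * (lam * s)) '' t))
    (him : ∀ᶠ s in l, 0 ≤ (Φ s).im)
    (hlim : Tendsto (fun s => Complex.cos (Φ s) * Complex.exp (lam * s)) l (𝓝 g))
    (hexp : Tendsto (fun s => Complex.exp (lam * s)) l (𝓝 0)) {ρ : ℝ}
    (hρ : ∃ᶠ s in l, (Φ s).re - lam * s.im = ρ) :
    Tendsto (fun s => (Φ s).im) l atTop ∧ Tendsto (fun s => (Φ s).re - lam * s.im) l (𝓝 ρ) := by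
  have hcos : Tendsto (fun s => ‖Complex.cos (Φ s)‖) l atTop := by
    have h1 : Tendsto (fun s => ‖Complex.cos (Φ s) * Complex.exp (lam * s)‖ *
        ‖Complex.exp (lam * s)‖⁻¹) l atTop := by
      refine hlim.norm.pos_mul_atTop (norm_pos_iff.2 hg) (tendsto_inv_nhdsGT_zero.comp ?_)
      refine tendsto_nhdsWithin_iff.2 ⟨by simpa using hexp.norm, Eventually.of_forall fun s => ?_⟩
      simp [Complex.exp_ne_zero]
    refine h1.congr fun s => ?_
    rw [norm_mul, mul_assoc, mul_inv_cancel₀ (by simp [Complex.exp_ne_zero]), mul_one]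
  have hexpim : Tendsto (fun s => Real.exp (Φ s).im) l atTop :=
    tendsto_atTop_mono' l (him.mono fun s hs => norm_cos_le_exp_im hs) hcos
  have himt : Tendsto (fun s => (Φ s).im) l atTop := Real.tendsto_exp_comp_atTop.1 hexpim
  refine ⟨himt, ?_⟩
  have h2 : Tendsto (fun s => Complex.exp (Complex.I * Φ s)) l (𝓝 0) := by
    rw [tendsto_zero_iff_norm_tendsto_zero]
    refine (Real.tendsto_exp_comp_nhds_zero.2 (tendsto_neg_atTop_atBot.comp himt)).congr fun s => ?_
    rw [Complex.norm_exp]; simp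
  have h3 : Tendsto (fun s => Complex.exp (Complex.I * Φ s) ^ 2 + 1) l (𝓝 1) := by
    simpa using (h2.pow 2).add_const 1
  -- From `exp(iΦ)² + 1 = 2 cos Φ exp(iΦ)`, the quantity `exp(iΦ - λs)` equals `(1 + exp(iΦ)²) / (2
  -- cos Φ exp(λs))`, and `exp(iΦ)` tends to `0`. The limit of its logarithm has a real part that
  -- the hypothesis on `ρ` identifies.
  have h4 : Tendsto (fun s => Complex.exp (Complex.I * (Φ s + Complex.I * (lam * s)))) l
      (𝓝 (1 / (2 * g))) := by
    refine (h3.div (hlim.const_mul 2) (mul_ne_zero two_ne_zero hg)).congr' ?_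
    have hcne : ∀ᶠ s in l, Complex.cos (Φ s) ≠ 0 := by
      filter_upwards [hcos.eventually_gt_atTop 0] with s hs using norm_pos_iff.1 hs
    filter_upwards [hcne] with s hs
    have e1 : Complex.exp (Complex.I * Φ s) ^ 2 + 1 =
        2 * Complex.cos (Φ s) * Complex.exp (Complex.I * Φ s) := by
      rw [Complex.two_cos, add_mul, ← Complex.exp_add, ← Complex.exp_add, ← Complex.exp_nat_mul,
        ← Complex.exp_zero]
      congr 2
      · push_cast; ring
      · ring
    have e2 : Complex.exp (Complex.I * (Φ s + Complex.I * (lam * s))) =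
        Complex.exp (Complex.I * Φ s) / Complex.exp (lam * s) := by
      rw [← Complex.exp_sub]
      congr 1
      linear_combination (lam * s : ℂ) * Complex.I_mul_I
    simp only [Pi.div_apply]
    rw [e1, e2, div_eq_div_iff (mul_ne_zero two_ne_zero (mul_ne_zero hs (Complex.exp_ne_zero _)))
      (Complex.exp_ne_zero _)]
    ring
  obtain ⟨κ, hκ⟩ := exists_tendsto_of_tendsto_exp (one_div_ne_zero (mul_ne_zero two_ne_zero hg)) hl h4
  have h5 : Tendsto (fun s => (Φ s).re - lam * s.im) l (𝓝 κ.re) := by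
    refine ((Complex.continuous_re.tendsto _).comp hκ).congr fun s => ?_
    simp
    ring
  have h6 : κ.re = ρ := by
    by_contra hne
    have := (h5.eventually_ne hne).and_frequently hρ
    exact this.exists.elim fun s hs => hs.1 hs.2
  rwa [h6] at h5

variable {k m : ℕ} {a L : ℝ} {c : Fin (k + m + 1 + 1) → ℝ} {x : Fin (k + m + 1 + 1 + 1) → ℝ}
  {Φ : ℂ → ℂ}

theorem tendsto_oddLaurentC_mul_pow {N : ℕ} (c : Fin (N + 1) → ℝ) {l : Filter ℂ} {p : ℂ → ℂ}
    (hp : Tendsto p l (𝓝 0)) (hp0 : ∀ s, p s ≠ 0) :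
    Tendsto (fun s => oddLaurentC k c (p s) * p s ^ (2 * k + 1)) l (𝓝 (c 0)) := by
  have h1 : Continuous fun z : ℂ => ∑ j : Fin (N + 1), (c j : ℂ) * (z ^ 2) ^ (j : ℕ) := by fun_prop
  have h2 := (h1.tendsto 0).comp hp
  rw [Fin.sum_univ_succ] at h2
  simp at h2
  refine h2.congr fun s => ?_
  rw [oddLaurentC_eq_div, div_mul_cancel₀ _ (pow_ne_zero _ (hp0 s))]
  rfl

theorem tendsto_exp_leftEnd : Tendsto Complex.exp leftEnd (𝓝 0) := by
  rw [tendsto_zero_iff_norm_tendsto_zero]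
  have : Tendsto Complex.re leftEnd atBot := tendsto_comap.mono_left inf_le_left
  exact (Real.tendsto_exp_comp_nhds_zero.2 this).congr fun s => (Complex.norm_exp s).symm

theorem tendsto_exp_neg_rightEnd : Tendsto (fun s => Complex.exp (-s)) rightEnd (𝓝 0) := by
  rw [tendsto_zero_iff_norm_tendsto_zero]
  have : Tendsto Complex.re rightEnd atTop := tendsto_comap.mono_left inf_le_left
  exact (Real.tendsto_exp_comp_nhds_zero.2 (tendsto_neg_atTop_atBot.comp this)).congr fun s => by
    rw [Complex.norm_exp]; simp

theorem tendsto_normError_mul {l : Filter ℂ} {G E : ℂ → ℂ} {c₀ : ℂ} {ε L : ℂ}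
    (hG : Tendsto (fun s => G s * E s) l (𝓝 c₀)) (hE : Tendsto E l (𝓝 0)) :
    Tendsto (fun s => ε * (1 - G s) / L * E s) l (𝓝 (-(ε * c₀ / L))) := by
  have := ((hE.sub hG).const_mul (ε / L))
  rw [zero_sub] at this
  refine (this.congr fun s => ?_).congr' EventuallyEq.rfl |>.trans (le_of_eq ?_)
  · ring
  · congr 1; ring

theorem IsExtremal.coeff_zero_ne (h : IsExtremal k m a L c x) : c 0 ≠ 0 := by
  intro h0; have := h.twist_zero; simp [twist, h0] at this

theorem IsExtremal.coeff_last_ne (h : IsExtremal k m a L c x) : c (Fin.last _) ≠ 0 := by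
  intro h0; have := h.twist_last; simp [twist, h0] at this

/-- Near `0` the term with exponent `-(2k+1)` dominates, which gives the rate. On the real edge left
of `log a` the real part of `Φ` is `0`, which fixes the limit. -/
theorem IsExtremal.tendsto_leftEnd (h : IsExtremal k m a L c x) (hΦ : IsLift k a L c Φ) :
    Tendsto (fun s => (Φ s).im) leftEnd atTop ∧
      Tendsto (fun s => (Φ s).re - (2 * k + 1) * s.im) leftEnd (𝓝 0) := by
  have hL : (L : ℂ) ≠ 0 := by exact_mod_cast h.L_pos.ne'
  have hmem : ∀ᶠ s in leftEnd, s ∈ closedStrip := mem_inf_of_right (mem_principal_self _)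
  have he : ∀ s : ℂ, Complex.exp (((2 * k + 1 : ℝ) : ℂ) * s) = Complex.exp s ^ (2 * k + 1) := by
    intro s; rw [← Complex.exp_nat_mul]; push_cast; rfl
  have hexp : Tendsto (fun s => Complex.exp (((2 * k + 1 : ℝ) : ℂ) * s)) leftEnd (𝓝 0) := by
    simp only [he]
    simpa using tendsto_exp_leftEnd.pow (2 * k + 1)
  refine tendsto_lift_end (g := -((-1) ^ (k + 1) * c 0 / L)) (lam := 2 * k + 1) ?_ ?_ ?_ ?_ hexp ?_
  · have : (c 0 : ℂ) ≠ 0 := by exact_mod_cast h.coeff_zero_ne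
    exact neg_ne_zero.2 (div_ne_zero (mul_ne_zero (by simp) this) hL)
  · exact exists_preconnected_leftEnd (hΦ.cont.add (by fun_prop))
  · exact hmem.mono fun s hs => hΦ.im_nonneg hs
  · have h1 := tendsto_oddLaurentC_mul_pow (k := k) c tendsto_exp_leftEnd Complex.exp_ne_zero
    simp only [← he] at h1
    refine (tendsto_normError_mul (ε := (-1) ^ (k + 1)) (L := L) h1 hexp).congr' ?_
    filter_upwards [hmem] with s hs
    rw [hΦ.cos_eq s hs, normError]
  · refine tendsto_ofReal_leftEnd.frequently (Eventually.frequently ?_)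
    filter_upwards [eventually_le_atBot (Real.log a)] with σ hσ
    rw [h.re_left hΦ hσ]; simp

/-- The inversion `z ↦ 1/z` turns the leading term of exponent `2m+1` into a lowest one. The real
edge right of `0` fixes the limit. -/
theorem IsExtremal.tendsto_rightEnd (h : IsExtremal k m a L c x) (hΦ : IsLift k a L c Φ) :
    Tendsto (fun s => (Φ s).im) rightEnd atTop ∧
      Tendsto (fun s => (Φ s).re + (2 * m + 1) * s.im) rightEnd (𝓝 ((k + m + 2) * Real.pi)) := by
  have hL : (L : ℂ) ≠ 0 := by exact_mod_cast h.L_pos.ne'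
  have hmem : ∀ᶠ s in rightEnd, s ∈ closedStrip := mem_inf_of_right (mem_principal_self _)
  have he : ∀ s : ℂ, Complex.exp (((-(2 * m + 1) : ℝ) : ℂ) * s) =
      Complex.exp (-s) ^ (2 * m + 1) := by
    intro s; rw [← Complex.exp_nat_mul]; push_cast; ring_nf
  have hexp : Tendsto (fun s => Complex.exp (((-(2 * m + 1) : ℝ) : ℂ) * s)) rightEnd (𝓝 0) := by
    simp only [he]
    simpa using tendsto_exp_neg_rightEnd.pow (2 * m + 1)
  have key := tendsto_lift_end (Φ := Φ) (l := rightEnd)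
    (g := -((-1) ^ (k + 1) * c (Fin.last _) / L)) (lam := -(2 * m + 1))
    (ρ := (k + m + 2) * Real.pi) ?_ ?_ ?_ ?_ hexp ?_
  · refine ⟨key.1, key.2.congr fun s => by ring⟩
  · have : (c (Fin.last _) : ℂ) ≠ 0 := by exact_mod_cast h.coeff_last_ne
    exact neg_ne_zero.2 (div_ne_zero (mul_ne_zero (by simp) this) hL)
  · exact exists_preconnected_rightEnd (hΦ.cont.add (by fun_prop))
  · exact hmem.mono fun s hs => hΦ.im_nonneg hs
  · have h1 := tendsto_oddLaurentC_mul_pow (k := m) (fun j => c j.rev) tendsto_exp_neg_rightEnd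
      fun s => Complex.exp_ne_zero _
    simp only [← he, Fin.rev_zero] at h1
    refine (tendsto_normError_mul (ε := (-1) ^ (k + 1)) (L := L) h1 hexp).congr' ?_
    filter_upwards [hmem] with s hs
    rw [hΦ.cos_eq s hs, normError, ← oddLaurentC_inv c (Complex.exp_ne_zero _), Complex.exp_neg,
      inv_inv]
  · refine tendsto_ofReal_rightEnd.frequently (Eventually.frequently ?_)
    filter_upwards [eventually_ge_atTop 0] with σ hσ
    rw [h.re_right hΦ hσ]; simp

/-- The real part of the lift is bounded. -/
theorem IsExtremal.exists_re_bound (h : IsExtremal k m a L c x) (hΦ : IsLift k a L c Φ) :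
    ∃ C, ∀ s ∈ closedStrip, |(Φ s).re| ≤ C := by
  have hpi := Real.pi_pos
  obtain ⟨M₁, -, hM₁⟩ := hasBasis_leftEnd.mem_iff.1
    ((h.tendsto_leftEnd hΦ).2.abs.eventually_lt_const (show |(0 : ℝ)| < 1 by simp))
  obtain ⟨M₂, -, hM₂⟩ := hasBasis_rightEnd.mem_iff.1
    ((h.tendsto_rightEnd hΦ).2.abs.eventually_lt_const (lt_add_one _))
  have hK : IsCompact (Icc M₁ M₂ ×ℂ Icc 0 (Real.pi / 2)) := isCompact_Icc.reProdIm isCompact_Icc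
  have hsub : Icc M₁ M₂ ×ℂ Icc 0 (Real.pi / 2) ⊆ closedStrip := fun s hs => hs.2
  obtain ⟨C₀, hC₀⟩ := hK.exists_bound_of_continuousOn (f := fun s => (Φ s).re)
    (Complex.continuous_re.comp_continuousOn (hΦ.cont.mono hsub))
  refine ⟨max C₀ (max (1 + (2 * k + 1) * (Real.pi / 2))
    (|(k + m + 2) * Real.pi| + 1 + (2 * m + 1) * (Real.pi / 2))), fun s hs => ?_⟩
  have him : s.im ∈ Icc 0 (Real.pi / 2) := hs
  by_cases h1 : s.re ≤ M₁
  · have h2 : |(Φ s).re - (2 * k + 1) * s.im| < 1 := hM₁ ⟨h1, hs⟩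
    refine le_max_of_le_right (le_max_of_le_left ?_)
    have h3 : (2 * k + 1) * s.im ≤ (2 * k + 1) * (Real.pi / 2) :=
      mul_le_mul_of_nonneg_left him.2 (by positivity)
    have h4 : 0 ≤ (2 * k + 1) * s.im := mul_nonneg (by positivity) him.1
    rw [abs_lt] at h2
    rw [abs_le]
    constructor <;> linarith
  by_cases h2 : M₂ ≤ s.re
  · have h2 : |(Φ s).re + (2 * m + 1) * s.im| < |(k + m + 2) * Real.pi| + 1 := hM₂ ⟨h2, hs⟩
    refine le_max_of_le_right (le_max_of_le_right ?_)
    have h3 : (2 * m + 1) * s.im ≤ (2 * m + 1) * (Real.pi / 2) :=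
      mul_le_mul_of_nonneg_left him.2 (by positivity)
    have h4 : 0 ≤ (2 * m + 1) * s.im := mul_nonneg (by positivity) him.1
    rw [abs_lt] at h2
    rw [abs_le]
    constructor <;> linarith
  · exact le_max_of_le_left (hC₀ s ⟨⟨(not_le.1 h1).le, (not_le.1 h2).le⟩, him⟩)

end Ends

/-! ### Boundary values on the imaginary axis; monotonicity and univalence -/

section Top

/-- On `cos θ cosh v = C` with `θ ≥ 0`, a larger angle has a smaller cosine, hence a larger `v`, so
both factors grow. -/
theorem sin_mul_sinh_lt {θ θ' v v' C : ℝ} (h0 : 0 ≤ θ') (hlt : θ' < θ) (hθ : θ < Real.pi / 2)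
    (hv : 0 ≤ v) (hv' : 0 ≤ v') (h : Real.cos θ * Real.cosh v = C)
    (h' : Real.cos θ' * Real.cosh v' = C) :
    Real.sin θ' * Real.sinh v' < Real.sin θ * Real.sinh v := by
  have hpi := Real.pi_pos
  have hcos : Real.cos θ < Real.cos θ' :=
    Real.cos_lt_cos_of_nonneg_of_le_pi_div_two h0 hθ.le hlt
  have hcos0 : 0 < Real.cos θ := Real.cos_pos_of_mem_Ioo ⟨by linarith, hθ⟩
  have hcosh : Real.cosh v' < Real.cosh v := by
    by_contra hcon
    push Not at hcon
    have h1 := mul_lt_mul hcos hcon (Real.cosh_pos v) (hcos0.trans hcos).le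
    rw [h, h'] at h1
    exact lt_irrefl _ h1
  rw [Real.cosh_lt_cosh, abs_of_nonneg hv, abs_of_nonneg hv'] at hcosh
  have hsin : Real.sin θ' < Real.sin θ :=
    Real.sin_lt_sin_of_lt_of_le_pi_div_two (by linarith) hθ.le hlt
  have hsin0 : 0 ≤ Real.sin θ' := Real.sin_nonneg_of_nonneg_of_le_pi h0 (by linarith)
  have hs1 := Real.sinh_lt_sinh.2 hcosh
  have hs2 : 0 ≤ Real.sinh v' := Real.sinh_nonneg_iff.2 hv'
  nlinarith

/-- On the curve `cos θ cosh v = C` the angle is an increasing function of `sin θ sinh v`. -/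
theorem le_of_sin_mul_sinh_le {θ θ' v v' C : ℝ} (hθ : θ ∈ Ioo (-(Real.pi / 2)) (Real.pi / 2))
    (hθ' : θ' ∈ Ioo (-(Real.pi / 2)) (Real.pi / 2)) (hv : 0 ≤ v) (hv' : 0 ≤ v') (hC : 1 < C)
    (h : Real.cos θ * Real.cosh v = C) (h' : Real.cos θ' * Real.cosh v' = C)
    (hle : Real.sin θ * Real.sinh v ≤ Real.sin θ' * Real.sinh v') : θ ≤ θ' := by
  by_contra hcon
  push Not at hcon
  have hpi := Real.pi_pos
  rcases le_or_gt 0 θ' with h0 | h0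
  · exact absurd hle (not_le.2 (sin_mul_sinh_lt h0 hcon hθ.2 hv hv' h h'))
  rcases le_or_gt θ 0 with h1 | h1
  · have := sin_mul_sinh_lt (C := C) (θ := -θ') (θ' := -θ) (by linarith) (by linarith)
      (by linarith [hθ'.1]) hv' hv (by rwa [Real.cos_neg]) (by rwa [Real.cos_neg])
    rw [Real.sin_neg, Real.sin_neg] at this
    linarith
  · have h2 : Real.sin θ' < 0 := Real.sin_neg_of_neg_of_neg_pi_lt h0 (by linarith [hθ'.1])
    have h3 : 0 < Real.sin θ := Real.sin_pos_of_pos_of_lt_pi h1 (by linarith [hθ.2])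
    have h4 : 0 < v := by
      refine lt_of_le_of_ne hv fun h5 => ?_
      rw [← h5, Real.cosh_zero, mul_one] at h
      linarith [Real.cos_le_one θ]
    have h5 : 0 < Real.sinh v := Real.sinh_pos_iff.2 h4
    have h6 : 0 ≤ Real.sinh v' := Real.sinh_nonneg_iff.2 hv'
    nlinarith

variable {k m : ℕ} {a L : ℝ} {c : Fin (k + m + 1 + 1) → ℝ} {x : Fin (k + m + 1 + 1 + 1) → ℝ}
  {Φ : ℂ → ℂ}

/-- The parametrization of the upper edge of the strip. -/
def topEdge (σ : ℝ) : ℂ := σ + (Real.pi / 2 : ℝ) * Complex.I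

@[simp] theorem topEdge_re (σ : ℝ) : (topEdge σ).re = σ := by simp [topEdge]

@[simp] theorem topEdge_im (σ : ℝ) : (topEdge σ).im = Real.pi / 2 := by simp [topEdge]

theorem topEdge_mem (σ : ℝ) : topEdge σ ∈ closedStrip := by
  simp only [closedStrip, mem_preimage, topEdge_im, mem_Icc, le_refl, and_true]; positivity

theorem continuous_topEdge : Continuous topEdge := by unfold topEdge; fun_prop

theorem exp_topEdge (σ : ℝ) : Complex.exp (topEdge σ) = Complex.I * (Real.exp σ : ℝ) := by
  rw [topEdge, Complex.exp_add]; push_cast; rw [Complex.exp_pi_div_two_mul_I]; ring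

theorem tendsto_topEdge_leftEnd : Tendsto topEdge atBot leftEnd := by
  refine tendsto_inf.2 ⟨tendsto_comap_iff.2 ?_, tendsto_principal.2 ?_⟩
  · exact tendsto_id.congr fun σ => (topEdge_re σ).symm
  · exact Eventually.of_forall topEdge_mem

/-- As `f` is imaginary here, the real part of the normalized error is `±1/L`. Shifting by `(k+1)π`
absorbs the sign and exposes the equation of the removed curve. -/
theorem IsExtremal.cos_topEdge (h : IsExtremal k m a L c x) (hΦ : IsLift k a L c Φ) (σ : ℝ) :
    Real.cos ((Φ (topEdge σ)).re - (k + 1) * Real.pi) * Real.cosh (Φ (topEdge σ)).im = 1 / L ∧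
    Real.sin ((Φ (topEdge σ)).re - (k + 1) * Real.pi) * Real.sinh (Φ (topEdge σ)).im =
      oddLaurent k (twist k c) (Real.exp σ) / L := by
  have hL := h.L_pos.ne'
  have h1 := hΦ.cos_eq _ (topEdge_mem σ)
  rw [exp_topEdge, normError, oddLaurentC_I_mul] at h1
  set H := oddLaurent k (twist k c) (Real.exp σ)
  have h2 : (-1) ^ (k + 1) * (1 - Complex.I * (H : ℂ)) / L =
      (((-1) ^ (k + 1) / L : ℝ) : ℂ) + ((-((-1) ^ (k + 1) * H / L) : ℝ) : ℂ) * Complex.I := by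
    push_cast; ring
  rw [h2] at h1
  have hre := cos_re_eq (Φ (topEdge σ))
  have him := cos_im_eq (Φ (topEdge σ))
  rw [h1] at hre him
  simp only [Complex.add_re, Complex.ofReal_re, Complex.re_ofReal_mul, Complex.I_re, mul_zero,
    add_zero, Complex.add_im, Complex.ofReal_im, Complex.im_ofReal_mul, Complex.I_im, mul_one,
    zero_add] at hre him
  have hc := Real.cos_sub_nat_mul_pi (Φ (topEdge σ)).re (k + 1)
  have hs := Real.sin_sub_nat_mul_pi (Φ (topEdge σ)).re (k + 1)
  push_cast at hc hs
  rw [hc, hs]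
  have hsq := neg_one_pow_mul_self ℝ (k + 1)
  constructor
  · rw [mul_assoc, ← hre]
    linear_combination hsq / L
  · rw [mul_assoc, show Real.sin (Φ (topEdge σ)).re * Real.sinh (Φ (topEdge σ)).im =
      (-1) ^ (k + 1) * H / L by linarith]
    linear_combination hsq * H / L

theorem IsLift.continuous_topEdge {N : ℕ} {c : Fin N → ℝ} (hΦ : IsLift k a L c Φ) :
    Continuous fun σ : ℝ => Φ (topEdge σ) :=
  hΦ.cont.comp_continuous SgnApprox.continuous_topEdge topEdge_mem

/-- The cosine of the angle is positive along the edge, so the angle cannot cross an odd multiple of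
`π/2`. Its limit at the left end is `(2k+1)π/2 - (k+1)π = -π/2`; positivity of the cosine shows that
this is approached from above. -/
theorem IsExtremal.topEdge_angle (h : IsExtremal k m a L c x) (hΦ : IsLift k a L c Φ) (σ : ℝ) :
    (Φ (topEdge σ)).re - (k + 1) * Real.pi ∈ Ioo (-(Real.pi / 2)) (Real.pi / 2) := by
  have hpi := Real.pi_pos
  set θ : ℝ → ℝ := fun σ => (Φ (topEdge σ)).re - (k + 1) * Real.pi with hθ
  have hcont : Continuous θ :=
    (Complex.continuous_re.comp hΦ.continuous_topEdge).sub continuous_const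
  have hcos : ∀ σ, 0 < Real.cos (θ σ) := by
    intro σ
    have h1 := (h.cos_topEdge hΦ σ).1
    have h2 : 0 < Real.cos (θ σ) * Real.cosh (Φ (topEdge σ)).im := by
      rw [hθ, h1]; exact one_div_pos.2 h.L_pos
    exact (mul_pos_iff_of_pos_right (Real.cosh_pos _)).1 h2
  have hlim : Tendsto θ atBot (𝓝 (-(Real.pi / 2))) := by
    have h1 := (h.tendsto_leftEnd hΦ).2.comp tendsto_topEdge_leftEnd
    have h2 := h1.add_const ((2 * k + 1) * (Real.pi / 2) - (k + 1) * Real.pi)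
    refine (h2.congr fun σ => ?_).trans (le_of_eq ?_)
    · simp only [Function.comp_apply, topEdge_im, hθ]; ring
    · congr 1; ring
  obtain ⟨M, hM⟩ := eventually_atBot.1 (hlim.eventually
    (Ioo_mem_nhds (show -Real.pi < -(Real.pi / 2) by linarith)
      (show -(Real.pi / 2) < 0 by linarith)))
  have hsub : ∀ t, θ t ≠ Real.pi / 2 ∧ θ t ≠ -(Real.pi / 2) := by
    intro t
    have := hcos t
    constructor <;> intro h0 <;> rw [h0] at this <;> simp at this
  have hord : (range θ).OrdConnected := (isPreconnected_range hcont).ordConnected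
  have hM0 := hM M le_rfl
  have hM1 : -(Real.pi / 2) < θ M := by
    by_contra hcon
    push Not at hcon
    have h1 := hcos M
    rw [← Real.cos_neg] at h1
    exact absurd h1 (not_lt.2 (Real.cos_nonpos_of_pi_div_two_le_of_le (by linarith)
      (by linarith [hM0.1])))
  constructor
  · by_contra hcon
    push Not at hcon
    obtain ⟨t, ht⟩ := hord.out (mem_range_self σ) (mem_range_self M) ⟨hcon, hM1.le⟩
    exact (hsub t).2 ht
  · by_contra hcon
    push Not at hcon
    obtain ⟨t, ht⟩ := hord.out (mem_range_self M) (mem_range_self σ) ⟨by linarith [hM0.2], hcon⟩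
    exact (hsub t).1 ht

/-- On the curve the angle increases with `sin θ sinh v`, which is a positive multiple of the
increasing function `-i f(iy)`. -/
theorem IsExtremal.monotone_re_topEdge (h : IsExtremal k m a L c x) (hΦ : IsLift k a L c Φ) :
    Monotone fun σ : ℝ => (Φ (topEdge σ)).re := by
  intro σ σ' hle
  have hmono : MonotoneOn (oddLaurent k (twist k c)) (Ioi 0) := by
    refine monotoneOn_of_deriv_nonneg (convex_Ioi 0) (continuousOn_oddLaurent (twist k c)) ?_ ?_
    · rw [interior_Ioi]
      exact fun y hy => (hasDerivAt_oddLaurent (k := k) (twist k c)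
        (ne_of_gt hy)).differentiableAt.differentiableWithinAt
    · rw [interior_Ioi]
      intro y hy
      rw [(hasDerivAt_oddLaurent (k := k) (twist k c) (ne_of_gt hy)).deriv, eulerCoeff_twist]
      exact (div_pos (h.twist_deriv y hy) hy).le
  have h1 := le_of_sin_mul_sinh_le (h.topEdge_angle hΦ σ) (h.topEdge_angle hΦ σ')
    (hΦ.im_nonneg (topEdge_mem σ)) (hΦ.im_nonneg (topEdge_mem σ'))
    ((one_lt_div h.L_pos).2 h.L_lt_one) (h.cos_topEdge hΦ σ).1 (h.cos_topEdge hΦ σ').1 (by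
      rw [(h.cos_topEdge hΦ σ).2, (h.cos_topEdge hΦ σ').2]
      exact div_le_div_of_nonneg_right (hmono (Real.exp_pos σ) (Real.exp_pos σ')
        (Real.exp_le_exp.2 hle)) h.L_pos.le)
  simp only
  linarith

theorem add_ofReal_mem_closedStrip {s : ℂ} (δ : ℝ) : s + δ ∈ closedStrip ↔ s ∈ closedStrip := by
  simp [closedStrip]

theorem add_ofReal_mem_strip {s : ℂ} (δ : ℝ) : s + δ ∈ strip ↔ s ∈ strip := by
  simp [strip]

/-- Phragmén–Lindelöf for `exp (Φ(s) - Φ(s + δ))`: it is bounded because `Re Φ` is, and monotonicity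
on the edges bounds it there by `1`. -/
theorem IsExtremal.re_le_re_add (h : IsExtremal k m a L c x) (hΦ : IsLift k a L c Φ) {δ : ℝ}
    (hδ : 0 ≤ δ) {s : ℂ} (hs : s ∈ closedStrip) : (Φ s).re ≤ (Φ (s + δ)).re := by
  obtain ⟨C, hC⟩ := h.exists_re_bound hΦ
  have hcont : ContinuousOn (fun s : ℂ => Φ (s + δ)) closedStrip :=
    hΦ.cont.comp (by fun_prop) fun s hs => (add_ofReal_mem_closedStrip δ).2 hs
  have hcl : closure (Complex.im ⁻¹' Ioo 0 (Real.pi / 2)) = closedStrip := closure_strip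
  have hd : DiffContOnCl ℂ (fun s => Complex.exp (Φ s - Φ (s + δ)))
      (Complex.im ⁻¹' Ioo 0 (Real.pi / 2)) := by
    refine ⟨fun s hs => ?_, ?_⟩
    · refine (((hΦ.differentiableAt hs).sub ?_).cexp).differentiableWithinAt
      exact (hΦ.differentiableAt ((add_ofReal_mem_strip δ).2 hs)).comp s
        (differentiableAt_id.add_const _)
    · rw [hcl]; exact (hΦ.cont.sub hcont).cexp
  have hbd : ∀ s ∈ closedStrip, ‖Complex.exp (Φ s - Φ (s + δ))‖ ≤ Real.exp (2 * C) := by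
    intro s hs
    rw [Complex.norm_exp, Real.exp_le_exp, Complex.sub_re]
    have h1 := abs_le.1 (hC s hs)
    have h2 := abs_le.1 (hC _ ((add_ofReal_mem_closedStrip δ).2 hs))
    linarith
  have key := PhragmenLindelof.horizontal_strip (C := 1) (z := s) hd ?_ ?_ ?_ hs.1 hs.2
  · rw [Complex.norm_exp, Real.exp_le_one_iff, Complex.sub_re] at key
    linarith
  · refine ⟨0, by rw [sub_zero]; positivity, 0, ?_⟩
    refine Asymptotics.IsBigO.of_bound (Real.exp (2 * C)) ?_
    filter_upwards [mem_inf_of_right (mem_principal_self _)] with t ht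
    simpa using hbd t (strip_subset_closedStrip ht)
  · intro z hz
    rw [Complex.norm_exp, Real.exp_le_one_iff, Complex.sub_re]
    have hz' : z = (z.re : ℂ) := Complex.ext rfl (by simpa using hz)
    have := h.monotone_re_real hΦ (show z.re ≤ z.re + δ by linarith)
    simp only [Complex.ofReal_add, ← hz'] at this
    linarith
  · intro z hz
    rw [Complex.norm_exp, Real.exp_le_one_iff, Complex.sub_re]
    have hz' : z = topEdge z.re := Complex.ext (by simp) (by simpa using hz)
    have hz'' : z + δ = topEdge (z.re + δ) := Complex.ext (by simp) (by simpa using hz)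
    have := h.monotone_re_topEdge hΦ (show z.re ≤ z.re + δ by linarith)
    simp only [← hz', ← hz''] at this
    linarith

/-- Along horizontal lines `Re Φ` increases, and its limit at the left end is known. The upper bound
comes in the same way from the right end. -/
theorem IsExtremal.re_ge (h : IsExtremal k m a L c x) (hΦ : IsLift k a L c Φ) {s : ℂ}
    (hs : s ∈ closedStrip) : (2 * k + 1) * s.im ≤ (Φ s).re := by
  have hp : Tendsto (fun δ : ℝ => s + ((-δ : ℝ) : ℂ)) atTop leftEnd := by
    refine tendsto_inf.2 ⟨tendsto_comap_iff.2 ?_, tendsto_principal.2 ?_⟩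
    · have : Tendsto (fun δ : ℝ => s.re + -δ) atTop atBot :=
        tendsto_atBot_add_const_left _ _ tendsto_neg_atTop_atBot
      exact this.congr fun δ => by simp
    · exact Eventually.of_forall fun δ => (add_ofReal_mem_closedStrip _).2 hs
  have h1 := (h.tendsto_leftEnd hΦ).2.comp hp
  have : 0 ≤ (Φ s).re - (2 * k + 1) * s.im := by
    refine le_of_tendsto h1 ?_
    filter_upwards [eventually_ge_atTop 0] with δ hδ
    have h2 := h.re_le_re_add hΦ hδ ((add_ofReal_mem_closedStrip (-δ)).2 hs)
    have h3 : s + ((-δ : ℝ) : ℂ) + δ = s := by push_cast; ring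
    rw [h3] at h2
    simpa using h2
  linarith

theorem IsExtremal.re_le (h : IsExtremal k m a L c x) (hΦ : IsLift k a L c Φ) {s : ℂ}
    (hs : s ∈ closedStrip) : (Φ s).re ≤ (k + m + 2) * Real.pi - (2 * m + 1) * s.im := by
  have hp : Tendsto (fun δ : ℝ => s + (δ : ℂ)) atTop rightEnd := by
    refine tendsto_inf.2 ⟨tendsto_comap_iff.2 ?_, tendsto_principal.2 ?_⟩
    · have : Tendsto (fun δ : ℝ => s.re + δ) atTop atTop :=
        tendsto_atTop_add_const_left _ _ tendsto_id
      exact this.congr fun δ => by simp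
    · exact Eventually.of_forall fun δ => (add_ofReal_mem_closedStrip _).2 hs
  have h1 := (h.tendsto_rightEnd hΦ).2.comp hp
  have : (Φ s).re + (2 * m + 1) * s.im ≤ (k + m + 2) * Real.pi := by
    refine ge_of_tendsto h1 ?_
    filter_upwards [eventually_ge_atTop 0] with δ hδ
    have h2 := h.re_le_re_add hΦ hδ hs
    simpa using h2
  linarith

theorem IsLift.differentiableOn {N : ℕ} {c : Fin N → ℝ} (hΦ : IsLift k a L c Φ) :
    DifferentiableOn ℂ Φ strip := fun _ hs => (hΦ.differentiableAt hs).differentiableWithinAt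

theorem IsExtremal.deriv_re_nonneg (h : IsExtremal k m a L c x) (hΦ : IsLift k a L c Φ) {s : ℂ}
    (hs : s ∈ strip) : 0 ≤ (deriv Φ s).re := by
  have hp : HasDerivAt (fun t : ℝ => s + (t : ℂ)) 1 0 :=
    (Complex.ofRealCLM.hasDerivAt (x := 0)).const_add s
  have hd : HasDerivAt Φ (deriv Φ s) (s + ((0 : ℝ) : ℂ)) := by
    rw [Complex.ofReal_zero, add_zero]; exact (hΦ.differentiableAt hs).hasDerivAt
  have h1 := Complex.reCLM.hasFDerivAt.comp_hasDerivAt (0 : ℝ) (hd.comp (0 : ℝ) hp)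
  simp only [mul_one, Complex.reCLM_apply] at h1
  have hslope := h1.tendsto_slope_zero_right
  refine ge_of_tendsto hslope ?_
  filter_upwards [self_mem_nhdsWithin] with t ht
  have h2 := h.re_le_re_add hΦ (le_of_lt ht) (strip_subset_closedStrip hs)
  simp only [Function.comp_apply, Complex.reCLM_apply, zero_add, Complex.ofReal_zero, add_zero,
    smul_eq_mul]
  exact mul_nonneg (inv_nonneg.2 (le_of_lt ht)) (by linarith)

/-- If the real part of `Φ'` vanished somewhere, openness of `Φ'` would produce negative real parts.
A constant `Φ'` with zero real part would make `Re Φ` constant on the real edge, where it takes both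
`0` and `(k+m+2)π`. -/
theorem IsExtremal.deriv_re_pos (h : IsExtremal k m a L c x) (hΦ : IsLift k a L c Φ) {s : ℂ}
    (hs : s ∈ strip) : 0 < (deriv Φ s).re := by
  refine lt_of_le_of_ne (h.deriv_re_nonneg hΦ hs) fun h0 => ?_
  have han : AnalyticOnNhd ℂ (deriv Φ) strip :=
    (hΦ.differentiableOn.deriv isOpen_strip).analyticOnNhd isOpen_strip
  rcases han.is_constant_or_isOpen convex_strip.isPreconnected with ⟨w, hw⟩ | hopen
  · have hw0 : w.re = 0 := by rw [← hw s hs, ← h0]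
    have hconst : ∀ t ∈ strip, ∀ δ : ℝ, (Φ (t + δ)).re = (Φ t).re := by
      intro t ht δ
      have hder : ∀ u : ℝ, HasDerivAt (fun u : ℝ => (Φ (t + u)).re) 0 u := by
        intro u
        have hp : HasDerivAt (fun u : ℝ => t + (u : ℂ)) 1 u :=
          (Complex.ofRealCLM.hasDerivAt (x := u)).const_add t
        have hmem := (add_ofReal_mem_strip u).2 ht
        have hd := (hΦ.differentiableAt hmem).hasDerivAt
        rw [hw _ hmem] at hd
        have h1 := Complex.reCLM.hasFDerivAt.comp_hasDerivAt u (hd.comp u hp)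
        simp only [mul_one, Complex.reCLM_apply, hw0] at h1
        exact h1
      have := is_const_of_deriv_eq_zero (fun u => (hder u).differentiableAt)
        (fun u => (hder u).deriv) δ 0
      simpa using this
    have hcl : ∀ t ∈ closedStrip, ∀ δ : ℝ, (Φ (t + δ)).re = (Φ t).re := by
      intro t ht δ
      have hcont : ContinuousOn (fun s : ℂ => (Φ (s + δ)).re) closedStrip :=
        Complex.continuous_re.comp_continuousOn
          (hΦ.cont.comp (by fun_prop) fun s hs => (add_ofReal_mem_closedStrip δ).2 hs)
      have hcont' : ContinuousOn (fun s : ℂ => (Φ s).re) closedStrip :=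
        Complex.continuous_re.comp_continuousOn hΦ.cont
      have heq : EqOn (fun s : ℂ => (Φ (s + δ)).re) (fun s => (Φ s).re) strip :=
        fun t ht => hconst t ht δ
      exact heq.of_subset_closure hcont hcont' strip_subset_closedStrip closure_strip.ge ht
    have h1 := hcl _ (ofReal_mem_closedStrip 0) (Real.log a)
    rw [h.re_right hΦ le_rfl, ← Complex.ofReal_add, zero_add, h.re_left hΦ le_rfl] at h1
    have : 0 < ((k : ℝ) + m + 2) * Real.pi := by positivity
    linarith
  · have h1 := hopen strip subset_rfl isOpen_strip
    have h2 : deriv Φ '' strip ∈ 𝓝 (deriv Φ s) := h1.mem_nhds ⟨s, hs, rfl⟩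
    obtain ⟨ε, hε, hball⟩ := Metric.mem_nhds_iff.1 h2
    have hmem : deriv Φ s - (ε / 2 : ℝ) ∈ Metric.ball (deriv Φ s) ε := by
      rw [mem_ball_iff_norm, sub_sub_cancel_left, norm_neg, Complex.norm_real, Real.norm_eq_abs,
        abs_of_pos (by linarith)]
      linarith
    obtain ⟨t, ht, hteq⟩ := hball hmem
    have h3 := h.deriv_re_nonneg hΦ ht
    rw [hteq, Complex.sub_re, ← h0, Complex.ofReal_re] at h3
    linarith

/-- The Noshiro–Warschawski argument: along the segment from `s` to `t` in the convex strip, the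
real part of `Φ/(t - s)` has positive derivative. -/
theorem IsExtremal.injOn (h : IsExtremal k m a L c x) (hΦ : IsLift k a L c Φ) :
    InjOn Φ strip := by
  intro s hs t ht heq
  by_contra hne
  have hts : t - s ≠ 0 := sub_ne_zero.2 (Ne.symm hne)
  have hmem : ∀ u ∈ Icc (0 : ℝ) 1, s + u * (t - s) ∈ strip := by
    intro u hu
    have := convex_strip hs ht (sub_nonneg.2 hu.2) hu.1 (by ring)
    convert this using 1
    simp only [Complex.real_smul]; push_cast; ring
  have hder : ∀ u ∈ Icc (0 : ℝ) 1, HasDerivAt (fun u : ℝ => (Φ (s + u * (t - s)) / (t - s)).re)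
      (deriv Φ (s + u * (t - s))).re u := by
    intro u hu
    have hp : HasDerivAt (fun u : ℝ => s + (u : ℂ) * (t - s)) (t - s) u := by
      simpa using ((Complex.ofRealCLM.hasDerivAt (x := u)).mul_const (t - s)).const_add s
    have hd := (hΦ.differentiableAt (hmem u hu)).hasDerivAt
    have h1 := Complex.reCLM.hasFDerivAt.comp_hasDerivAt u ((hd.comp u hp).div_const (t - s))
    rw [mul_div_assoc, div_self hts, mul_one] at h1
    exact h1
  have hmono := strictMonoOn_of_deriv_pos (convex_Icc (0 : ℝ) 1)
    (fun u hu => (hder u hu).continuousAt.continuousWithinAt) (fun u hu => by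
      have hu' := interior_subset hu
      rw [(hder u hu').deriv]
      exact h.deriv_re_pos hΦ (hmem u hu'))
  have := hmono (left_mem_Icc.2 zero_le_one) (right_mem_Icc.2 zero_le_one) zero_lt_one
  simp [heq] at this

end Top

/-! ### Identification of the image with the slit half-strip -/

section Image

theorem arccos_div_cosh_lt {b v v' : ℝ} (hb : 0 ≤ b) (hv : b ≤ v) (hlt : v < v') :
    Real.arccos (Real.cosh b / Real.cosh v) < Real.arccos (Real.cosh b / Real.cosh v') := by
  have h1 : Real.cosh b ≤ Real.cosh v := Real.cosh_le_cosh.2 (by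
    rwa [abs_of_nonneg hb, abs_of_nonneg (hb.trans hv)])
  have h2 : Real.cosh v < Real.cosh v' := Real.cosh_lt_cosh.2 (by
    rwa [abs_of_nonneg (hb.trans hv), abs_of_nonneg ((hb.trans hv).trans hlt.le)])
  have hbp := Real.cosh_pos b
  have hvp := Real.cosh_pos v
  have hvp' := Real.cosh_pos v'
  refine Real.strictAntiOn_arccos ⟨?_, ?_⟩ ⟨?_, ?_⟩ ?_
  · linarith [div_pos hbp hvp']
  · exact (div_le_one hvp').2 (h1.trans h2.le)
  · linarith [div_pos hbp hvp]
  · exact (div_le_one hvp).2 h1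
  · exact div_lt_div_of_pos_left hbp hvp h2

theorem arccos_div_cosh_lt_pi_div_two (b v : ℝ) :
    Real.arccos (Real.cosh b / Real.cosh v) < Real.pi / 2 :=
  Real.arccos_lt_pi_div_two.2 (div_pos (Real.cosh_pos b) (Real.cosh_pos v))

theorem mem_domainΩ_of_im_lt {k m : ℕ} {b u v : ℝ} (hb : v < b)
    (hv : 0 < v) (hu : 0 < u) (hu' : u < ((k : ℝ) + m) * Real.pi) : (⟨u, v⟩ : ℂ) ∈ domainΩ k m b :=
  ⟨⟨hv, hu, hu'⟩, fun h => absurd h.2 (not_le.2 hb)⟩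

theorem mem_domainΩ_of_le {k m : ℕ} {b : ℝ} (hb : 0 < b) {w : ℂ} (hw : w ∈ domainΩ k m b) {v : ℝ}
    (hv : 0 < v) (hle : v ≤ w.im) : (⟨w.re, v⟩ : ℂ) ∈ domainΩ k m b := by
  refine ⟨⟨hv, hw.1.2.1, hw.1.2.2⟩, fun h => hw.2 ⟨?_, ?_⟩⟩
  · refine h.1.trans ?_
    rcases hle.eq_or_lt with h1 | h1
    · simp only [h1, le_refl]
    · exact (arccos_div_cosh_lt hb.le h.2 h1).le
  · exact le_trans h.2 hle

/-- Every point can be joined vertically to the height `b/2`, which lies below the removed region,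
and then horizontally. -/
theorem isPreconnected_domainΩ (k m : ℕ) {b : ℝ} (hb : 0 < b) : IsPreconnected (domainΩ k m b) := by
  rcases (domainΩ k m b).eq_empty_or_nonempty with h0 | ⟨w₀, hw₀⟩
  · rw [h0]; exact isPreconnected_empty
  have hline : Continuous fun u : ℝ => (⟨u, b / 2⟩ : ℂ) := by
    have : (fun u : ℝ => (⟨u, b / 2⟩ : ℂ)) = fun u : ℝ => (u : ℂ) + (b / 2 : ℝ) * Complex.I := by
      funext u; apply Complex.ext <;> simp
    rw [this]; fun_prop
  have hvert : ∀ u : ℝ, Continuous fun v : ℝ => (⟨u, v⟩ : ℂ) := fun u => by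
    have : (fun v : ℝ => (⟨u, v⟩ : ℂ)) = fun v : ℝ => (u : ℂ) + (v : ℝ) * Complex.I := by
      funext u; apply Complex.ext <;> simp
    rw [this]; fun_prop
  refine isPreconnected_of_forall (⟨w₀.re, b / 2⟩ : ℂ) fun w hw => ?_
  refine ⟨(fun u : ℝ => (⟨u, b / 2⟩ : ℂ)) '' uIcc w₀.re w.re ∪
    (fun v : ℝ => (⟨w.re, v⟩ : ℂ)) '' uIcc (b / 2) w.im, ?_, ?_, ?_, ?_⟩
  · rintro _ (⟨u, hu, rfl⟩ | ⟨v, hv, rfl⟩)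
    · refine mem_domainΩ_of_im_lt (by linarith) (by linarith) ?_ ?_
      · exact lt_of_lt_of_le (lt_min hw₀.1.2.1 hw.1.2.1) hu.1
      · exact lt_of_le_of_lt hu.2 (max_lt hw₀.1.2.2 hw.1.2.2)
    · have hv0 : 0 < v := lt_of_lt_of_le (lt_min (by linarith) hw.1.1) hv.1
      rcases le_or_gt v w.im with h1 | h1
      · exact mem_domainΩ_of_le hb hw hv0 h1
      · refine mem_domainΩ_of_im_lt ?_ hv0 hw.1.2.1 hw.1.2.2
        have := (le_max_iff.1 hv.2).resolve_right (not_le.2 h1)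
        linarith
  · exact Or.inl ⟨_, left_mem_uIcc, rfl⟩
  · exact Or.inr ⟨_, right_mem_uIcc, rfl⟩
  · refine IsPreconnected.union (⟨w.re, b / 2⟩ : ℂ) ⟨_, right_mem_uIcc, rfl⟩
      ⟨_, left_mem_uIcc, rfl⟩ ?_ ?_
    · exact isPreconnected_uIcc.image _ hline.continuousOn
    · exact isPreconnected_uIcc.image _ (hvert _).continuousOn

variable {k m : ℕ} {a L b : ℝ} {c : Fin (k + m + 1 + 1) → ℝ} {x : Fin (k + m + 1 + 1 + 1) → ℝ}
  {Φ : ℂ → ℂ}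

theorem IsExtremal.isOpen_image (h : IsExtremal k m a L c x) (hΦ : IsLift k a L c Φ) :
    IsOpen (Φ '' strip) := by
  have han : AnalyticOnNhd ℂ Φ strip := hΦ.differentiableOn.analyticOnNhd isOpen_strip
  rcases han.is_constant_or_isOpen convex_strip.isPreconnected with ⟨w, hw⟩ | hopen
  · have hs : ∀ t ∈ Ioo 0 (Real.pi / 2), (t : ℂ) * Complex.I ∈ strip := fun t ht => by
      simpa [strip] using ht
    have hpi := Real.pi_pos
    have h1 := hs (Real.pi / 4) ⟨by positivity, by linarith⟩
    have h2 := hs (Real.pi / 3) ⟨by positivity, by linarith⟩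
    have h3 := h.injOn hΦ h1 h2 ((hw _ h1).trans (hw _ h2).symm)
    have h4 := congrArg Complex.im h3
    simp at h4
    linarith
  · exact hopen _ subset_rfl isOpen_strip

/-- Points of the closed strip with bounded image height stay away from both ends. -/
theorem IsExtremal.exists_compact (h : IsExtremal k m a L c x) (hΦ : IsLift k a L c Φ) (T : ℝ) :
    ∃ K ⊆ closedStrip, IsCompact K ∧ ∀ s ∈ closedStrip, (Φ s).im ≤ T → s ∈ K := by
  obtain ⟨M₁, -, hM₁⟩ := hasBasis_leftEnd.mem_iff.1
    ((h.tendsto_leftEnd hΦ).1.eventually (eventually_gt_atTop T))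
  obtain ⟨M₂, -, hM₂⟩ := hasBasis_rightEnd.mem_iff.1
    ((h.tendsto_rightEnd hΦ).1.eventually (eventually_gt_atTop T))
  refine ⟨Icc M₁ M₂ ×ℂ Icc 0 (Real.pi / 2), fun s hs => hs.2,
    isCompact_Icc.reProdIm isCompact_Icc, fun s hs hsT => ⟨⟨?_, ?_⟩, hs⟩⟩
  · by_contra hcon
    exact absurd hsT (not_le.2 (hM₁ ⟨(not_le.1 hcon).le, hs⟩))
  · by_contra hcon
    exact absurd hsT (not_le.2 (hM₂ ⟨(not_le.1 hcon).le, hs⟩))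

/-- The height of `Φ` tends to infinity at both ends, so bounded parts of the image come from
compact sets. -/
theorem IsExtremal.closure_image_subset (h : IsExtremal k m a L c x) (hΦ : IsLift k a L c Φ) :
    closure (Φ '' strip) ⊆ Φ '' closedStrip := by
  intro w hw
  obtain ⟨K, hKs, hK, hmem⟩ := h.exists_compact hΦ (w.im + 1)
  have hclosed : IsClosed (Φ '' K) := (hK.image_of_continuousOn (hΦ.cont.mono hKs)).isClosed
  have hopen : IsOpen {z : ℂ | z.im < w.im + 1} := isOpen_lt Complex.continuous_im continuous_const
  have h1 : w ∈ closure ({z : ℂ | z.im < w.im + 1} ∩ Φ '' strip) :=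
    hopen.inter_closure ⟨by simp, hw⟩
  have h2 : {z : ℂ | z.im < w.im + 1} ∩ Φ '' strip ⊆ Φ '' K := by
    rintro _ ⟨hz, s, hs, rfl⟩
    exact ⟨s, hmem s (strip_subset_closedStrip hs) (le_of_lt hz), rfl⟩
  exact image_mono hKs (closure_minimal h2 hclosed h1)

theorem IsExtremal.bottom_edge (h : IsExtremal k m a L c x) (hΦ : IsLift k a L c Φ) (σ : ℝ) :
    (Φ σ).re = 0 ∨ (Φ σ).re = (k + m + 2) * Real.pi ∨ (Φ σ).im = 0 := by
  rcases le_or_gt σ (Real.log a) with h1 | h1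
  · exact Or.inl (h.re_left hΦ h1)
  rcases le_or_gt 0 σ with h2 | h2
  · exact Or.inr (Or.inl (h.re_right hΦ h2))
  · refine Or.inr (Or.inr (hΦ.im_eq_zero ?_))
    have h3 := h.le (Real.exp σ) ⟨((Real.log_lt_iff_lt_exp h.a_pos).1 h1).le,
      Real.exp_le_one_iff.2 h2.le⟩
    rw [realError, abs_div, abs_mul, abs_pow, abs_neg, abs_one, one_pow, one_mul,
      abs_of_pos h.L_pos]
    exact (div_le_one h.L_pos).2 h3

theorem IsExtremal.top_edge (h : IsExtremal k m a L c x) (hΦ : IsLift k a L c Φ) (hb : 0 < b)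
    (hbL : Real.cosh b = 1 / L) (σ : ℝ) :
    |(Φ (topEdge σ)).re - (k + 1) * Real.pi| =
      Real.arccos (Real.cosh b / Real.cosh (Φ (topEdge σ)).im) ∧ b ≤ (Φ (topEdge σ)).im := by
  have h1 := (h.cos_topEdge hΦ σ).1
  have hθ := h.topEdge_angle hΦ σ
  have hpos := Real.cosh_pos (Φ (topEdge σ)).im
  rw [← hbL] at h1
  constructor
  · rw [← h1, mul_div_assoc, div_self hpos.ne', mul_one, ← Real.cos_abs,
      Real.arccos_cos (abs_nonneg _)]
    have := abs_lt.2 hθ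
    linarith [Real.pi_pos]
  · have h2 : Real.cosh b ≤ Real.cosh (Φ (topEdge σ)).im := by
      rw [← h1]; exact mul_le_of_le_one_left hpos.le (Real.cos_le_one _)
    rwa [Real.cosh_le_cosh, abs_of_pos hb, abs_of_nonneg (hΦ.im_nonneg (topEdge_mem σ))] at h2

/-- A boundary point of the image lies on the image of one of the edges. -/
theorem IsExtremal.closure_image (h : IsExtremal k m a L c x) (hΦ : IsLift k a L c Φ) {w : ℂ}
    (hw : w ∈ closure (Φ '' strip)) :
    w ∈ Φ '' strip ∨ (∃ σ : ℝ, w = Φ σ) ∨ ∃ σ : ℝ, w = Φ (topEdge σ) := by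
  obtain ⟨s, hs, rfl⟩ := h.closure_image_subset hΦ hw
  rcases hs.1.eq_or_lt with h1 | h1
  · refine Or.inr (Or.inl ⟨s.re, ?_⟩)
    congr 1
    exact Complex.ext rfl (by simpa using h1.symm)
  rcases hs.2.eq_or_lt with h2 | h2
  · refine Or.inr (Or.inr ⟨s.re, ?_⟩)
    congr 1
    exact Complex.ext (by simp) (by simpa using h2)
  · exact Or.inl ⟨s, ⟨h1, h2⟩, rfl⟩

/-- High points of the image lie over the neighbourhoods of the two ends. -/
theorem IsExtremal.exists_height (h : IsExtremal k m a L c x) (hΦ : IsLift k a L c Φ) {ε : ℝ}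
    (hε : 0 < ε) :
    ∃ T, ∀ s ∈ closedStrip, T < (Φ s).im →
      Real.pi / 2 - ε < |(Φ s).re - (k + 1) * Real.pi| := by
  obtain ⟨M₁, -, hM₁⟩ := hasBasis_leftEnd.mem_iff.1
    ((h.tendsto_leftEnd hΦ).2.eventually (gt_mem_nhds hε))
  obtain ⟨M₂, -, hM₂⟩ := hasBasis_rightEnd.mem_iff.1
    ((h.tendsto_rightEnd hΦ).2.eventually (lt_mem_nhds (sub_lt_self _ hε)))
  have hK : IsCompact (Icc M₁ M₂ ×ℂ Icc 0 (Real.pi / 2)) := isCompact_Icc.reProdIm isCompact_Icc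
  have hsub : Icc M₁ M₂ ×ℂ Icc 0 (Real.pi / 2) ⊆ closedStrip := fun s hs => hs.2
  obtain ⟨T, hT⟩ := hK.exists_bound_of_continuousOn (f := fun s => (Φ s).im)
    (Complex.continuous_im.comp_continuousOn (hΦ.cont.mono hsub))
  refine ⟨T, fun s hs hsT => ?_⟩
  have him : s.im ∈ Icc 0 (Real.pi / 2) := hs
  rw [lt_abs]
  by_cases h1 : s.re ≤ M₁
  · have h2 : (Φ s).re - (2 * k + 1) * s.im < ε := hM₁ ⟨h1, hs⟩
    have h3 : (2 * k + 1) * s.im ≤ (2 * k + 1) * (Real.pi / 2) :=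
      mul_le_mul_of_nonneg_left him.2 (by positivity)
    right; linarith
  by_cases h2 : M₂ ≤ s.re
  · have h2 : (k + m + 2) * Real.pi - ε < (Φ s).re + (2 * m + 1) * s.im := hM₂ ⟨h2, hs⟩
    have h3 : (2 * m + 1) * s.im ≤ (2 * m + 1) * (Real.pi / 2) :=
      mul_le_mul_of_nonneg_left him.2 (by positivity)
    left; linarith
  · exact absurd hsT (not_lt.2 ((le_abs_self _).trans
      (hT s ⟨⟨(not_le.1 h1).le, (not_le.1 h2).le⟩, him⟩)))

/-- The vertical ray upwards from such a point meets the image of neither edge, so it stays in the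
image if it starts there. But high points of the image have real parts at distance almost `π/2` or
more from `(k+1)π`, and the ray is closer. -/
theorem IsExtremal.notMem_image (h : IsExtremal k m a L c x) (hΦ : IsLift k a L c Φ) (hb : 0 < b)
    (hbL : Real.cosh b = 1 / L) {w : ℂ} (hwb : b ≤ w.im)
    (hw : |w.re - (k + 1) * Real.pi| < Real.arccos (Real.cosh b / Real.cosh w.im)) :
    w ∉ Φ '' strip := by
  intro hmem
  have hpi := Real.pi_pos
  have hw2 := hw.trans (arccos_div_cosh_lt_pi_div_two b w.im)
  have hvert : Continuous fun v : ℝ => (⟨w.re, v⟩ : ℂ) := by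
    have : (fun v : ℝ => (⟨w.re, v⟩ : ℂ)) = fun v : ℝ => (w.re : ℂ) + (v : ℝ) * Complex.I := by
      funext u; apply Complex.ext <;> simp
    rw [this]; fun_prop
  have hray : (fun v : ℝ => (⟨w.re, v⟩ : ℂ)) '' Ici w.im ⊆ Φ '' strip := by
    refine (isPreconnected_Ici.image _ hvert.continuousOn).subset_of_closure_inter_subset
      (h.isOpen_image hΦ) ⟨w, ⟨w.im, mem_Ici.2 le_rfl, rfl⟩, hmem⟩ ?_
    rintro _ ⟨hcl, v, hv, rfl⟩
    have hv' : w.im ≤ v := hv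
    rcases h.closure_image hΦ hcl with h1 | ⟨σ, hσ⟩ | ⟨σ, hσ⟩
    · exact h1
    · exfalso
      have h2 := h.bottom_edge hΦ σ
      rw [← hσ] at h2
      simp only at h2
      rw [abs_lt] at hw2
      have hk : 0 ≤ (k : ℝ) * Real.pi := by positivity
      have hm : 0 ≤ (m : ℝ) * Real.pi := by positivity
      rcases h2 with h2 | h2 | h2 <;> [linarith; linarith; linarith]
    · exfalso
      have h2 := (h.top_edge hΦ hb hbL σ).1
      rw [← hσ] at h2
      simp only at h2
      have h3 : Real.arccos (Real.cosh b / Real.cosh w.im) ≤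
          Real.arccos (Real.cosh b / Real.cosh v) := by
        rcases hv'.eq_or_lt with h4 | h4
        · rw [h4]
        · exact (arccos_div_cosh_lt hb.le hwb h4).le
      linarith
  obtain ⟨T, hT⟩ := h.exists_height hΦ (sub_pos.2 hw2)
  obtain ⟨s, hs, hseq⟩ := hray ⟨max w.im (T + 1), mem_Ici.2 (le_max_left _ _), rfl⟩
  have h1 := hT s (strip_subset_closedStrip hs) (by
    rw [hseq]; exact lt_of_lt_of_le (lt_add_one T) (le_max_right _ _))
  rw [hseq] at h1
  simp only at h1
  linarith

theorem IsExtremal.image_eq (h : IsExtremal k m a L c x) (hΦ : IsLift k a L c Φ) (hb : 0 < b)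
    (hbL : Real.cosh b = 1 / L) : Φ '' strip = domainΩ (k + 1) (m + 1) b := by
  have hpi := Real.pi_pos
  have hsub : Φ '' strip ⊆ domainΩ (k + 1) (m + 1) b := by
    rintro _ ⟨s, hs, rfl⟩
    have hs' := strip_subset_closedStrip hs
    have him : 0 < s.im := hs.1
    have hk : 0 < (2 * (k : ℝ) + 1) * s.im := by positivity
    have hm : 0 < (2 * (m : ℝ) + 1) * s.im := by positivity
    refine ⟨⟨hΦ.im_pos s hs, by linarith [h.re_ge hΦ hs'], ?_⟩, ?_⟩
    · have := h.re_le hΦ hs'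
      push_cast
      linarith
    -- The removed set includes its boundary curve. If an image point lay in it, openness would give
    -- a slightly higher image point, which is strictly inside.
    · rintro ⟨h1, h2⟩
      have hopen := h.isOpen_image hΦ
      have hmem : Φ '' strip ∈ 𝓝 (Φ s) := hopen.mem_nhds ⟨s, hs, rfl⟩
      have hup : Tendsto (fun t : ℝ => Φ s + t * Complex.I) (𝓝[>] 0) (𝓝 (Φ s)) := by
        have : Continuous fun t : ℝ => Φ s + t * Complex.I := by fun_prop
        simpa using (this.tendsto 0).mono_left (nhdsWithin_le_nhds (s := Ioi 0))
      obtain ⟨t, ht1, ht2⟩ := ((hup.eventually hmem).and self_mem_nhdsWithin).exists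
      have ht2 : 0 < t := ht2
      refine h.notMem_image hΦ hb hbL (w := Φ s + t * Complex.I) ?_ ?_ ht1
      · simp; linarith
      · have h3 := arccos_div_cosh_lt hb.le h2 (show (Φ s).im < (Φ s).im + t by linarith)
        simp only [Complex.add_re, Complex.mul_re, Complex.ofReal_re, Complex.I_re, mul_zero,
          Complex.ofReal_im, Complex.I_im, mul_one, sub_self, add_zero, Complex.add_im,
          Complex.mul_im]
        push_cast at h1
        rw [mul_comm Real.pi] at h1
        exact h1.trans_lt h3
  refine subset_antisymm hsub ?_
  -- The image is open and relatively closed in the connected domain, since both edges are mapped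
  -- outside the domain.
  refine (isPreconnected_domainΩ _ _ hb).subset_of_closure_inter_subset (h.isOpen_image hΦ) ?_ ?_
  · have hs : ((Real.pi / 4 : ℝ) : ℂ) * Complex.I ∈ strip := by
      simp [strip]; constructor <;> linarith
    exact ⟨_, hsub ⟨_, hs, rfl⟩, _, hs, rfl⟩
  · rintro w ⟨hcl, hw⟩
    rcases h.closure_image hΦ hcl with h1 | ⟨σ, rfl⟩ | ⟨σ, rfl⟩
    · exact h1
    · exfalso
      have h3 := hw.1.2.2
      push_cast at h3
      rcases h.bottom_edge hΦ σ with h2 | h2 | h2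
      · exact hw.1.2.1.ne' h2
      · rw [h2] at h3; linarith
      · exact hw.1.1.ne' h2
    · exfalso
      have h2 := h.top_edge hΦ hb hbL σ
      refine hw.2 ⟨?_, h2.2⟩
      push_cast
      rw [mul_comm Real.pi, h2.1]

end Image

/-! ### The normalized conformal map of the quadrant -/

section Normalized

theorem bijOn_log_quadrant : BijOn Complex.log quadrant strip := by
  refine ⟨fun z hz => log_mem_strip hz, fun z hz w hw heq => ?_, fun s hs => ?_⟩
  · rw [← Complex.exp_log (ne_zero_of_mem_quadrant hz), heq,
      Complex.exp_log (ne_zero_of_mem_quadrant hw)]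
  · refine ⟨Complex.exp s, exp_mem_quadrant hs, Complex.log_exp ?_ ?_⟩
    · linarith [hs.1, Real.pi_pos]
    · linarith [hs.2, Real.pi_pos]

theorem tendsto_log_leftEnd : Tendsto Complex.log (𝓝[quadrant] 0) leftEnd := by
  refine tendsto_inf.2 ⟨tendsto_comap_iff.2 ?_, tendsto_principal.2 ?_⟩
  · have h1 : Tendsto (fun z : ℂ => ‖z‖) (𝓝[quadrant] 0) (𝓝[>] 0) := by
      refine tendsto_nhdsWithin_iff.2 ⟨?_, ?_⟩
      · exact (tendsto_norm_zero (E := ℂ)).mono_left nhdsWithin_le_nhds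
      · filter_upwards [self_mem_nhdsWithin] with z hz
        exact norm_pos_iff.2 (ne_zero_of_mem_quadrant hz)
    exact (Real.tendsto_log_nhdsGT_zero.comp h1).congr fun z => (Complex.log_re z).symm
  · filter_upwards [self_mem_nhdsWithin] with z hz
    exact strip_subset_closedStrip (log_mem_strip hz)

theorem tendsto_log_rightEnd :
    Tendsto Complex.log (Bornology.cobounded ℂ ⊓ 𝓟 quadrant) rightEnd := by
  refine tendsto_inf.2 ⟨tendsto_comap_iff.2 ?_, tendsto_principal.2 ?_⟩
  · have h1 : Tendsto (fun z : ℂ => ‖z‖) (Bornology.cobounded ℂ ⊓ 𝓟 quadrant) atTop :=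
      tendsto_norm_cobounded_atTop.mono_left inf_le_left
    exact (Real.tendsto_log_atTop.comp h1).congr fun z => (Complex.log_re z).symm
  · filter_upwards [mem_inf_of_right (mem_principal_self _)] with z hz
    exact strip_subset_closedStrip (log_mem_strip hz)

theorem tendsto_log_ofReal {y : ℝ} (hy : 0 < y) :
    Tendsto Complex.log (𝓝[quadrant] (y : ℂ)) (𝓝[closedStrip] (Real.log y : ℂ)) := by
  refine tendsto_nhdsWithin_iff.2 ⟨?_, ?_⟩
  · rw [Complex.ofReal_log hy.le]
    exact (continuousAt_clog (Complex.ofReal_mem_slitPlane.2 hy)).tendsto.mono_left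
      nhdsWithin_le_nhds
  · filter_upwards [self_mem_nhdsWithin] with z hz
    exact strip_subset_closedStrip (log_mem_strip hz)

instance nhdsWithin_quadrant_neBot (y : ℝ) [Fact (0 < y)] : (𝓝[quadrant] (y : ℂ)).NeBot := by
  have hy : 0 < y := Fact.out
  have : Tendsto (fun t : ℝ => (y : ℂ) + t * Complex.I) (𝓝[>] 0) (𝓝[quadrant] (y : ℂ)) := by
    refine tendsto_nhdsWithin_iff.2 ⟨?_, ?_⟩
    · have hc : Continuous fun t : ℝ => (y : ℂ) + t * Complex.I := by fun_prop
      simpa using (hc.tendsto 0).mono_left (nhdsWithin_le_nhds (s := Ioi 0))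
    · filter_upwards [self_mem_nhdsWithin] with t ht
      exact ⟨by simpa using hy, by simpa using ht⟩
  exact this.neBot

variable {k m : ℕ} {a L b : ℝ} {c : Fin (k + m + 1 + 1) → ℝ} {x : Fin (k + m + 1 + 1 + 1) → ℝ}
  {Φ : ℂ → ℂ}

theorem IsExtremal.apply_zero (h : IsExtremal k m a L c x) (hΦ : IsLift k a L c Φ) :
    Φ 0 = ((((k + 1 : ℕ) : ℝ) + (m + 1 : ℕ)) * Real.pi : ℝ) := by
  have h1 := h.re_right hΦ (le_refl 0)
  have h2 : (Φ (0 : ℝ)).im = 0 := by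
    refine hΦ.im_eq_zero ?_
    have := h.realError_point (Fin.last _)
    rw [h.last] at this
    rw [Real.exp_zero, this, abs_pow, abs_neg, abs_one, one_pow]
  rw [Complex.ofReal_zero] at h1 h2
  refine Complex.ext ?_ (by rw [h2, Complex.ofReal_im])
  rw [h1, Complex.ofReal_re]; push_cast; ring

/-- The conformal map of the quadrant that belongs to an extremal function. -/
theorem IsExtremal.isNormalizedMap (h : IsExtremal k m a L c x) (hΦ : IsLift k a L c Φ)
    (hb : 0 < b) (hbL : Real.cosh b = 1 / L) :
    IsNormalizedMap (k + 1) (m + 1) b fun z => Φ (Complex.log z) where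
  holo z hz := ((hΦ.differentiableAt (log_mem_strip hz)).comp z
    (Complex.differentiableAt_log (Or.inl hz.1))).differentiableWithinAt
  bij := by
    have h1 : BijOn Φ strip (domainΩ (k + 1) (m + 1) b) := by
      rw [← h.image_eq hΦ hb hbL]; exact (h.injOn hΦ).bijOn_image
    exact h1.comp bijOn_log_quadrant
  zero_im := (h.tendsto_leftEnd hΦ).1.comp tendsto_log_leftEnd
  zero_left := by
    have hpi := Real.pi_pos
    have h1 := (h.tendsto_leftEnd hΦ).2.eventually (gt_mem_nhds (show 0 < Real.pi / 2 by positivity))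
    have h2 : ∀ᶠ s in leftEnd, s ∈ closedStrip := mem_inf_of_right (mem_principal_self _)
    filter_upwards [tendsto_log_leftEnd.eventually (h1.and h2)] with z hz
    have h3 : (2 * (k : ℝ) + 1) * (Complex.log z).im ≤ (2 * k + 1) * (Real.pi / 2) :=
      mul_le_mul_of_nonneg_left hz.2.2 (by positivity)
    have h4 := hz.1
    push_cast
    linarith
  one := by
    have h1 := tendsto_log_ofReal one_pos
    rw [Real.log_one, Complex.ofReal_zero, Complex.ofReal_one] at h1
    have h2 : Tendsto Φ (𝓝[closedStrip] 0) (𝓝 (Φ 0)) :=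
      hΦ.cont 0 (by simpa using ofReal_mem_closedStrip 0)
    rw [h.apply_zero hΦ] at h2
    exact h2.comp h1
  infty_im := (h.tendsto_rightEnd hΦ).1.comp tendsto_log_rightEnd
  infty_right := by
    have hpi := Real.pi_pos
    have h1 := (h.tendsto_rightEnd hΦ).2.eventually
      (lt_mem_nhds (sub_lt_self _ (show 0 < Real.pi / 2 by positivity)))
    have h2 : ∀ᶠ s in rightEnd, s ∈ closedStrip := mem_inf_of_right (mem_principal_self _)
    filter_upwards [tendsto_log_rightEnd.eventually (h1.and h2)] with z hz
    have h3 : (2 * (m : ℝ) + 1) * (Complex.log z).im ≤ (2 * m + 1) * (Real.pi / 2) :=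
      mul_le_mul_of_nonneg_left hz.2.2 (by positivity)
    have h4 := hz.1
    push_cast
    linarith

theorem IsLift.hasBoundaryValue {N : ℕ} {c : Fin N → ℝ} (hΦ : IsLift k a L c Φ) {y : ℝ}
    (hy : 0 < y) : HasBoundaryValue (fun z => Φ (Complex.log z)) y (Φ (Real.log y)) :=
  (hΦ.cont _ (ofReal_mem_closedStrip _)).tendsto.comp (tendsto_log_ofReal hy)

/-- Left of `a` the imaginary part of `Φ` is positive; right of `a` the real part is, by
monotonicity and the arccosine formula on the first interval. -/
theorem IsExtremal.apply_log_eq_zero_iff (h : IsExtremal k m a L c x) (hΦ : IsLift k a L c Φ)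
    {y : ℝ} (hy : 0 < y) : Φ (Real.log y) = 0 ↔ y = a := by
  refine ⟨fun h0 => ?_, fun h0 => h0 ▸ hΦ.zero⟩
  rcases lt_trichotomy y a with hlt | heq | hgt
  · exfalso
    have h1 := h.one_lt_realError_left hy hlt
    rw [← Real.exp_log hy] at h1
    have h2 := (hΦ.sin_re_eq_zero (h1.trans_le (le_abs_self _))).2
    rw [h0] at h2
    simp at h2
  · exact heq
  · exfalso
    have h01 : a < x (Fin.succ 0) := by
      rw [← h.first]; exact h.strictMono (Fin.succ_pos 0)
    obtain ⟨t, hat, ht⟩ := exists_between (lt_min hgt h01)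
    have ht0 := h.a_pos.trans hat
    have hf : x (Fin.castSucc 0) = a := h.first
    have hmem : t ∈ Ioo (x (Fin.castSucc 0)) (x (Fin.succ 0)) :=
      ⟨hf ▸ hat, ht.trans_le (min_le_right _ _)⟩
    have h1 := h.re_between hΦ 0 (σ := Real.log t) (by rw [hf, hΦ.zero]; simp)
      ⟨Real.log_le_log (h.pos _) hmem.1.le, Real.log_le_log ht0 hmem.2.le⟩
    have h2 := h.abs_realError_lt 0 hmem
    rw [Real.exp_log ht0] at h1
    have h3 : 0 < Real.arccos ((-1) ^ ((0 : Fin (k + m + 1 + 1)) : ℕ) * realError k L c t) := by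
      rw [Real.arccos_pos]
      simpa using (abs_lt.1 h2).2
    have h4 := h.monotone_re_real hΦ (Real.log_le_log ht0 (ht.trans_le (min_le_left _ _)).le)
    simp only [h0, h1, Complex.zero_re] at h4
    simp only [Fin.val_zero, Nat.cast_zero, zero_mul, zero_add] at h3 h4
    linarith

theorem IsExtremal.oddLaurent_eq (h : IsExtremal k m a L c x) (hΦ : IsLift k a L c Φ) {y : ℝ}
    (hy : 0 < y) :
    (oddLaurent k c y : ℂ) = 1 - (-1) ^ (k + 1) * L * Complex.cos (Φ (Real.log y)) := by
  rw [hΦ.cos_eq _ (ofReal_mem_closedStrip _), ← Complex.ofReal_exp, Real.exp_log hy,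
    ← h.oddLaurentC_eq, oddLaurentC_ofReal]

end Normalized

/-! ### Rigidity of disc automorphisms -/

section Disc

/-- A holomorphic function that is injective on an open set has a holomorphic inverse. -/
theorem exists_holomorphic_inverse {f : ℂ → ℂ} {U V : Set ℂ} (hU : IsOpen U)
    (hf : DifferentiableOn ℂ f U) (hbij : BijOn f U V) :
    ∃ g : ℂ → ℂ, InvOn g f U V ∧ DifferentiableOn ℂ g V ∧ BijOn g V U := by
  have hinv := hbij.invOn_invFunOn
  set g := Function.invFunOn f U
  have hgbij : BijOn g V U := hinv.symm.bijOn hbij.surjOn.mapsTo_invFunOn hbij.mapsTo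
  have han : ∀ z ∈ U, AnalyticAt ℂ f z := fun z hz => hf.analyticAt (hU.mem_nhds hz)
  have hmap : ∀ z ∈ U, 𝓝 (f z) ≤ map f (𝓝 z) := by
    intro z hz
    refine (han z hz).eventually_constant_or_nhds_le_map_nhds.resolve_left fun hc => ?_
    have h1 : ∀ᶠ w in 𝓝[≠] z, w ∈ U ∧ f w = f z :=
      ((hU.eventually_mem hz).and hc).filter_mono nhdsWithin_le_nhds
    obtain ⟨w, ⟨hwU, hw⟩, hne⟩ := (h1.and self_mem_nhdsWithin).exists
    exact hne (hbij.injOn hwU hz hw)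
  have hV : IsOpen V := by
    rw [isOpen_iff_mem_nhds, ← hbij.image_eq]
    rintro _ ⟨z, hz, rfl⟩
    exact hmap z hz (image_mem_map (hU.mem_nhds hz))
  have hgc : ∀ w ∈ V, ContinuousAt g w := by
    intro w hw
    have hz := hgbij.mapsTo hw
    have hfz : f (g w) = w := hinv.2 hw
    intro N hN
    have h1 : f '' (N ∩ U) ∈ 𝓝 w := by
      have := hmap _ hz (image_mem_map (inter_mem hN (hU.mem_nhds hz)))
      rwa [hfz] at this
    rw [mem_map]
    filter_upwards [h1]
    rintro _ ⟨z, ⟨hzN, hzU⟩, rfl⟩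
    rw [mem_preimage, hinv.1 hzU]
    exact hzN
  have hgd : ∀ w ∈ V, deriv f (g w) ≠ 0 → DifferentiableAt ℂ g w := by
    intro w hw h0
    refine (HasDerivAt.of_local_left_inverse (hgc w hw)
      (han _ (hgbij.mapsTo hw)).differentiableAt.hasDerivAt h0 ?_).differentiableAt
    filter_upwards [hV.mem_nhds hw] with y hy using hinv.2 hy
  refine ⟨g, hinv, fun w hw => ?_, hgbij⟩
  -- Zeros of `f'` are isolated, since `f` is not locally constant; the continuous inverse is
  -- therefore differentiable off isolated points, and these are removable.
  refine (Complex.analyticAt_of_differentiable_on_punctured_nhds_of_continuousAt ?_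
    (hgc w hw)).differentiableAt.differentiableWithinAt
  have hz := hgbij.mapsTo hw
  have hne : ∀ᶠ z in 𝓝[≠] (g w), deriv f z ≠ 0 := by
    refine (han _ hz).deriv.eventually_eq_zero_or_eventually_ne_zero.resolve_left fun hc => ?_
    obtain ⟨ε, hε, hball⟩ := Metric.eventually_nhds_iff_ball.1
      ((hU.eventually_mem hz).and hc)
    obtain ⟨z, hzb, hzne⟩ : ∃ z ∈ Metric.ball (g w) ε, z ≠ g w := by
      refine ⟨g w + (ε / 2 : ℝ), ?_, ?_⟩
      · rw [mem_ball_iff_norm, add_sub_cancel_left, Complex.norm_real, Real.norm_eq_abs,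
          abs_of_pos (by linarith)]
        linarith
      · simp [hε.ne']
    have := (convex_ball (g w) ε).is_const_of_fderivWithin_eq_zero (𝕜 := ℂ) (f := f)
      (fun t ht => (han t (hball t ht).1).differentiableAt.differentiableWithinAt)
      (fun t ht => by
        rw [fderivWithin_of_isOpen Metric.isOpen_ball ht]
        ext
        simp [(hball t ht).2]) hzb (Metric.mem_ball_self hε)
    exact hzne (hbij.injOn (hball z hzb).1 hz this)
  have hgt : Tendsto g (𝓝[≠] w) (𝓝[≠] (g w)) := by
    refine tendsto_nhdsWithin_iff.2 ⟨(hgc w hw).tendsto.mono_left nhdsWithin_le_nhds, ?_⟩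
    filter_upwards [self_mem_nhdsWithin, mem_nhdsWithin_of_mem_nhds (hV.mem_nhds hw)] with y hy hyV
    exact fun h => hy (hgbij.injOn hyV hw h)
  filter_upwards [hgt.eventually hne, mem_nhdsWithin_of_mem_nhds (hV.mem_nhds hw)] with y hy hyV
  exact hgd y hyV hy

theorem normSq_one_add_sub (q w : ℂ) :
    Complex.normSq (1 + starRingEnd ℂ q * w) - Complex.normSq (w + q) =
      (1 - Complex.normSq q) * (1 - Complex.normSq w) := by
  simp only [Complex.normSq_apply, Complex.add_re, Complex.add_im, Complex.mul_re, Complex.mul_im,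
    Complex.conj_re, Complex.conj_im, Complex.one_re, Complex.one_im]
  ring

/-- A disc automorphism of the form `w ↦ (w + q) / (1 + q̄ w)`. -/
def discShift (q w : ℂ) : ℂ := (w + q) / (1 + starRingEnd ℂ q * w)

theorem normSq_lt_one {w : ℂ} (hw : w ∈ Metric.ball (0 : ℂ) 1) : Complex.normSq w < 1 := by
  rw [mem_ball_zero_iff] at hw
  rw [Complex.normSq_eq_norm_sq]
  exact pow_lt_one₀ (norm_nonneg _) hw two_ne_zero

theorem norm_lt_of_normSq_lt {z w : ℂ} (h : Complex.normSq z < Complex.normSq w) : ‖z‖ < ‖w‖ := by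
  rw [Complex.normSq_eq_norm_sq, Complex.normSq_eq_norm_sq] at h
  exact lt_of_pow_lt_pow_left₀ 2 (norm_nonneg _) h

theorem one_add_conj_mul_ne_zero {q w : ℂ} (hq : q ∈ Metric.ball (0 : ℂ) 1)
    (hw : w ∈ Metric.ball (0 : ℂ) 1) : 1 + starRingEnd ℂ q * w ≠ 0 := by
  intro h0
  have h1 := normSq_one_add_sub q w
  rw [h0, map_zero] at h1
  have h2 := mul_pos (sub_pos.2 (normSq_lt_one hq)) (sub_pos.2 (normSq_lt_one hw))
  have h3 := Complex.normSq_nonneg (w + q)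
  linarith

theorem discShift_mem {q w : ℂ} (hq : q ∈ Metric.ball (0 : ℂ) 1)
    (hw : w ∈ Metric.ball (0 : ℂ) 1) : discShift q w ∈ Metric.ball (0 : ℂ) 1 := by
  rw [mem_ball_zero_iff, discShift, norm_div,
    div_lt_one (norm_pos_iff.2 (one_add_conj_mul_ne_zero hq hw))]
  refine norm_lt_of_normSq_lt ?_
  have h1 := normSq_one_add_sub q w
  have h2 := mul_pos (sub_pos.2 (normSq_lt_one hq)) (sub_pos.2 (normSq_lt_one hw))
  linarith

theorem neg_mem_unit_ball {q : ℂ} (hq : q ∈ Metric.ball (0 : ℂ) 1) :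
    -q ∈ Metric.ball (0 : ℂ) 1 := by
  rw [mem_ball_zero_iff, norm_neg]; exact mem_ball_zero_iff.1 hq

theorem discShift_neg_discShift {q w : ℂ} (hq : q ∈ Metric.ball (0 : ℂ) 1)
    (hw : w ∈ Metric.ball (0 : ℂ) 1) : discShift q (discShift (-q) w) = w := by
  have h1 := one_add_conj_mul_ne_zero (neg_mem_unit_ball hq) hw
  have h2 := one_add_conj_mul_ne_zero hq (discShift_mem (neg_mem_unit_ball hq) hw)
  rw [discShift, div_eq_iff h2, discShift]
  rw [map_neg, neg_mul, ← sub_eq_add_neg] at h1 ⊢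
  generalize starRingEnd ℂ q = p at h1 ⊢
  have h3 : (w + -q) / (1 - p * w) * (1 - p * w) = w - q := by rw [div_mul_cancel₀ _ h1]; ring
  refine mul_right_cancel₀ h1 ?_
  linear_combination (1 - w * p) * h3

theorem bijOn_discShift {q : ℂ} (hq : q ∈ Metric.ball (0 : ℂ) 1) :
    BijOn (discShift q) (Metric.ball 0 1) (Metric.ball 0 1) := by
  refine InvOn.bijOn (f' := discShift (-q)) ⟨fun w hw => ?_, fun w hw => ?_⟩
    (fun w hw => discShift_mem hq hw) fun w hw => discShift_mem (neg_mem_unit_ball hq) hw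
  · have := discShift_neg_discShift (neg_mem_unit_ball hq) hw
    rwa [neg_neg] at this
  · exact discShift_neg_discShift hq hw

/-- A bijective holomorphic self-map of the disc that fixes the origin is a rotation. -/
theorem exists_eq_mul_of_bijOn_ball {G : ℂ → ℂ} (hd : DifferentiableOn ℂ G (Metric.ball 0 1))
    (hbij : BijOn G (Metric.ball 0 1) (Metric.ball 0 1)) (h0 : G 0 = 0) :
    ∃ lam : ℂ, ∀ w ∈ Metric.ball (0 : ℂ) 1, G w = lam * w := by
  obtain ⟨H, hinv, hHd, hHbij⟩ := exists_holomorphic_inverse Metric.isOpen_ball hd hbij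
  have hz0 : (0 : ℂ) ∈ Metric.ball (0 : ℂ) 1 := Metric.mem_ball_self one_pos
  have hH0 : H 0 = 0 := by
    have := hinv.1 hz0
    rwa [h0] at this
  have hw0 : (1 / 2 : ℂ) ∈ Metric.ball (0 : ℂ) 1 := by
    rw [mem_ball_zero_iff]; norm_num
  -- The Schwarz lemma for `G` and for its inverse gives equality of norms at `1/2`, which is the
  -- rigid case.
  have h1 : ‖G (1 / 2)‖ ≤ ‖(1 / 2 : ℂ)‖ := Complex.norm_le_norm_of_mapsTo_ball hd
    (fun w hw => Metric.ball_subset_closedBall (hbij.mapsTo hw)) h0 (mem_ball_zero_iff.1 hw0)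
  have h2 : ‖H (G (1 / 2))‖ ≤ ‖G (1 / 2)‖ := Complex.norm_le_norm_of_mapsTo_ball hHd
    (fun w hw => Metric.ball_subset_closedBall (hHbij.mapsTo hw)) hH0
    (mem_ball_zero_iff.1 (hbij.mapsTo hw0))
  rw [hinv.1 hw0] at h2
  obtain ⟨C, -, hC⟩ := Complex.affine_of_mapsTo_ball_of_exists_norm_dslope_eq_div' (R₂ := 1) hd
    (by rw [h0]; exact fun w hw => Metric.ball_subset_closedBall (hbij.mapsTo hw))
    ⟨1 / 2, hw0, by
      rw [dslope_of_ne _ (by norm_num), slope_def_module, h0, sub_zero, sub_zero, norm_smul,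
        norm_inv, le_antisymm h1 h2]
      norm_num⟩
  refine ⟨C, fun w hw => ?_⟩
  rw [hC hw, h0]
  simp [mul_comm]

/-- A bijective holomorphic self-map of the disc with three boundary fixed points is the
identity. -/
theorem eqOn_id_of_bijOn_ball {F : ℂ → ℂ} (hd : DifferentiableOn ℂ F (Metric.ball 0 1))
    (hbij : BijOn F (Metric.ball 0 1) (Metric.ball 0 1)) {ω₁ ω₂ ω₃ : ℂ} (h12 : ω₁ ≠ ω₂)
    (h13 : ω₁ ≠ ω₃) (h23 : ω₂ ≠ ω₃)
    (hlim : ∀ ω ∈ ({ω₁, ω₂, ω₃} : Set ℂ), ‖ω‖ = 1 ∧ Tendsto F (𝓝[Metric.ball 0 1] ω) (𝓝 ω)) :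
    EqOn F id (Metric.ball 0 1) := by
  have hz0 : (0 : ℂ) ∈ Metric.ball (0 : ℂ) 1 := Metric.mem_ball_self one_pos
  obtain ⟨q, hq, hFq⟩ := hbij.surjOn hz0
  have hMd : DifferentiableOn ℂ (discShift q) (Metric.ball 0 1) := fun w hw => by
    have := one_add_conj_mul_ne_zero hq hw
    unfold discShift
    exact DifferentiableAt.differentiableWithinAt (by fun_prop (disch := assumption))
  obtain ⟨lam, hlam⟩ := exists_eq_mul_of_bijOn_ball
    (hd.comp hMd (bijOn_discShift hq).mapsTo) (hbij.comp (bijOn_discShift hq))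
    (by simp [discShift, hFq])
  have hform : ∀ w ∈ Metric.ball (0 : ℂ) 1,
      F w * (1 - starRingEnd ℂ q * w) = lam * (w - q) := by
    intro w hw
    have h1 := hlam _ (discShift_mem (neg_mem_unit_ball hq) hw)
    rw [Function.comp_apply, discShift_neg_discShift hq hw] at h1
    have h2 := one_add_conj_mul_ne_zero (neg_mem_unit_ball hq) hw
    rw [h1, discShift]
    rw [map_neg] at h2 ⊢
    rw [neg_mul, ← sub_eq_add_neg] at h2 ⊢
    rw [mul_assoc, ← sub_eq_add_neg, div_mul_cancel₀ _ h2]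
  -- Boundary fixed points solve an equation of degree at most two in `ω`. Three distinct solutions
  -- force all its coefficients to vanish, so `q = 0` and `lam = 1`.
  have hroot : ∀ ω ∈ ({ω₁, ω₂, ω₃} : Set ℂ),
      ω * (1 - starRingEnd ℂ q * ω) = lam * (ω - q) := by
    intro ω hω
    obtain ⟨hnorm, hF⟩ := hlim ω hω
    have hcl : ω ∈ closure (Metric.ball (0 : ℂ) 1) := by
      rw [closure_ball _ one_ne_zero, mem_closedBall_zero_iff, hnorm]
    have := mem_closure_iff_nhdsWithin_neBot.1 hcl
    have hid : Tendsto (fun w : ℂ => w) (𝓝[Metric.ball 0 1] ω) (𝓝 ω) :=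
      tendsto_id.mono_left nhdsWithin_le_nhds
    refine tendsto_nhds_unique (hF.mul (tendsto_const_nhds.sub (hid.const_mul _))) ?_
    refine ((hid.sub_const q).const_mul lam).congr' ?_
    filter_upwards [self_mem_nhdsWithin] with w hw using (hform w hw).symm
  have e1 := hroot ω₁ (by simp)
  have e2 := hroot ω₂ (by simp)
  have e3 := hroot ω₃ (by simp)
  set p := starRingEnd ℂ q
  have f12 : 1 - p * (ω₁ + ω₂) = lam := by
    refine mul_left_cancel₀ (sub_ne_zero.2 h12) ?_
    linear_combination e1 - e2
  have f13 : 1 - p * (ω₁ + ω₃) = lam := by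
    refine mul_left_cancel₀ (sub_ne_zero.2 h13) ?_
    linear_combination e1 - e3
  have hp : p = 0 := by
    refine (mul_eq_zero.1 (show p * (ω₂ - ω₃) = 0 by linear_combination f13 - f12)).resolve_right
      (sub_ne_zero.2 h23)
  have hl : lam = 1 := by rw [← f12, hp]; ring
  have hq0 : q = 0 := (map_eq_zero _).1 hp
  intro w hw
  have := hform w hw
  rw [hl, hq0, hp] at this
  simpa using this

end Disc

/-! ### Transfer of the rigidity to the quadrant -/

section Cayley

/-- The conformal map `z ↦ (z² - i)/(z² + i)` of the quadrant onto the unit disc. -/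
def quadrantToDisc (z : ℂ) : ℂ := (z ^ 2 - Complex.I) / (z ^ 2 + Complex.I)

/-- The inverse map `w ↦ √(i(1 + w)/(1 - w))`. -/
def discToQuadrant (w : ℂ) : ℂ :=
  Complex.exp (Complex.log (Complex.I * (1 + w) / (1 - w)) / 2)

theorem sq_im_pos {z : ℂ} (hz : z ∈ quadrant) : 0 < (z ^ 2).im := by
  rw [sq, Complex.mul_im]; nlinarith [mul_pos hz.1 hz.2]

theorem sq_add_I_ne_zero {z : ℂ} (hz : z ∈ quadrant) : z ^ 2 + Complex.I ≠ 0 := by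
  intro h0
  have h1 := congrArg Complex.im h0
  rw [Complex.add_im, Complex.I_im, Complex.zero_im] at h1
  linarith [sq_im_pos hz]

theorem eq_of_sq_eq_of_mem_quadrant {z z' : ℂ} (hz : z ∈ quadrant) (hz' : z' ∈ quadrant)
    (h : z ^ 2 = z' ^ 2) : z = z' := by
  rcases sq_eq_sq_iff_eq_or_eq_neg.1 h with h1 | h1
  · exact h1
  · have := congrArg Complex.re h1
    rw [Complex.neg_re] at this
    linarith [hz.1, hz'.1]

theorem quadrantToDisc_mem {z : ℂ} (hz : z ∈ quadrant) :
    quadrantToDisc z ∈ Metric.ball (0 : ℂ) 1 := by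
  rw [mem_ball_zero_iff, quadrantToDisc, norm_div,
    div_lt_one (norm_pos_iff.2 (sq_add_I_ne_zero hz))]
  refine norm_lt_of_normSq_lt ?_
  have := sq_im_pos hz
  simp only [Complex.normSq_apply, Complex.add_re, Complex.add_im, Complex.sub_re, Complex.sub_im,
    Complex.I_re, Complex.I_im]
  nlinarith

theorem one_sub_ne_zero_of_mem_ball {w : ℂ} (hw : w ∈ Metric.ball (0 : ℂ) 1) : 1 - w ≠ 0 := by
  intro h0
  have : w = 1 := (sub_eq_zero.1 h0).symm
  rw [this] at hw
  simp at hw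

theorem cayley_im_pos {w : ℂ} (hw : w ∈ Metric.ball (0 : ℂ) 1) :
    0 < (Complex.I * (1 + w) / (1 - w)).im := by
  have h1 := normSq_lt_one hw
  have h2 := Complex.normSq_pos.2 (one_sub_ne_zero_of_mem_ball hw)
  have h3 : (Complex.I * (1 + w) / (1 - w)).im =
      (1 - Complex.normSq w) / Complex.normSq (1 - w) := by
    rw [Complex.div_im]
    simp only [Complex.mul_re, Complex.mul_im, Complex.I_re, Complex.I_im, Complex.add_re,
      Complex.add_im, Complex.sub_re, Complex.sub_im, Complex.one_re, Complex.one_im,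
      Complex.normSq_apply w]
    ring
  rw [h3]
  exact div_pos (by linarith) h2

theorem discToQuadrant_mem {w : ℂ} (hw : w ∈ Metric.ball (0 : ℂ) 1) :
    discToQuadrant w ∈ quadrant := by
  refine exp_mem_quadrant ?_
  have h1 := cayley_im_pos hw
  have h2 : (Complex.log (Complex.I * (1 + w) / (1 - w)) / 2).im =
      (Complex.I * (1 + w) / (1 - w)).arg / 2 := by
    rw [← Complex.log_im, show (2 : ℂ) = ((2 : ℝ) : ℂ) by norm_num, Complex.div_ofReal_im]
  simp only [strip, mem_preimage, h2, mem_Ioo]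
  constructor
  · have : 0 < (Complex.I * (1 + w) / (1 - w)).arg :=
      lt_of_le_of_ne (Complex.arg_nonneg_iff.2 h1.le) fun h => h1.ne'
        (Complex.arg_eq_zero_iff.1 h.symm).2
    linarith
  · have : (Complex.I * (1 + w) / (1 - w)).arg < Real.pi :=
      lt_of_le_of_ne (Complex.arg_le_pi _) fun h => h1.ne' (Complex.arg_eq_pi_iff.1 h).2
    linarith

theorem cayley_ne_zero {w : ℂ} (hw : w ∈ Metric.ball (0 : ℂ) 1) :
    Complex.I * (1 + w) / (1 - w) ≠ 0 := fun h => by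
  have := cayley_im_pos hw; rw [h] at this; simp at this

theorem discToQuadrant_sq {w : ℂ} (hw : w ∈ Metric.ball (0 : ℂ) 1) :
    discToQuadrant w ^ 2 = Complex.I * (1 + w) / (1 - w) := by
  rw [discToQuadrant, ← Complex.exp_nat_mul, Nat.cast_ofNat, mul_div_cancel₀ _ two_ne_zero,
    Complex.exp_log (cayley_ne_zero hw)]

theorem quadrantToDisc_discToQuadrant {w : ℂ} (hw : w ∈ Metric.ball (0 : ℂ) 1) :
    quadrantToDisc (discToQuadrant w) = w := by
  have h1 := one_sub_ne_zero_of_mem_ball hw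
  have h2 := sq_add_I_ne_zero (discToQuadrant_mem hw)
  rw [quadrantToDisc, div_eq_iff h2, discToQuadrant_sq hw]
  field_simp
  ring

theorem discToQuadrant_quadrantToDisc {z : ℂ} (hz : z ∈ quadrant) :
    discToQuadrant (quadrantToDisc z) = z := by
  have hw := quadrantToDisc_mem hz
  refine eq_of_sq_eq_of_mem_quadrant (discToQuadrant_mem hw) hz ?_
  have h1 := one_sub_ne_zero_of_mem_ball hw
  have h2 := sq_add_I_ne_zero hz
  rw [discToQuadrant_sq hw, div_eq_iff h1, quadrantToDisc]
  field_simp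
  ring

theorem bijOn_quadrantToDisc : BijOn quadrantToDisc quadrant (Metric.ball 0 1) :=
  InvOn.bijOn (f' := discToQuadrant) ⟨fun _ hz => discToQuadrant_quadrantToDisc hz,
    fun _ hw => quadrantToDisc_discToQuadrant hw⟩ (fun _ hz => quadrantToDisc_mem hz)
    fun _ hw => discToQuadrant_mem hw

theorem bijOn_discToQuadrant : BijOn discToQuadrant (Metric.ball 0 1) quadrant :=
  InvOn.bijOn (f' := quadrantToDisc) ⟨fun _ hw => quadrantToDisc_discToQuadrant hw,
    fun _ hz => discToQuadrant_quadrantToDisc hz⟩ (fun _ hw => discToQuadrant_mem hw)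
    fun _ hz => quadrantToDisc_mem hz

theorem differentiableOn_discToQuadrant : DifferentiableOn ℂ discToQuadrant (Metric.ball 0 1) := by
  intro w hw
  have h1 := one_sub_ne_zero_of_mem_ball hw
  have h2 : Complex.I * (1 + w) / (1 - w) ∈ Complex.slitPlane := Or.inr (cayley_im_pos hw).ne'
  have h3 : DifferentiableAt ℂ (fun w : ℂ => Complex.I * (1 + w) / (1 - w)) w := by
    fun_prop (disch := assumption)
  exact ((h3.clog h2).div_const 2).cexp.differentiableWithinAt

theorem differentiableOn_quadrantToDisc : DifferentiableOn ℂ quadrantToDisc quadrant := by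
  intro z hz
  have h2 := sq_add_I_ne_zero hz
  unfold quadrantToDisc
  exact DifferentiableAt.differentiableWithinAt (by fun_prop (disch := assumption))

theorem tendsto_discToQuadrant_zero :
    Tendsto discToQuadrant (𝓝[Metric.ball 0 1] (-1)) (𝓝[quadrant] 0) := by
  refine tendsto_nhdsWithin_iff.2 ⟨?_, ?_⟩
  · have hc : ContinuousAt (fun w : ℂ => Complex.I * (1 + w) / (1 - w)) (-1) := by
      refine ContinuousAt.div (by fun_prop) (by fun_prop) (by norm_num)
    have h1 : Tendsto (fun w : ℂ => discToQuadrant w ^ 2) (𝓝[Metric.ball 0 1] (-1)) (𝓝 0) := by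
      have := hc.tendsto.mono_left (nhdsWithin_le_nhds (s := Metric.ball (0 : ℂ) 1))
      simp only [add_neg_cancel, mul_zero, zero_div] at this
      refine this.congr' ?_
      filter_upwards [self_mem_nhdsWithin] with w hw using (discToQuadrant_sq hw).symm
    rw [tendsto_zero_iff_norm_tendsto_zero] at h1 ⊢
    have h2 := (Real.continuous_sqrt.tendsto 0).comp h1
    rw [Real.sqrt_zero] at h2
    refine h2.congr fun w => ?_
    rw [Function.comp_apply, norm_pow, Real.sqrt_sq (norm_nonneg _)]
  · filter_upwards [self_mem_nhdsWithin] with w hw using discToQuadrant_mem hw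

theorem tendsto_discToQuadrant_one :
    Tendsto discToQuadrant (𝓝[Metric.ball 0 1] (-Complex.I)) (𝓝[quadrant] 1) := by
  refine tendsto_nhdsWithin_iff.2 ⟨?_, ?_⟩
  · have hne : 1 - -Complex.I ≠ 0 := fun h => by
      have := congrArg Complex.re h; simp at this
    have hval : Complex.I * (1 + -Complex.I) / (1 - -Complex.I) = 1 := by
      rw [div_eq_one_iff_eq hne, mul_add, mul_neg, Complex.I_mul_I]; ring
    have hc : ContinuousAt (fun w : ℂ => Complex.I * (1 + w) / (1 - w)) (-Complex.I) :=
      ContinuousAt.div (by fun_prop) (by fun_prop) hne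
    have hc2 : ContinuousAt discToQuadrant (-Complex.I) := by
      refine ((hc.clog ?_).div_const 2).cexp
      rw [hval]; exact Complex.one_mem_slitPlane
    have := hc2.tendsto.mono_left (nhdsWithin_le_nhds (s := Metric.ball (0 : ℂ) 1))
    rw [discToQuadrant, hval] at this
    simpa using this
  · filter_upwards [self_mem_nhdsWithin] with w hw using discToQuadrant_mem hw

theorem tendsto_discToQuadrant_infty :
    Tendsto discToQuadrant (𝓝[Metric.ball 0 1] 1) (Bornology.cobounded ℂ ⊓ 𝓟 quadrant) := by
  refine tendsto_inf.2 ⟨?_, tendsto_principal.2 ?_⟩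
  · rw [← tendsto_norm_atTop_iff_cobounded]
    have h1 : Tendsto (fun w : ℂ => ‖discToQuadrant w‖ ^ 2) (𝓝[Metric.ball 0 1] 1) atTop := by
      have hnum : Tendsto (fun w : ℂ => ‖Complex.I * (1 + w)‖) (𝓝[Metric.ball 0 1] 1) (𝓝 2) := by
        have hc : Continuous fun w : ℂ => ‖Complex.I * (1 + w)‖ := by fun_prop
        have := (hc.tendsto 1).mono_left (nhdsWithin_le_nhds (s := Metric.ball (0 : ℂ) 1))
        convert this using 2
        norm_num
      have hden : Tendsto (fun w : ℂ => ‖1 - w‖) (𝓝[Metric.ball 0 1] 1) (𝓝[>] 0) := by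
        refine tendsto_nhdsWithin_iff.2 ⟨?_, ?_⟩
        · have hc : Continuous fun w : ℂ => ‖1 - w‖ := by fun_prop
          have := (hc.tendsto 1).mono_left (nhdsWithin_le_nhds (s := Metric.ball (0 : ℂ) 1))
          simpa using this
        · filter_upwards [self_mem_nhdsWithin] with w hw
          exact norm_pos_iff.2 (one_sub_ne_zero_of_mem_ball hw)
      refine (hnum.pos_mul_atTop two_pos hden.inv_tendsto_nhdsGT_zero).congr' ?_
      filter_upwards [self_mem_nhdsWithin] with w hw
      rw [← norm_pow, discToQuadrant_sq hw, norm_div]; rfl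
    have h2 := Real.tendsto_sqrt_atTop.comp h1
    refine h2.congr fun w => ?_
    rw [Function.comp_apply, Real.sqrt_sq (norm_nonneg _)]
  · filter_upwards [self_mem_nhdsWithin] with w hw using discToQuadrant_mem hw

theorem tendsto_quadrantToDisc_infty :
    Tendsto quadrantToDisc (Bornology.cobounded ℂ ⊓ 𝓟 quadrant) (𝓝 1) := by
  have h1 : Tendsto (fun z : ℂ => z ^ 2 + Complex.I) (Bornology.cobounded ℂ) (Bornology.cobounded ℂ) :=
    (tendsto_add_const_cobounded _).comp (tendsto_pow_cobounded_cobounded two_ne_zero)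
  have h2 : Tendsto (fun z : ℂ => 1 - 2 * Complex.I * (z ^ 2 + Complex.I)⁻¹)
      (Bornology.cobounded ℂ ⊓ 𝓟 quadrant) (𝓝 (1 - 2 * Complex.I * 0)) :=
    tendsto_const_nhds.sub (((tendsto_inv₀_cobounded.comp h1).mono_left inf_le_left).const_mul _)
  rw [mul_zero, sub_zero] at h2
  refine h2.congr' ?_
  filter_upwards [mem_inf_of_right (mem_principal_self _)] with z hz
  have := sq_add_I_ne_zero hz
  rw [quadrantToDisc]
  field_simp
  ring

/-- A bijective holomorphic self-map of the quadrant that fixes the boundary points `0`, `1`, `∞`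
is the identity. -/
theorem eqOn_id_of_bijOn_quadrant {T : ℂ → ℂ} (hd : DifferentiableOn ℂ T quadrant)
    (hbij : BijOn T quadrant quadrant) (h0 : Tendsto T (𝓝[quadrant] 0) (𝓝 0))
    (h1 : Tendsto T (𝓝[quadrant] 1) (𝓝 1))
    (hinf : Tendsto T (Bornology.cobounded ℂ ⊓ 𝓟 quadrant) (Bornology.cobounded ℂ)) :
    EqOn T id quadrant := by
  have hF := eqOn_id_of_bijOn_ball (F := quadrantToDisc ∘ T ∘ discToQuadrant)
    -- These are the images of `0`, `1` and `∞` under the conformal map to the disc.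
    (ω₁ := -1) (ω₂ := -Complex.I) (ω₃ := 1)
    (differentiableOn_quadrantToDisc.comp (hd.comp differentiableOn_discToQuadrant
      bijOn_discToQuadrant.mapsTo) (hbij.comp bijOn_discToQuadrant).mapsTo)
    (bijOn_quadrantToDisc.comp (hbij.comp bijOn_discToQuadrant))
    (fun h => by simpa using congrArg Complex.re h)
    (fun h => by have := congrArg Complex.re h; norm_num at this)
    (fun h => by simpa using congrArg Complex.re h) ?_
  · intro z hz
    have h2 := hF (quadrantToDisc_mem hz)
    simp only [Function.comp_apply, discToQuadrant_quadrantToDisc hz, id] at h2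
    exact bijOn_quadrantToDisc.injOn (hbij.mapsTo hz) hz h2
  · rintro ω (rfl | rfl | rfl)
    · refine ⟨by simp, ?_⟩
      have hc : ContinuousAt quadrantToDisc 0 :=
        ContinuousAt.div (by fun_prop) (by fun_prop) (by simp)
      have h2 := hc.tendsto.comp (h0.comp tendsto_discToQuadrant_zero)
      have hv : quadrantToDisc 0 = -1 := by
        rw [quadrantToDisc]
        simp
      rwa [hv] at h2
    · refine ⟨by simp, ?_⟩
      have hne : (1 : ℂ) ^ 2 + Complex.I ≠ 0 := fun h => by
        have := congrArg Complex.re h; simp at this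
      have hc : ContinuousAt quadrantToDisc 1 :=
        ContinuousAt.div (by fun_prop) (by fun_prop) hne
      have h2 := hc.tendsto.comp (h1.comp tendsto_discToQuadrant_one)
      have hv : quadrantToDisc 1 = -Complex.I := by
        rw [quadrantToDisc, div_eq_iff hne, mul_add, neg_mul, neg_mul, Complex.I_mul_I]; ring
      rwa [hv] at h2
    · refine ⟨by simp, ?_⟩
      refine tendsto_quadrantToDisc_infty.comp (tendsto_inf.2 ⟨hinf.comp
        tendsto_discToQuadrant_infty, tendsto_principal.2 ?_⟩)
      filter_upwards [self_mem_nhdsWithin] with w hw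
        using hbij.mapsTo (discToQuadrant_mem hw)

end Cayley

/-! ### Uniqueness of the normalized map -/

section Uniqueness

variable {k m : ℕ} {a L b : ℝ} {c : Fin (k + m + 1 + 1) → ℝ} {x : Fin (k + m + 1 + 1 + 1) → ℝ}
  {Φ ψ : ℂ → ℂ}

theorem isOpen_quadrant : IsOpen quadrant :=
  (isOpen_Ioi.preimage Complex.continuous_re).inter (isOpen_Ioi.preimage Complex.continuous_im)

/-- The corner `(k+m+2)π` is attained only at `s = 0`: the upper bound for `Re Φ` forces `s` to be
real, left of `0` the real part is smaller, and right of `0` the imaginary part is positive. -/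
theorem IsExtremal.eq_zero_of_apply_eq (h : IsExtremal k m a L c x) (hΦ : IsLift k a L c Φ)
    {s : ℂ} (hs : s ∈ closedStrip) (heq : Φ s = Φ 0) : s = 0 := by
  have hpi := Real.pi_pos
  have h0 := h.apply_zero hΦ
  have him : (Φ s).im = 0 := by rw [heq, h0, Complex.ofReal_im]
  have hre : (Φ s).re = (k + m + 2) * Real.pi := by
    rw [heq, h0, Complex.ofReal_re]; push_cast; ring
  have hsre : (2 * (m : ℝ) + 1) * s.im ≤ 0 := by linarith [h.re_le hΦ hs]
  have hsim : s.im = 0 := by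
    refine le_antisymm ?_ hs.1
    by_contra hcon
    have : 0 < (2 * (m : ℝ) + 1) * s.im := mul_pos (by positivity) (not_le.1 hcon)
    linarith
  obtain ⟨σ, rfl⟩ : ∃ σ : ℝ, s = σ := ⟨s.re, Complex.ext rfl (by simpa using hsim)⟩
  rcases lt_trichotomy σ 0 with hlt | heq | hgt
  · exfalso
    have h01 : x (Fin.castSucc (Fin.last _)) < 1 := by
      rw [← h.last]; exact h.strictMono (Fin.castSucc_lt_last _)
    obtain ⟨t, ht, ht1⟩ := exists_between (max_lt (Real.exp_lt_one_iff.2 hlt) h01)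
    have ht0 : 0 < t := (Real.exp_pos σ).trans_le ((le_max_left _ _).trans ht.le)
    have hf : x (Fin.succ (Fin.last _)) = 1 := h.last
    have hmem : t ∈ Ioo (x (Fin.castSucc (Fin.last _))) (x (Fin.succ (Fin.last _))) :=
      ⟨(le_max_right _ _).trans_lt ht, hf.symm ▸ ht1⟩
    have h1 := h.re_between hΦ (Fin.last _) (σ := Real.log t) (h.re_point hΦ _)
      ⟨Real.log_le_log (h.pos _) hmem.1.le, Real.log_le_log ht0 hmem.2.le⟩
    have h2 := h.abs_realError_lt _ hmem
    rw [Real.exp_log ht0] at h1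
    have h3 : Real.arccos ((-1) ^ ((Fin.last (k + m + 1) : Fin (k + m + 1 + 1)) : ℕ) *
        realError k L c t) < Real.pi := by
      refine lt_of_le_of_ne (Real.arccos_le_pi _) fun h4 => ?_
      rw [Real.arccos_eq_pi] at h4
      have h5 : |(-1 : ℝ) ^ ((Fin.last (k + m + 1) : Fin (k + m + 1 + 1)) : ℕ) *
          realError k L c t| < 1 := by
        rwa [abs_mul, abs_pow, abs_neg, abs_one, one_pow, one_mul]
      linarith [(abs_lt.1 h5).1]
    have hσt : σ ≤ Real.log t :=
      (Real.le_log_iff_exp_le ht0).2 ((le_max_left _ _).trans ht.le)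
    have h4 := h.monotone_re_real hΦ hσt
    simp only [hre, h1, Fin.val_last] at h4 h3
    push_cast at h4
    linarith
  · rw [heq, Complex.ofReal_zero]
  · exfalso
    have := (hΦ.sin_re_eq_zero (h.one_lt_abs_realError_right (Real.one_lt_exp_iff.2 hgt))).2
    linarith

/-- A function into the strip whose image under the lift has height tending to infinity runs to one
of the ends. -/
theorem IsLift.eventually_lt_abs_re {N : ℕ} {c : Fin N → ℝ} (hΦ : IsLift k a L c Φ)
    {l : Filter ℂ} {S : ℂ → ℂ} (hS : ∀ᶠ z in l, S z ∈ closedStrip)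
    (him : Tendsto (fun z => (Φ (S z)).im) l atTop) (M : ℝ) : ∀ᶠ z in l, M < |(S z).re| := by
  have hK : IsCompact (Icc (-M) M ×ℂ Icc 0 (Real.pi / 2)) := isCompact_Icc.reProdIm isCompact_Icc
  obtain ⟨T, hT⟩ := hK.exists_bound_of_continuousOn (f := fun s => (Φ s).im)
    (Complex.continuous_im.comp_continuousOn (hΦ.cont.mono fun s hs => hs.2))
  filter_upwards [hS, him.eventually (eventually_gt_atTop T)] with z hz hzT
  by_contra hcon
  have := hT (S z) ⟨abs_le.1 (not_lt.1 hcon), hz⟩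
  exact absurd ((le_abs_self _).trans this) (not_le.2 hzT)

/-- Unbounded height drives `S` out of every compact part of the strip. The right end is impossible,
because there `Re Φ + (2m+1) Im s` tends to `(k+m+2)π`, whereas `Re Φ < (k+1)π` and `Im s ≤ π/2`
keep it at least `π/2` below that. -/
theorem IsExtremal.tendsto_re_atBot (h : IsExtremal k m a L c x) (hΦ : IsLift k a L c Φ)
    {l : Filter ℂ} {S : ℂ → ℂ} (hS : ∀ᶠ z in l, S z ∈ closedStrip)
    (him : Tendsto (fun z => (Φ (S z)).im) l atTop)
    (hre : ∀ᶠ z in l, (Φ (S z)).re < Real.pi * (k + 1 : ℕ)) :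
    Tendsto (fun z => (S z).re) l atBot := by
  have hpi := Real.pi_pos
  obtain ⟨M₀, -, hM₀⟩ := hasBasis_rightEnd.mem_iff.1 ((h.tendsto_rightEnd hΦ).2.eventually
    (lt_mem_nhds (sub_lt_self _ (show 0 < Real.pi / 2 by positivity))))
  refine tendsto_atBot.2 fun M => ?_
  filter_upwards [hS, hre, hΦ.eventually_lt_abs_re hS him (max M₀ (-M))] with z hz hzr hzM
  rcases lt_abs.1 hzM with h1 | h1
  · exfalso
    have h2 : (k + m + 2) * Real.pi - Real.pi / 2 < (Φ (S z)).re + (2 * m + 1) * (S z).im :=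
      hM₀ ⟨(le_max_left _ _).trans h1.le, hz⟩
    have h3 : (2 * (m : ℝ) + 1) * (S z).im ≤ (2 * m + 1) * (Real.pi / 2) :=
      mul_le_mul_of_nonneg_left hz.2 (by positivity)
    push_cast at hzr
    linarith
  · have := (le_max_right M₀ (-M)).trans_lt h1
    linarith

theorem IsExtremal.tendsto_re_atTop (h : IsExtremal k m a L c x) (hΦ : IsLift k a L c Φ)
    {l : Filter ℂ} {S : ℂ → ℂ} (hS : ∀ᶠ z in l, S z ∈ closedStrip)
    (him : Tendsto (fun z => (Φ (S z)).im) l atTop)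
    (hre : ∀ᶠ z in l, Real.pi * (k + 1 : ℕ) < (Φ (S z)).re) :
    Tendsto (fun z => (S z).re) l atTop := by
  have hpi := Real.pi_pos
  obtain ⟨M₀, -, hM₀⟩ := hasBasis_leftEnd.mem_iff.1 ((h.tendsto_leftEnd hΦ).2.eventually
    (gt_mem_nhds (show 0 < Real.pi / 2 by positivity)))
  refine tendsto_atTop.2 fun M => ?_
  filter_upwards [hS, hre, hΦ.eventually_lt_abs_re hS him (max (-M₀) M)] with z hz hzr hzM
  rcases lt_abs.1 hzM with h1 | h1
  · exact (le_max_right _ _).trans h1.le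
  · exfalso
    have h0 := (le_max_left (-M₀) M).trans h1.le
    have h2 : (Φ (S z)).re - (2 * k + 1) * (S z).im < Real.pi / 2 :=
      hM₀ ⟨show (S z).re ≤ M₀ by linarith, hz⟩
    have h3 : (2 * (k : ℝ) + 1) * (S z).im ≤ (2 * k + 1) * (Real.pi / 2) :=
      mul_le_mul_of_nonneg_left hz.2 (by positivity)
    push_cast at hzr
    linarith

/-- The normalized conformal map is unique. -/
theorem IsExtremal.eqOn_of_isNormalizedMap (h : IsExtremal k m a L c x) (hΦ : IsLift k a L c Φ)
    (hb : 0 < b) (hbL : Real.cosh b = 1 / L) (hψ : IsNormalizedMap (k + 1) (m + 1) b ψ) :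
    EqOn ψ (fun z => Φ (Complex.log z)) quadrant := by
  have hφ := h.isNormalizedMap hΦ hb hbL
  obtain ⟨g, hinv, hgd, hgbij⟩ := exists_holomorphic_inverse isOpen_quadrant hφ.holo hφ.bij
  -- The transition map `g ∘ ψ`, with `g` the inverse of the known map, is an automorphism of the
  -- quadrant; it remains to see that it fixes `0`, `1` and `∞`.
  have hTbij : BijOn (g ∘ ψ) quadrant quadrant := hgbij.comp hψ.bij
  have hTd : DifferentiableOn ℂ (g ∘ ψ) quadrant := hgd.comp hψ.holo hψ.bij.mapsTo
  have hΦT : ∀ z ∈ quadrant, Φ (Complex.log ((g ∘ ψ) z)) = ψ z := fun z hz =>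
    hinv.2 (hψ.bij.mapsTo hz)
  have hS : ∀ z ∈ quadrant, Complex.log ((g ∘ ψ) z) ∈ closedStrip := fun z hz =>
    strip_subset_closedStrip (log_mem_strip (hTbij.mapsTo hz))
  have hexp : ∀ z ∈ quadrant, Complex.exp (Complex.log ((g ∘ ψ) z)) = (g ∘ ψ) z := fun z hz =>
    Complex.exp_log (ne_zero_of_mem_quadrant (hTbij.mapsTo hz))
  have hnorm : ∀ z ∈ quadrant, Real.exp (Complex.log ((g ∘ ψ) z)).re = ‖(g ∘ ψ) z‖ := fun z hz => by
    rw [← Complex.norm_exp, hexp z hz]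
  have hself : ∀ᶠ z in Bornology.cobounded ℂ ⊓ 𝓟 quadrant, z ∈ quadrant :=
    mem_inf_of_right (mem_principal_self _)
  have hself' : ∀ y : ℂ, ∀ᶠ z in 𝓝[quadrant] y, z ∈ quadrant := fun y => self_mem_nhdsWithin
  have hT0 : Tendsto (g ∘ ψ) (𝓝[quadrant] 0) (𝓝 0) := by
    rw [tendsto_zero_iff_norm_tendsto_zero]
    have h1 := h.tendsto_re_atBot hΦ (S := fun z => Complex.log ((g ∘ ψ) z))
      ((hself' 0).mono hS)
      (hψ.zero_im.congr' ((hself' 0).mono fun z hz => by simp only [hΦT z hz]))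
      (by filter_upwards [hψ.zero_left, hself' 0] with z hz hzq; rwa [hΦT z hzq])
    exact (Real.tendsto_exp_comp_nhds_zero.2 h1).congr' ((hself' 0).mono hnorm)
  have hTinf : Tendsto (g ∘ ψ) (Bornology.cobounded ℂ ⊓ 𝓟 quadrant) (Bornology.cobounded ℂ) := by
    rw [← tendsto_norm_atTop_iff_cobounded]
    have h1 := h.tendsto_re_atTop hΦ (S := fun z => Complex.log ((g ∘ ψ) z))
      (hself.mono hS)
      (hψ.infty_im.congr' (hself.mono fun z hz => by simp only [hΦT z hz]))
      (by filter_upwards [hψ.infty_right, hself] with z hz hzq; rwa [hΦT z hzq])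
    exact (Real.tendsto_exp_atTop.comp h1).congr' (hself.mono hnorm)
  have hT1 : Tendsto (g ∘ ψ) (𝓝[quadrant] 1) (𝓝 1) := by
    have hψ1 : Tendsto ψ (𝓝[quadrant] 1) (𝓝 (Φ 0)) := by
      rw [h.apply_zero hΦ]; exact hψ.one
    -- Bounded height keeps the logarithms in a compact set, and any cluster point is sent by `Φ` to
    -- the corner, hence is `0`.
    have hS0 : Tendsto (fun z => Complex.log ((g ∘ ψ) z)) (𝓝[quadrant] 1) (𝓝 0) := by
      obtain ⟨K, hKs, hK, hmem⟩ := h.exists_compact hΦ 1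
      refine hK.tendsto_nhds_of_unique_mapClusterPt ?_ fun s hs hcl => ?_
      · have him : Tendsto (fun z => (ψ z).im) (𝓝[quadrant] 1) (𝓝 0) := by
          have := (Complex.continuous_im.tendsto _).comp hψ.one
          rwa [Complex.ofReal_im] at this
        filter_upwards [him.eventually (gt_mem_nhds one_pos), hself' 1] with z hz hzq
        exact hmem _ (hS z hzq) (by rw [hΦT z hzq]; exact hz.le)
      · refine h.eq_zero_of_apply_eq hΦ (hKs hs) ?_
        obtain ⟨u, hu, hus⟩ := mapClusterPt_iff_ultrafilter.1 hcl
        have hmemu : ∀ᶠ z in (u : Filter ℂ), z ∈ quadrant := hu (hself' 1)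
        have h1 : Tendsto (fun z => Φ (Complex.log ((g ∘ ψ) z))) u (𝓝 (Φ s)) :=
          (hΦ.cont s (hKs hs)).tendsto.comp (tendsto_nhdsWithin_iff.2 ⟨hus, hmemu.mono hS⟩)
        exact tendsto_nhds_unique h1
          ((hψ1.mono_left hu).congr' (hmemu.mono fun z hz => (hΦT z hz).symm))
    have h1 := (Complex.continuous_exp.tendsto 0).comp hS0
    rw [Complex.exp_zero] at h1
    exact h1.congr' ((hself' 1).mono hexp)
  intro z hz
  have h1 := eqOn_id_of_bijOn_quadrant hTd hTbij hT0 hT1 hTinf hz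
  have h2 := hΦT z hz
  rw [h1] at h2
  exact h2.symm

end Uniqueness

/-! ### The best error as a function of `a` -/

section ErrorFunction

variable {k m N : ℕ}

/-- The numerator of an odd Laurent polynomial, as a polynomial in `x²`. -/
def numerator (c : Fin N → ℝ) : Polynomial ℝ := ∑ j, Polynomial.C (c j) * Polynomial.X ^ (j : ℕ)

theorem oddLaurent_eq_eval (c : Fin N → ℝ) (x : ℝ) :
    oddLaurent k c x = (numerator c).eval (x ^ 2) / x ^ (2 * k + 1) := by
  rw [oddLaurent_eq_div, numerator, Polynomial.eval_finsetSum]; simp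

/-- No odd Laurent polynomial approximates `1` on `(0, 1]` with an error smaller than `1`. -/
theorem one_le_of_forall_abs_le {c : Fin N → ℝ} {M : ℝ}
    (h : ∀ x ∈ Ioc (0 : ℝ) 1, |1 - oddLaurent k c x| ≤ M) : 1 ≤ M := by
  by_contra hM
  push Not at hM
  have hbd : ∀ x ∈ Ioc (0 : ℝ) 1, |oddLaurent k c x| ≤ 2 ∧ 1 - M ≤ oddLaurent k c x := by
    intro x hx
    have h1 := abs_le.1 (h x hx)
    exact ⟨abs_le.2 ⟨by linarith, by linarith⟩, by linarith⟩
  have hmem : ∀ᶠ x in 𝓝[>] (0 : ℝ), x ∈ Ioc (0 : ℝ) 1 := Ioc_mem_nhdsGT one_pos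
  have hid : Tendsto (fun x : ℝ => x) (𝓝[>] 0) (𝓝 0) := tendsto_id.mono_left nhdsWithin_le_nhds
  have hp0 : numerator c ≠ 0 := by
    intro h0
    have := (hbd 1 ⟨one_pos, le_rfl⟩).2
    rw [oddLaurent_eq_eval, h0] at this
    simp at this
    linarith
  -- With the largest power of `x²` split off, `f = x^{2n-2k-1} q(x²)` and `q(0) ≠ 0`. The exponent
  -- is odd, hence nonzero, so `f` tends to `0` or is unbounded at `0`; both contradict the bounds
  -- `1 - M ≤ f ≤ 2`.
  obtain ⟨q, hq, hndvd⟩ := Polynomial.exists_eq_pow_rootMultiplicity_mul_and_not_dvd _ hp0 0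
  generalize (numerator c).rootMultiplicity 0 = n at hq
  have hq0 : q.eval 0 ≠ 0 := fun h0 => hndvd (Polynomial.dvd_iff_isRoot.2 h0)
  have hform : ∀ x : ℝ, oddLaurent k c x = (x ^ 2) ^ n * q.eval (x ^ 2) / x ^ (2 * k + 1) := by
    intro x
    rw [oddLaurent_eq_eval, hq]
    simp
  have hqlim : Tendsto (fun x : ℝ => q.eval (x ^ 2)) (𝓝[>] 0) (𝓝 (q.eval 0)) := by
    have hc : Continuous fun x : ℝ => q.eval (x ^ 2) := by fun_prop
    simpa using (hc.tendsto 0).mono_left (nhdsWithin_le_nhds (s := Ioi 0))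
  rcases Nat.lt_or_ge k n with hkn | hkn
  · obtain ⟨i, rfl⟩ := Nat.exists_eq_add_of_lt hkn
    have hlim : Tendsto (fun x : ℝ => x ^ (2 * i + 1) * q.eval (x ^ 2)) (𝓝[>] 0)
        (𝓝 (0 ^ (2 * i + 1) * q.eval 0)) := (hid.pow _).mul hqlim
    rw [zero_pow (by omega), zero_mul] at hlim
    have h1 : 1 - M ≤ 0 := by
      refine ge_of_tendsto hlim ?_
      filter_upwards [hmem] with x hx
      have h2 := (hbd x hx).2
      have hx0 := hx.1.ne'
      rw [hform x] at h2
      refine h2.trans_eq (Eq.symm ?_)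
      rw [eq_div_iff (pow_ne_zero _ hx0), ← pow_mul]
      ring
    linarith
  · obtain ⟨i, rfl⟩ := Nat.exists_eq_add_of_le hkn
    have hlim : Tendsto (fun x : ℝ => q.eval (x ^ 2)) (𝓝[>] 0) (𝓝 0) := by
      refine squeeze_zero_norm' (a := fun x : ℝ => 2 * x ^ (2 * i + 1)) ?_ ?_
      · filter_upwards [hmem] with x hx
        have hx0 := hx.1.ne'
        have h2 : q.eval (x ^ 2) = oddLaurent (n + i) c x * x ^ (2 * i + 1) := by
          rw [hform x, div_mul_eq_mul_div, eq_div_iff (pow_ne_zero _ hx0), ← pow_mul]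
          ring
        rw [h2, norm_mul, Real.norm_eq_abs, Real.norm_eq_abs, abs_of_pos (pow_pos hx.1 _)]
        exact mul_le_mul_of_nonneg_right (hbd x hx).1 (pow_pos hx.1 _).le
      · have := (hid.pow (2 * i + 1)).const_mul 2
        rwa [zero_pow (by omega), mul_zero] at this
    exact hq0 (tendsto_nhds_unique hqlim hlim)

/-- Otherwise an even polynomial would equal `X^{2k+1}`. -/
theorem exists_oddLaurent_ne_one (c : Fin N → ℝ) {a : ℝ} (ha : 0 < a) (ha1 : a < 1) :
    ∃ x ∈ Icc a 1, oddLaurent k c x ≠ 1 := by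
  by_contra hcon
  push Not at hcon
  have heq : (numerator c).comp (Polynomial.X ^ 2) = Polynomial.X ^ (2 * k + 1) := by
    refine Polynomial.eq_of_infinite_eval_eq _ _ ((Icc_infinite ha1).mono fun x hx => ?_)
    have h1 := hcon x hx
    have hx0 : x ≠ 0 := (ha.trans_le hx.1).ne'
    rw [oddLaurent_eq_eval, div_eq_one_iff_eq (pow_ne_zero _ hx0)] at h1
    simpa using h1
  have h1 := congrArg (Polynomial.eval 1) heq
  have h2 := congrArg (Polynomial.eval (-1)) heq
  have h3 : (-1 : ℝ) ^ (2 * k + 1) = -1 := Odd.neg_one_pow ⟨k, rfl⟩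
  simp only [Polynomial.eval_comp, Polynomial.eval_pow, Polynomial.eval_X, one_pow, neg_sq,
    h3] at h1 h2
  linarith

theorem oddLaurent_single (k m : ℕ) (x : ℝ) :
    oddLaurent k (Pi.single (⟨k + 1, by omega⟩ : Fin (k + m + 1 + 1)) 1) x = x := by
  rcases eq_or_ne x 0 with rfl | hx
  · simp [oddLaurent]
  · rw [oddLaurent, Finset.sum_eq_single (⟨k + 1, by omega⟩ : Fin (k + m + 1 + 1))]
    · rw [Pi.single_eq_same, one_mul, div_eq_iff (pow_ne_zero _ hx), ← pow_mul]
      ring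
    · intro j _ hj; rw [Pi.single_eq_of_ne hj, zero_mul]
    · simp

variable {a a' L L' M : ℝ} {c c' : Fin (k + m + 1 + 1) → ℝ}

theorem IsBest.pos {c : Fin N → ℝ} (h : IsBest k a M c) (ha : 0 < a) (ha1 : a < 1) : 0 < M := by
  obtain ⟨x, hx, hne⟩ := exists_oddLaurent_ne_one (k := k) c ha ha1
  exact (abs_pos.2 (sub_ne_zero.2 (Ne.symm hne))).trans_le (h.1 x hx)

/-- The competitor `f(x) = x` has error `1 - a`. -/
theorem IsBest.le_one_sub (h : IsBest k a M c) : M ≤ 1 - a := by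
  obtain ⟨x, hx, hMx⟩ := h.2 (Pi.single (⟨k + 1, by omega⟩ : Fin (k + m + 1 + 1)) 1)
  rw [oddLaurent_single, abs_of_nonneg (by linarith [hx.2])] at hMx
  linarith [hx.1]

/-- `c` is the best approximation of `1` on `[a, 1]`, its error is `L`, and `x` are its alternation
points. -/
structure IsSolution (k m : ℕ) (a L : ℝ) (c : Fin (k + m + 1 + 1) → ℝ)
    (x w : Fin (k + m + 1 + 1 + 1) → ℝ) : Prop where
  best : IsBest k a L c
  certificate : IsCertificate k a L c x w
  extremal : IsExtremal k m a L c x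

theorem exists_isSolution (k m : ℕ) (ha : a ∈ Ioo (0 : ℝ) 1) :
    ∃ L c x w, IsSolution k m a L c x w := by
  obtain ⟨L, c, hc⟩ := exists_isBest k (k + m + 1 + 1) ha.1 ha.2
  have hL := hc.pos ha.1 ha.2
  obtain ⟨x, w, hx⟩ := hc.exists_isCertificate ha.1 hL
  exact ⟨L, c, x, w, hc, hx, hx.isExtremal ha.1 hL (by linarith [hc.le_one_sub, ha.1]) hc.1⟩

theorem IsBest.le_of_forall {c c' : Fin N → ℝ} (h : IsBest k a M c)
    (hle : ∀ y ∈ Icc a 1, |1 - oddLaurent k c' y| ≤ L) : M ≤ L := by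
  obtain ⟨y, hy, hMy⟩ := h.2 c'
  exact hMy.trans (hle y hy)

variable {x w x' w' : Fin (k + m + 1 + 1 + 1) → ℝ}

/-- Restriction to the shorter interval gives the weak inequality. With equal errors, uniqueness
would give the same function on both intervals; then `a'` would be an interior extremal point of the
longer one, so the derivative would vanish there, which is impossible at the left endpoint of the
shorter one. -/
theorem IsSolution.lt_of_lt (h : IsSolution k m a L c x w) (h' : IsSolution k m a' L' c' x' w')
    (hlt : a < a') : L' < L := by
  have ha := h.extremal.a_pos
  have ha' := h'.extremal.a_pos
  have hres : ∀ y ∈ Icc a' 1, |1 - oddLaurent k c y| ≤ L := fun y hy =>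
    h.best.1 y ⟨hlt.le.trans hy.1, hy.2⟩
  refine lt_of_le_of_ne (h'.best.le_of_forall hres) fun heq => ?_
  subst heq
  have hcc : c = c' := h'.certificate.coeff_eq ha' fun i => hres _ (h'.certificate.mem i)
  subst hcc
  have h1 : |1 - oddLaurent k c a'| = L' := by
    rw [← h'.extremal.first]; exact h'.certificate.extremal 0
  have ha1 : a' < 1 := by
    rw [← h'.extremal.first, ← h'.extremal.last]; exact h'.extremal.strictMono (Fin.last_pos)
  have h2 := eulerCoeff_root_of_extremal h.extremal.L_pos ha h.best.1 ⟨hlt, ha1⟩ h1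
  have h3 := h'.extremal.deriv_left a' ⟨ha', le_rfl⟩
  rw [h2, mul_zero] at h3
  exact lt_irrefl _ h3

theorem IsSolution.lt_one (h : IsSolution k m a L c x w) : a < 1 := by
  rw [← h.extremal.first, ← h.extremal.last]; exact h.extremal.strictMono (Fin.last_pos)

theorem IsSolution.lt_iff_lt (h : IsSolution k m a L c x w) (h' : IsSolution k m a' L' c' x' w') :
    L' < L ↔ a < a' := by
  refine ⟨fun hlt => ?_, h.lt_of_lt h'⟩
  rcases lt_trichotomy a a' with h1 | rfl | h1
  · exact h1
  · exact absurd (h.best.le_of_forall h'.best.1) (not_le.2 hlt)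
  · exact absurd (h'.lt_of_lt h h1) (not_lt.2 hlt.le)

theorem IsSolution.eq_iff_eq (h : IsSolution k m a L c x w) (h' : IsSolution k m a' L' c' x' w') :
    L = L' ↔ a = a' := by
  have h1 := h.lt_iff_lt h'
  have h2 := h'.lt_iff_lt h
  constructor
  · rintro rfl
    exact le_antisymm (not_lt.1 fun h3 => lt_irrefl _ (h2.2 h3))
      (not_lt.1 fun h3 => lt_irrefl _ (h1.2 h3))
  · rintro rfl
    exact le_antisymm (not_lt.1 fun h3 => lt_irrefl _ (h1.1 h3))
      (not_lt.1 fun h3 => lt_irrefl _ (h2.1 h3))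

/-- Every number in `(0, 1)` is the error of the best approximation for some `a`. -/
theorem exists_isSolution_of_error (k m : ℕ) {t : ℝ} (ht : t ∈ Ioo (0 : ℝ) 1) :
    ∃ a c x w, IsSolution k m a t c x w := by
  let S : Set ℝ := {a | a ∈ Ioo (0 : ℝ) 1 ∧
    ∃ c : Fin (k + m + 1 + 1) → ℝ, ∀ y ∈ Icc a 1, |1 - oddLaurent k c y| ≤ t}
  have hne : S.Nonempty := by
    refine ⟨1 - t, ⟨by linarith [ht.2], by linarith [ht.1]⟩,
      Pi.single (⟨k + 1, by omega⟩ : Fin (k + m + 1 + 1)) 1, fun y hy => ?_⟩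
    rw [oddLaurent_single, abs_of_nonneg (by linarith [hy.2])]
    linarith [hy.1]
  have hbdd : BddBelow S := ⟨0, fun y hy => hy.1.1.le⟩
  set a := sInf S with ha
  have ha0 : 0 ≤ a := le_csInf hne fun y hy => hy.1.1.le
  have ha1 : a < 1 := by
    obtain ⟨y, hy⟩ := hne
    exact (csInf_le hbdd hy).trans_lt hy.1.2
  obtain ⟨u, -, hu, huS⟩ := exists_seq_tendsto_sInf hne hbdd
  choose hmem cs hcs using huS
  obtain ⟨c', hc'⟩ := exists_limit_coeff ha0 ha1 hu (tendsto_const_nhds (x := t)) cs hcs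
  -- If the infimum were `0`, the limiting function would approximate `1` on all of `(0, 1]` with
  -- error below `1`.
  have hapos : 0 < a := by
    refine lt_of_le_of_ne ha0 fun h0 => ?_
    rw [← h0] at hc'
    exact absurd (one_le_of_forall_abs_le hc') (not_le.2 ht.2)
  have hcl : ∀ y ∈ Icc a 1, |1 - oddLaurent k c' y| ≤ t := by
    intro y hy
    rw [← closure_Ioc ha1.ne] at hy
    refine le_on_closure (g := fun _ => t) hc' ?_ continuousOn_const hy
    rw [closure_Ioc ha1.ne]
    exact (continuousOn_const.sub (continuousOn_oddLaurent_Icc hapos c')).abs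
  -- The best error at the infimum is at most `t`. If it were smaller, continuity at `a` would keep
  -- the error below `t` slightly to the left, contradicting the infimum.
  obtain ⟨L, c, x, w, hsol⟩ := exists_isSolution k m ⟨hapos, ha1⟩
  have hLt : L ≤ t := hsol.best.le_of_forall hcl
  rcases hLt.eq_or_lt with rfl | hlt
  · exact ⟨a, c, x, w, hsol⟩
  exfalso
  have hcont : ContinuousAt (fun y => |1 - oddLaurent k c y|) a :=
    (continuousAt_const.sub ((continuousOn_oddLaurent c).continuousAt (Ioi_mem_nhds hapos))).abs
  have hev : ∀ᶠ y in 𝓝 a, |1 - oddLaurent k c y| < t :=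
    hcont.eventually (gt_mem_nhds ((hsol.best.1 a ⟨le_rfl, ha1.le⟩).trans_lt hlt))
  obtain ⟨l, hl, hlt'⟩ := (exists_Ioc_subset_of_mem_nhds hev ⟨0, hapos⟩)
  obtain ⟨a', ha', ha''⟩ := exists_between (max_lt hl hapos)
  have hmem' : a' ∈ S := by
    refine ⟨⟨(le_max_right _ _).trans_lt ha', ha''.trans ha1⟩, c, fun y hy => ?_⟩
    rcases le_or_gt y a with h1 | h1
    · exact le_of_lt (hlt' ⟨((le_max_left _ _).trans_lt ha').trans_le hy.1, h1⟩)
    · exact (hsol.best.1 y ⟨h1.le, hy.2⟩).trans hlt.le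
  exact absurd (csInf_le hbdd hmem') (not_le.2 ha'')

end ErrorFunction

/-! ### From general approximants to odd ones -/

section Approximants

variable {k m : ℕ}

/-- The coefficients of the odd powers. -/
def oddCoeff (k m : ℕ) (c : ℤ → ℝ) (i : Fin (k + m + 1 + 1)) : ℝ := c (2 * (i : ℤ) - (2 * k + 1))

/-- The coefficients of the even powers, with exponents raised by one. -/
def evenCoeff (k m : ℕ) (c : ℤ → ℝ) (i : Fin (k + m + 1 + 1)) : ℝ :=
  -- The slot `i = 0` would stand for the exponent `-(2k+2)`, which does not occur.
  if i = 0 then 0 else c (2 * (i : ℤ) - (2 * k + 2))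

/-- The exponents that occur in the approximating functions. -/
def exponents (k m : ℕ) : Finset ℤ :=
  Finset.Icc (-(2 * ((k + 1 : ℕ) : ℤ) - 1)) (2 * ((m + 1 : ℕ) : ℤ) - 1)

theorem mem_exponents {j : ℤ} : j ∈ exponents k m ↔ -(2 * k + 1) ≤ j ∧ j ≤ 2 * m + 1 := by
  rw [exponents, Finset.mem_Icc]; push_cast; constructor <;> rintro ⟨h1, h2⟩ <;> constructor <;> omega

theorem exponent_cases {j : ℤ} (hj : j ∈ exponents k m) :
    (∃ i : Fin (k + m + 1 + 1), j = 2 * (i : ℤ) - (2 * k + 1)) ∨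
      ∃ i : Fin (k + m + 1 + 1), i ≠ 0 ∧ j = 2 * (i : ℤ) - (2 * k + 2) := by
  rw [mem_exponents] at hj
  rcases Int.even_or_odd' j with ⟨l, hl | hl⟩
  · right
    refine ⟨⟨(l + k + 1).toNat, by omega⟩, fun h0 => ?_, ?_⟩
    · have := congrArg Fin.val h0
      simp at this
      omega
    · simp only; omega
  · left
    refine ⟨⟨(l + k + 1).toNat, by omega⟩, ?_⟩
    simp only; omega

theorem zpow_odd_exponent {x : ℝ} (i : ℕ) :
    x ^ (2 * (i : ℤ) - (2 * k + 1)) = (x ^ 2) ^ i / x ^ (2 * k + 1) := by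
  rcases eq_or_ne x 0 with rfl | hx
  · rw [zero_zpow _ (by omega), zero_pow (n := 2 * k + 1) (by omega), div_zero]
  · rw [zpow_sub₀ hx, ← pow_mul]
    norm_cast

theorem sum_exponents_eq (c : ℤ → ℝ) {x : ℝ} (hx : x ≠ 0) :
    ∑ j ∈ exponents k m, c j * x ^ j =
      oddLaurent k (oddCoeff k m c) x + oddLaurent k (evenCoeff k m c) x / x := by
  have hodd : oddLaurent k (oddCoeff k m c) x =
      ∑ j ∈ exponents k m with Odd j, c j * x ^ j := by
    rw [oddLaurent]
    refine Finset.sum_of_injOn (fun i : Fin (k + m + 1 + 1) => 2 * (i : ℤ) - (2 * k + 1))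
      ?_ ?_ ?_ ?_
    · intro i _ i' _ h
      simp only at h
      exact Fin.ext (by omega)
    · intro i _
      have := i.2
      simp only [Finset.coe_filter, mem_ofPred_eq, mem_exponents]
      refine ⟨⟨by omega, by omega⟩, (i : ℤ) - k - 1, by ring⟩
    · intro j hj hj'
      rw [Finset.mem_filter] at hj
      rcases exponent_cases hj.1 with ⟨i, hi⟩ | ⟨i, -, hi⟩
      · exact absurd ⟨i, by simp, hi.symm⟩ hj'
      · obtain ⟨l, hl⟩ := hj.2; omega
    · intro i _
      simp only [oddCoeff, zpow_odd_exponent]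
  have heven : oddLaurent k (evenCoeff k m c) x / x =
      ∑ j ∈ exponents k m with ¬ Odd j, c j * x ^ j := by
    rw [oddLaurent, Finset.sum_div,
      ← Finset.sum_filter_of_ne (p := fun i : Fin (k + m + 1 + 1) => i ≠ 0)]
    · refine Finset.sum_of_injOn (fun i : Fin (k + m + 1 + 1) => 2 * (i : ℤ) - (2 * k + 2))
        ?_ ?_ ?_ ?_
      · intro i _ i' _ h
        simp only at h
        exact Fin.ext (by omega)
      · intro i hi
        have := i.2
        have hi0 : (i : ℕ) ≠ 0 := fun h => by
          simp at hi
          exact hi (Fin.ext h)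
        simp only [Finset.coe_filter, mem_ofPred_eq, mem_exponents]
        refine ⟨⟨by omega, by omega⟩, ?_⟩
        rw [Int.not_odd_iff_even]
        exact ⟨(i : ℤ) - k - 1, by ring⟩
      · intro j hj hj'
        rw [Finset.mem_filter] at hj
        rcases exponent_cases hj.1 with ⟨i, hi⟩ | ⟨i, hi0, hi⟩
        · exact absurd ⟨(i : ℤ) - k - 1, by rw [hi]; ring⟩ hj.2
        · exact absurd ⟨i, by simpa using hi0, hi.symm⟩ hj'
      · intro i hi
        rw [Finset.mem_filter] at hi
        have h1 : x ^ (2 * (i : ℤ) - (2 * k + 2)) = x ^ (2 * (i : ℤ) - (2 * k + 1)) / x := by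
          rw [show 2 * (i : ℤ) - (2 * k + 2) = 2 * (i : ℤ) - (2 * k + 1) - 1 by ring,
            zpow_sub_one₀ hx, div_eq_mul_inv]
        simp only [evenCoeff, if_neg hi.2, h1, zpow_odd_exponent, mul_div_assoc]
    · intro i _ hne h0
      apply hne
      simp [evenCoeff, h0]
  rw [hodd, heven, Finset.sum_filter_add_sum_filter_not]

theorem oddLaurent_mem_approximants (c : Fin (k + m + 1 + 1) → ℝ) :
    oddLaurent k c ∈ approximants (k + 1) (m + 1) := by
  refine ⟨fun j => ∑ i : Fin (k + m + 1 + 1), if j = 2 * (i : ℤ) - (2 * k + 1) then c i else 0, ?_⟩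
  funext x
  change _ = ∑ j ∈ exponents k m, _
  simp only [Finset.sum_mul]
  rw [Finset.sum_comm, oddLaurent]
  refine Finset.sum_congr rfl fun i _ => ?_
  have hi : 2 * (i : ℤ) - (2 * k + 1) ∈ exponents k m := by
    have := i.2
    rw [mem_exponents]; constructor <;> omega
  rw [Finset.sum_eq_single_of_mem _ hi fun j _ hj => by rw [if_neg hj, zero_mul], if_pos rfl,
    zpow_odd_exponent]

variable {a L : ℝ} {c : Fin (k + m + 1 + 1) → ℝ} {x w : Fin (k + m + 1 + 1 + 1) → ℝ}

theorem isCompact_twoIntervals (a : ℝ) : IsCompact (twoIntervals a) := by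
  refine Metric.isCompact_of_isClosed_isBounded (isClosed_Icc.preimage continuous_abs) ?_
  refine (Metric.isBounded_Icc (-1 : ℝ) 1).subset fun y hy => ?_
  exact abs_le.1 hy.2

theorem bddAbove_deviation (ha : 0 < a) {g : ℝ → ℝ} (hg : g ∈ approximants (k + 1) (m + 1)) :
    BddAbove ((fun x : ℝ => |Real.sign x - g x|) '' twoIntervals a) := by
  obtain ⟨c, rfl⟩ := hg
  have hne : ∀ y ∈ twoIntervals a, y ≠ 0 := fun y hy h0 => by
    have := hy.1
    rw [h0, abs_zero] at this
    linarith
  have hcont : ContinuousOn (fun x : ℝ => ∑ j ∈ Finset.Icc (-(2 * ((k + 1 : ℕ) : ℤ) - 1))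
      (2 * ((m + 1 : ℕ) : ℤ) - 1), c j * x ^ j) (twoIntervals a) := by
    refine continuousOn_finsetSum _ fun j _ => continuousOn_const.mul fun y hy => ?_
    exact (continuousAt_zpow₀ y j (Or.inl (hne y hy))).continuousWithinAt
  obtain ⟨C, hC⟩ := (isCompact_twoIntervals a).exists_bound_of_continuousOn hcont
  refine ⟨1 + C, ?_⟩
  rintro _ ⟨y, hy, rfl⟩
  have h1 := hC y hy
  have h2 : |Real.sign y| ≤ 1 := by
    rcases Real.sign_apply_eq y with h | h | h <;> rw [h] <;> simp
  exact (abs_sub _ _).trans (add_le_add h2 h1)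

theorem abs_sign_sub_le_deviation (ha : 0 < a) {g : ℝ → ℝ}
    (hg : g ∈ approximants (k + 1) (m + 1)) {y : ℝ} (hy : |y| ∈ Icc a 1) :
    |Real.sign y - g y| ≤ deviation a g :=
  le_csSup (bddAbove_deviation ha hg) ⟨y, hy, rfl⟩

theorem abs_one_sub_le_deviation (ha : 0 < a) {g : ℝ → ℝ}
    (hg : g ∈ approximants (k + 1) (m + 1)) {y : ℝ} (hy : y ∈ Icc a 1) :
    |1 - g y| ≤ deviation a g ∧ |1 + g (-y)| ≤ deviation a g := by
  have hy0 : 0 < y := ha.trans_le hy.1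
  constructor
  · have := abs_sign_sub_le_deviation ha hg (y := y) (by rwa [abs_of_pos hy0])
    rwa [Real.sign_of_pos hy0] at this
  · have := abs_sign_sub_le_deviation ha hg (y := -y) (by rwa [abs_neg, abs_of_pos hy0])
    rw [Real.sign_of_neg (neg_neg_iff_pos.2 hy0), ← abs_neg] at this
    convert this using 2
    ring

theorem IsSolution.deviation_eq (h : IsSolution k m a L c x w) :
    deviation a (oddLaurent k c) = L := by
  have ha := h.extremal.a_pos
  have hmem : a ∈ Icc a 1 := ⟨le_rfl, h.lt_one.le⟩
  refine le_antisymm (csSup_le ⟨_, a, by rwa [twoIntervals, mem_ofPred_eq, abs_of_pos ha], rfl⟩ ?_) ?_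
  · rintro _ ⟨y, hy, rfl⟩
    have hy' : |y| ∈ Icc a 1 := hy
    rcases lt_trichotomy y 0 with h0 | h0 | h0
    · rw [abs_of_neg h0] at hy'
      have h1 := h.best.1 _ hy'
      have h2 : -1 - oddLaurent k c y = -(1 - oddLaurent k c (-y)) := by rw [oddLaurent_neg]; ring
      simp only [Real.sign_of_neg h0, h2, abs_neg]
      exact h1
    · rw [h0, abs_zero] at hy'
      linarith [hy'.1]
    · rw [abs_of_pos h0] at hy'
      simp only [Real.sign_of_pos h0]
      exact h.best.1 y hy'
  · have h1 := (abs_one_sub_le_deviation (k := k) (m := m) ha (oddLaurent_mem_approximants c)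
      hmem).1
    rw [← h.certificate.extremal 0, h.extremal.first]
    exact h1

/-- The average of the errors `1 - g(y)` and `1 + g(-y)` is the error of the odd part. -/
theorem IsSolution.le_deviation (h : IsSolution k m a L c x w) {g : ℝ → ℝ}
    (hg : g ∈ approximants (k + 1) (m + 1)) : L ≤ deviation a g := by
  have ha := h.extremal.a_pos
  have hg' := hg
  obtain ⟨d, hd⟩ := hg'
  refine h.best.le_of_forall (c' := oddCoeff k m d) fun y hy => ?_
  have hy0 : y ≠ 0 := (ha.trans_le hy.1).ne'
  obtain ⟨h1, h2⟩ := abs_one_sub_le_deviation ha hg hy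
  have e1 : g y = _ := (congrFun hd y).trans (sum_exponents_eq (k := k) (m := m) d hy0)
  have e2 : g (-y) = _ := (congrFun hd (-y)).trans
    (sum_exponents_eq (k := k) (m := m) d (neg_ne_zero.2 hy0))
  rw [oddLaurent_neg, oddLaurent_neg, neg_div_neg_eq] at e2
  have e3 : 1 - oddLaurent k (oddCoeff k m d) y = ((1 - g y) + (1 + g (-y))) / 2 := by
    rw [e1, e2]; ring
  rw [e3, abs_div, abs_two]
  have := abs_add_le (1 - g y) (1 + g (-y))
  linarith

theorem IsSolution.bestError_eq (h : IsSolution k m a L c x w) :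
    bestError (k + 1) (m + 1) a = L := by
  refine le_antisymm (csInf_le ⟨L, ?_⟩ ⟨_, oddLaurent_mem_approximants c, h.deviation_eq⟩)
    (le_csInf ⟨_, _, oddLaurent_mem_approximants c, rfl⟩ ?_)
  · rintro _ ⟨g, hg, rfl⟩; exact h.le_deviation hg
  · rintro _ ⟨g, hg, rfl⟩; exact h.le_deviation hg

/-- The odd part is optimal too, hence equals the solution. At the certifying points its error is
`±L`, and adding the even part at `y` and at `-y` leaves no room unless that part vanishes. It has
only `N` coefficients after a shift of exponents, so it is zero. -/
theorem IsSolution.eq_of_deviation_eq (h : IsSolution k m a L c x w) {g : ℝ → ℝ}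
    (hg : g ∈ approximants (k + 1) (m + 1)) (hdev : deviation a g = L) : g = oddLaurent k c := by
  have ha := h.extremal.a_pos
  have hg' := hg
  obtain ⟨d, hd⟩ := hg'
  have hpos : ∀ i, 0 < x i := h.extremal.pos
  have e1 : ∀ y ≠ 0, g y = oddLaurent k (oddCoeff k m d) y + oddLaurent k (evenCoeff k m d) y / y :=
    fun y hy => (congrFun hd y).trans (sum_exponents_eq (k := k) (m := m) d hy)
  have e2 : ∀ y ≠ 0,
      g (-y) = -oddLaurent k (oddCoeff k m d) y + oddLaurent k (evenCoeff k m d) y / y := by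
    intro y hy
    rw [e1 _ (neg_ne_zero.2 hy), oddLaurent_neg, oddLaurent_neg, neg_div_neg_eq]
  have hle : ∀ y ∈ Icc a 1, |1 - g y| ≤ L ∧ |1 + g (-y)| ≤ L := fun y hy =>
    hdev ▸ abs_one_sub_le_deviation ha hg hy
  have hodd : oddCoeff k m d = c := by
    refine h.certificate.coeff_eq ha fun i => ?_
    obtain ⟨h1, h2⟩ := hle _ (h.certificate.mem i)
    have e3 : 1 - oddLaurent k (oddCoeff k m d) (x i) = ((1 - g (x i)) + (1 + g (-(x i)))) / 2 := by
      rw [e1 _ (hpos i).ne', e2 _ (hpos i).ne']; ring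
    rw [e3, abs_div, abs_two]
    have := abs_add_le (1 - g (x i)) (1 + g (-(x i)))
    linarith
  have heven : evenCoeff k m d = 0 := by
    refine coeff_eq_zero_of_oddLaurent_eq_zero (k := k) (x := fun i => x (Fin.castSucc i))
      (h.extremal.strictMono.injective.comp (Fin.castSucc_injective _)) (fun i => hpos _)
      fun i => ?_
    obtain ⟨h1, h2⟩ := hle _ (h.certificate.mem i.castSucc)
    have h3 := h.certificate.extremal i.castSucc
    have hp := hpos i.castSucc
    set y := x i.castSucc
    rw [e1 y hp.ne', hodd] at h1
    rw [e2 y hp.ne', hodd] at h2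
    have h5 : oddLaurent k (evenCoeff k m d) y / y = 0 := by
      rw [abs_le] at h1 h2
      rcases (abs_eq h.extremal.L_pos.le).1 h3 with h4 | h4 <;> linarith
    exact (div_eq_zero_iff.1 h5).resolve_right hp.ne'
  -- Equality of functions includes the point `0`. There nonzero powers vanish, negative ones by
  -- convention, and the constant term belongs to the even part, which is zero.
  have hzero : ∀ j ∈ exponents k m, d j * (0 : ℝ) ^ j = 0 := by
    intro j hj
    rcases exponent_cases hj with ⟨i, hi⟩ | ⟨i, hi0, hi⟩
    · rw [zero_zpow _ (by omega), mul_zero]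
    · have := congrFun heven i
      rw [evenCoeff, if_neg hi0, ← hi] at this
      rw [this, Pi.zero_apply, zero_mul]
  funext y
  rcases eq_or_ne y 0 with rfl | h0
  · have h2 : oddLaurent k c 0 = 0 := by
      rw [oddLaurent_eq_div, zero_pow (n := 2 * k + 1) (by omega), div_zero]
    rw [congrFun hd 0, h2]
    exact Finset.sum_eq_zero hzero
  · rw [e1 y h0, hodd, heven]
    simp [oddLaurent]

end Approximants

/-! ### The correspondence between `B` and `a`, and the main theorem -/

theorem exists_cosh_eq {L : ℝ} (hL : L ∈ Ioo (0 : ℝ) 1) : ∃ b : ℝ, 0 < b ∧ Real.cosh b = 1 / L := by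
  have h1 : 1 < 1 / L := (one_lt_div hL.1).2 hL.2
  exact ⟨Real.arcosh (1 / L), Real.arcosh_pos h1, Real.cosh_arcosh h1.le⟩

/-- The boundary values of an arbitrary normalized map are those of the lift. -/
theorem IsExtremal.hasBoundaryValue {k m : ℕ} {a L b : ℝ} {c : Fin (k + m + 1 + 1) → ℝ}
    {x : Fin (k + m + 1 + 1 + 1) → ℝ} {Φ φ : ℂ → ℂ} (h : IsExtremal k m a L c x)
    (hΦ : IsLift k a L c Φ) (hb : 0 < b) (hbL : Real.cosh b = 1 / L)
    (hφ : IsNormalizedMap (k + 1) (m + 1) b φ) {y : ℝ} (hy : 0 < y) :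
    HasBoundaryValue φ y (Φ (Real.log y)) := by
  refine (hΦ.hasBoundaryValue hy).congr' ?_
  filter_upwards [self_mem_nhdsWithin] with z hz
    using (h.eqOn_of_isNormalizedMap hΦ hb hbL hφ hz).symm

end SgnApprox

end

theorem mainTheorem2 (k m : ℕ) (hk : 1 ≤ k) (hm : 1 ≤ m) :
    ∃ A B : ℝ → ℝ,
      -- for each `b > 0` the normalized conformal map exists and is unique, and `A b` is the
      -- point of the positive half-axis that it sends to `0`
      (∀ b : ℝ, 0 < b →
        (∃ φ : ℂ → ℂ, SgnApprox.IsNormalizedMap k m b φ) ∧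
        (∀ φ ψ : ℂ → ℂ, SgnApprox.IsNormalizedMap k m b φ → SgnApprox.IsNormalizedMap k m b ψ →
          Set.EqOn φ ψ SgnApprox.quadrant) ∧
        A b ∈ Set.Ioo (0 : ℝ) 1 ∧
        (∀ φ : ℂ → ℂ, SgnApprox.IsNormalizedMap k m b φ →
          ∀ x : ℝ, 0 < x → (SgnApprox.HasBoundaryValue φ x 0 ↔ x = A b))) ∧
      ContinuousOn A (Set.Ioi 0) ∧ StrictMonoOn A (Set.Ioi 0) ∧
      Filter.Tendsto A (nhdsWithin 0 (Set.Ioi 0)) (nhds 0) ∧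
      Filter.Tendsto A Filter.atTop (nhds 1) ∧
      -- `B` is the inverse function of `A`
      (∀ a ∈ Set.Ioo (0 : ℝ) 1, 0 < B a ∧ A (B a) = a) ∧
      -- the error of the best approximation and the extremal function
      (∀ a ∈ Set.Ioo (0 : ℝ) 1,
        SgnApprox.bestError k m a = 1 / Real.cosh (B a) ∧
        ∃ f ∈ SgnApprox.approximants k m,
          SgnApprox.deviation a f = SgnApprox.bestError k m a ∧
          (∀ g ∈ SgnApprox.approximants k m,
            SgnApprox.deviation a g = SgnApprox.bestError k m a → g = f) ∧
          (∀ x : ℝ, f (-x) = -f x) ∧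
          ∀ φ : ℂ → ℂ, SgnApprox.IsNormalizedMap k m (B a) φ →
            ∀ x : ℝ, 0 < x → ∃ w : ℂ, SgnApprox.HasBoundaryValue φ x w ∧
              (f x : ℂ) = 1 - (-1) ^ k * (SgnApprox.bestError k m a : ℂ) * Complex.cos w) := by
  open SgnApprox in
  obtain ⟨k, rfl⟩ := Nat.exists_eq_add_of_le' hk
  obtain ⟨m, rfl⟩ := Nat.exists_eq_add_of_le' hm
  have hexA : ∀ b : ℝ, 0 < b → ∃ a c x w, IsSolution k m a (1 / Real.cosh b) c x w := fun b hb =>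
    exists_isSolution_of_error k m ⟨one_div_pos.2 (Real.cosh_pos b),
      (div_lt_one (Real.cosh_pos b)).2 (Real.one_lt_cosh.2 hb.ne')⟩
  have hexB : ∀ a : ℝ, a ∈ Ioo (0 : ℝ) 1 →
      ∃ b, 0 < b ∧ ∃ c x w, IsSolution k m a (1 / Real.cosh b) c x w := by
    intro a ha
    obtain ⟨L, c, x, w, h⟩ := exists_isSolution k m ha
    obtain ⟨b, hb, hbL⟩ := exists_cosh_eq ⟨h.extremal.L_pos, h.extremal.L_lt_one⟩
    exact ⟨b, hb, c, x, w, by rwa [hbL, one_div_one_div]⟩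
  -- `A b` is the left endpoint for which the best error is `1 / cosh b`; `B a` reads the same
  -- relation backwards.
  choose! A hA using hexA
  choose! B hBpos hB using hexB
  have hAmem : ∀ b, 0 < b → A b ∈ Ioo (0 : ℝ) 1 := by
    intro b hb
    obtain ⟨c, x, w, h⟩ := hA b hb
    exact ⟨h.extremal.a_pos, h.lt_one⟩
  have hmono : StrictMonoOn A (Ioi 0) := by
    intro b hb b' hb' hlt
    obtain ⟨c, x, w, h⟩ := hA b hb
    obtain ⟨c', x', w', h'⟩ := hA b' hb'
    refine (h.lt_iff_lt h').1 (one_div_lt_one_div_of_lt (Real.cosh_pos b) (Real.cosh_lt_cosh.2 ?_))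
    rwa [abs_of_pos hb, abs_of_pos hb']
  have hAB : ∀ a ∈ Ioo (0 : ℝ) 1, A (B a) = a := by
    intro a ha
    obtain ⟨c, x, w, h⟩ := hA (B a) (hBpos a ha)
    obtain ⟨c', x', w', h'⟩ := hB a ha
    exact (h.eq_iff_eq h').1 rfl
  have himage : A '' Ioi 0 = Ioo 0 1 :=
    Subset.antisymm (by rintro _ ⟨b, hb, rfl⟩; exact hAmem b hb)
      fun a ha => ⟨B a, hBpos a ha, hAB a ha⟩
  refine ⟨A, B, fun b hb => ?_, ?_, hmono, ?_, ?_, fun a ha => ⟨hBpos a ha, hAB a ha⟩,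
    fun a ha => ?_⟩
  · obtain ⟨c, x, w, h⟩ := hA b hb
    have hbL : Real.cosh b = 1 / (1 / Real.cosh b) := (one_div_one_div _).symm
    obtain ⟨Φ, hΦ⟩ := h.extremal.exists_isLift
    refine ⟨⟨_, h.extremal.isNormalizedMap hΦ hb hbL⟩, fun φ ψ hφ hψ => ?_, hAmem b hb,
      fun φ hφ y hy => ?_⟩
    · exact (h.extremal.eqOn_of_isNormalizedMap hΦ hb hbL hφ).trans
        (h.extremal.eqOn_of_isNormalizedMap hΦ hb hbL hψ).symm
    · have h1 := h.extremal.hasBoundaryValue hΦ hb hbL hφ hy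
      rw [← h.extremal.apply_log_eq_zero_iff hΦ hy]
      have : Fact (0 < y) := ⟨hy⟩
      exact ⟨fun h2 => tendsto_nhds_unique h1 h2, fun h2 => h2 ▸ h1⟩
  · intro b hb
    -- A monotone function whose image is the open interval `(0, 1)` has no jumps.
    refine (hmono.continuousAt_of_image_mem_nhds (Ioi_mem_nhds hb) ?_).continuousWithinAt
    rw [himage]
    exact Ioo_mem_nhds (hAmem b hb).1 (hAmem b hb).2
  · rw [tendsto_order]
    refine ⟨fun l hl => ?_, fun u hu => ?_⟩
    · filter_upwards [self_mem_nhdsWithin] with b hb using hl.trans (hAmem b hb).1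
    · obtain ⟨a, ha0, ha⟩ := exists_between (lt_min hu one_pos)
      have hmem : a ∈ Ioo (0 : ℝ) 1 := ⟨ha0, ha.trans_le (min_le_right _ _)⟩
      filter_upwards [Ioo_mem_nhdsGT (hBpos a hmem)] with b hb
      have := hmono hb.1 (hBpos a hmem) hb.2
      rw [hAB a hmem] at this
      exact this.trans (ha.trans_le (min_le_left _ _))
  · rw [tendsto_order]
    refine ⟨fun l hl => ?_, fun u hu => ?_⟩
    · obtain ⟨a, ha, ha1⟩ := exists_between (max_lt hl one_pos)
      have hmem : a ∈ Ioo (0 : ℝ) 1 := ⟨(le_max_right _ _).trans_lt ha, ha1⟩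
      filter_upwards [eventually_gt_atTop (B a)] with b hb
      have := hmono (hBpos a hmem) ((hBpos a hmem).trans hb) hb
      rw [hAB a hmem] at this
      exact ((le_max_left _ _).trans_lt ha).trans this
    · filter_upwards [eventually_gt_atTop 0] with b hb using (hAmem b hb).2.trans hu
  · obtain ⟨c, x, w, h⟩ := hB a ha
    have hb := hBpos a ha
    have hbL : Real.cosh (B a) = 1 / (1 / Real.cosh (B a)) := (one_div_one_div _).symm
    obtain ⟨Φ, hΦ⟩ := h.extremal.exists_isLift
    rw [h.bestError_eq]
    refine ⟨rfl, oddLaurent k c, oddLaurent_mem_approximants c, h.deviation_eq,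
      fun g hg hdev => h.eq_of_deviation_eq hg hdev, oddLaurent_neg c, fun φ hφ y hy =>
      ⟨Φ (Real.log y), h.extremal.hasBoundaryValue hΦ hb hbL hφ hy, h.extremal.oddLaurent_eq hΦ hy⟩⟩
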